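/- A Dyck bridge of size $N$ is a lattice path started at $(0,0)$ with $N$ steps $(+1,+1)$ and $N$ steps $(+1,-1)$ in any order; a Dyck excursion is a Dyck bridge that never reaches a negative height. The region between such a path $w$ and the horizontal axis is cut into $N$ connected horizontal slices: each step $i$ leading away from the axis, from height $h$, is paired with the first later step $j$ that returns to height $h$, and the slice $e=(i,j)$ has (odd) length $\ell_w(e)=j-i$. For $\omega:\mathbb N\to\mathbb R$ put $$A_{\omega}(w)=\sum_{e}\omega\Big(\tfrac{\ell_w(e)-1}{2}\Big).$$ Let $p>0$, $p\ne\frac12$. Define $\mu^{E}_0=-\frac12$, $\mu^{E}_1=\frac{1}{8\sqrt\pi}\Gamma(p-\frac12)$, and $$\mu^{E}_s=\mu^{E}_{s-1}\frac{\Gamma(s(p+\frac12)-1)}{2\,\Gamma(s(p+\frac12)-p-1)}+\sum_{k=1}^{s-1}\mu^{E}_k\mu^{E}_{s-k}\quad(s\ge2),$$ $$\mu^{B}_0=1,\qquad \mu^{B}_s=2\sum_{k=0}^{s-1}\mu^{B}_k\mu^{E}_{s-k}\quad(s\ge1),$$ and $$m^{E}_s=\frac{4\sqrt\pi\,s!}{\Gamma(s(p+\frac12)-\frac12)}\mu^{E}_s,\qquad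 m^{B}_s=\frac{\sqrt\pi\,s!}{\Gamma(s(p+\frac12)+\frac12)}\mu^{B}_s\quad(s\ge0).$$ Then for $X\in\{E,B\}$ there is exactly one probability measure $\rho^{X}(\cdot\,;p)$ on $\mathbb R$ with finite moments of all orders and $s$-th moment $m^X_s$ for all $s\ge0$. If $p>\frac12$, it is carried by $[0,\infty)$. Moreover, let $\eta>0$ and let $\omega:\mathbb N\to\mathbb R$ satisfy $\omega(k)=k^p(1+O(k^{-\eta}))$ as $k\to\infty$. Write $c_k=2^{-2k-1}\frac{1}{k+1}\binom{2k}{k}$ and $\theta=\min(p,\eta,\frac12)$, and say that $\alpha\in\mathbb R$ is admissible if, as $z\to1^-$, $$\sum_{k\ge0}c_k\,\omega(k)z^k=\alpha+\frac{\Gamma(p-\frac12)}{2\sqrt\pi}(1-z)^{\frac12-p}\Big(1+O\big((1-z)^{\min(\eta,\frac12)}\big)\Big).$$ 1. Unless $\eta=p-\frac12\le\frac12$, an admissible $\alpha$ exists. If $p-\frac12<\min(\eta,\frac12)$, it is unique. (Otherwise the term $\alpha N$ below does not exceed the stated error.) 2. Let $\alpha$ be admissible, and let $A_N$ be $A_\omega(w)$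 for $w$ uniformly distributed over the Dyck excursions ($X=E$) or the Dyck bridges ($X=B$) of size $N$. Then $$A_N\ \text{ is distributed as }\ \alpha N+x_pN^{p+\frac12}\big(1+O(N^{-\theta})\big),\qquad x_p\sim\rho^X(\cdot\,;p),$$ in the following sense: as $N\to\infty$, $(A_N-\alpha N)/N^{p+\frac12}$ converges in distribution to $\rho^{X}(\cdot\,;p)$, and for every integer $s\ge0$ $$\mathbb E\left[\left(\frac{A_N-\alpha N}{N^{p+\frac12}}\right)^{s}\right]=m^X_s+O(N^{-\theta}).$$ 3. If $\eta=p-\frac12\le\frac12$, then for every $\alpha\in\mathbb R$ the same convergence in distribution holds, and the same moment estimates hold with $O(N^{-\theta}\log N)$ in place of $O(N^{-\theta})$. -/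

import Mathlib

open Filter Topology MeasureTheory Asymptotics

noncomputable section

namespace PAiry

/-- The two ensembles of lattice paths: Dyck excursions (Dyck paths) and Dyck bridges. -/
inductive Ensemble
  | excursion
  | bridge

/-- The set of Dyck excursions of size `N`: `N` up-steps and `N` down-steps, never reaching
negative heights. -/
def excursions (N : ℕ) : Finset (List DyckStep) :=
  (Finset.univ : Finset {w : DyckWord // w.semilength = N}).image fun w => w.1.toList

/-- The set of Dyck bridges of size `N`: all sequences of `N` up-steps and `N` down-steps. -/
def bridges (N : ℕ) : Finset (List DyckStep) :=
  (List.replicate N DyckStep.U ++ List.replicate N DyckStep.D).permutations.toFinset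

/-- The set of paths of size `N` in an ensemble. -/
def paths : Ensemble → ℕ → Finset (List DyckStep)
  | .excursion => excursions
  | .bridge => bridges

/-- A list of steps is a bridge of size `N` iff it has `N` up-steps and `N` down-steps. -/
theorem mem_bridges {N : ℕ} {l : List DyckStep} :
    l ∈ bridges N ↔ l.count DyckStep.U = N ∧ l.count DyckStep.D = N := by
  simp only [bridges, List.mem_toFinset, List.mem_permutations, List.perm_iff_count]
  constructor
  · intro h
    constructor
    · simpa [List.count_replicate] using h DyckStep.U
    · simpa [List.count_replicate] using h DyckStep.D
  · rintro ⟨hU, hD⟩ s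
    cases s <;> simp [List.count_replicate, hU, hD]

theorem paths_nonempty (e : Ensemble) (N : ℕ) : (paths e N).Nonempty := by
  cases e with
  | excursion =>
    have h : 0 < Fintype.card {w : DyckWord // w.semilength = N} := by
      rw [DyckWord.card_dyckWord_semilength_eq_catalan]
      have := succ_mul_catalan_eq_centralBinom N
      have := Nat.centralBinom_pos N
      exact Nat.pos_of_ne_zero fun h0 => by simp_all
    obtain ⟨w⟩ := Fintype.card_pos_iff.1 h
    exact ⟨_, Finset.mem_image_of_mem _ (Finset.mem_univ w)⟩
  | bridge =>
    exact ⟨List.replicate N DyckStep.U ++ List.replicate N DyckStep.D,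
      mem_bridges.2 (by simp [List.count_replicate])⟩

/-- The height of the path `w` after `k` steps. -/
def height (w : List DyckStep) (k : ℕ) : ℤ :=
  ((w.take k).count DyckStep.U : ℤ) - ((w.take k).count DyckStep.D : ℤ)

/-- The connected horizontal slices of `w`. A slice is recorded by the positions `i < j` (counted
from `0`) of the two steps that bound it: step `i` leaves the height `h = height w i` away from the
axis, and step `j` is the first later step that comes back to `h`. The slice sits half a unit
beyond `h` and extends horizontally from `i + 1/2` to `j + 1/2`. -/
def slices (w : List DyckStep) : Finset (ℕ × ℕ) :=
  (Finset.range w.length ×ˢ Finset.range w.length).filter fun e =>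
    e.1 < e.2 ∧ height w (e.2 + 1) = height w e.1 ∧
      ∀ k ∈ Finset.Ioc e.1 e.2, |height w e.1| < |height w k|

/-- The length `ℓ` of a horizontal slice. It is always odd. -/
def sliceLength (e : ℕ × ℕ) : ℕ := e.2 - e.1

/-- The cost `A_ω(w) = ∑_e ω((ℓ(e) - 1) / 2)`, the sum running over the horizontal slices of `w`.
As `ℓ(e)` is odd, the division is exact. -/
def cost (ω : ℕ → ℝ) (w : List DyckStep) : ℝ :=
  ∑ e ∈ slices w, ω ((sliceLength e - 1) / 2)

/-- The law of `(A_ω - α N) / N ^ (p + 1/2)` for a uniformly random path of size `N`. -/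
def rescaledLaw (e : Ensemble) (ω : ℕ → ℝ) (p α : ℝ) (N : ℕ) : ProbabilityMeasure ℝ :=
  ⟨((PMF.uniformOfFinset (paths e N) (paths_nonempty e N)).map
      fun w => (cost ω w - α * N) / (N : ℝ) ^ (p + 1 / 2)).toMeasure, inferInstance⟩

/-- The coefficients `μ_s` of the excursions; in the last line `s = n + 2`, and the sum is
`∑ μ_k μ_{s-k}` over `1 ≤ k ≤ s - 1`. -/
def muE (p : ℝ) : ℕ → ℝ
  | 0 => -1 / 2
  | 1 => Real.Gamma (p - 1 / 2) / (8 * √Real.pi)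
  | n + 2 =>
    muE p (n + 1) *
        (Real.Gamma ((n + 2) * (p + 1 / 2) - 1) /
          (2 * Real.Gamma ((n + 2) * (p + 1 / 2) - p - 1))) +
      ∑ k : Fin (n + 1), muE p (k + 1) * muE p (n + 1 - k)

/-- The coefficients `μ_s` of the bridges; in the last line `s = n + 1`, and the sum is
`∑ μ^B_k μ^E_{s-k}` over `0 ≤ k ≤ s - 1`. -/
def muB (p : ℝ) : ℕ → ℝ
  | 0 => 1
  | n + 1 => 2 * ∑ k : Fin (n + 1), muB p k * muE p (n + 1 - k)

/-- The `s`-th moment of the limit law. -/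
def limitMoment (e : Ensemble) (p : ℝ) (s : ℕ) : ℝ :=
  match e with
  | .excursion =>
    4 * √Real.pi * (s.factorial : ℝ) / Real.Gamma (s * (p + 1 / 2) - 1 / 2) * muE p s
  | .bridge =>
    √Real.pi * (s.factorial : ℝ) / Real.Gamma (s * (p + 1 / 2) + 1 / 2) * muB p s

/-- `ρ` has finite moments of all orders, given by the sequence `m`. -/
def HasMoments (ρ : ProbabilityMeasure ℝ) (m : ℕ → ℝ) : Prop :=
  ∀ s : ℕ, Integrable (fun x : ℝ => x ^ s) (ρ : Measure ℝ) ∧ ∫ x, x ^ s ∂(ρ : Measure ℝ) = m s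

/-- `ω(k) = k ^ p (1 + O(k ^ (-η)))` for large `k`. -/
def HasGrowth (ω : ℕ → ℝ) (p η : ℝ) : Prop :=
  (fun k : ℕ => ω k - (k : ℝ) ^ p) =O[atTop] fun k : ℕ => (k : ℝ) ^ (p - η)

/-- The normalized Catalan numbers `c_k = 2 ^ (-2k-1) C_k`. -/
def normCatalan (k : ℕ) : ℝ := (catalan k : ℝ) / 2 ^ (2 * k + 1)

/-- `α` is the constant `α(ω)`, the constant term in the expansion
`∑ c_k ω(k) z ^ k = α + Γ(p - 1/2) / (2 √π) (1 - z) ^ (1/2 - p) (1 + O((1 - z) ^ min(η, 1/2)))`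
as `z → 1` from below. -/
def IsAlpha (ω : ℕ → ℝ) (p η α : ℝ) : Prop :=
  (fun z : ℝ => (∑' k : ℕ, normCatalan k * ω k * z ^ k) - α
      - Real.Gamma (p - 1 / 2) / (2 * √Real.pi) * (1 - z) ^ (1 / 2 - p))
    =O[𝓝[<] 1] fun z : ℝ => (1 - z) ^ (1 / 2 - p + min η (1 / 2))

end PAiry

end

/-!
# Limit laws for additive functionals of Dyck paths

The expected value of `A_ω ^ s / s!` over the paths of size `N` is a quotient of the coefficients
of two generating series, `momentSeries e ω s` and `momentSeries e ω 0`. The theorem follows from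
asymptotic expansions of these coefficients together with the method of moments.

*Recursion.* Cutting a path at its first return to the axis turns into a quadratic recursion for
the moment series of excursions (`excursionRec`) and a linear one for those of bridges
(`bridgeRec`). The slice spanned by the first arch costs `ω n` if the arch encloses an excursion of
size `n`, so it enters through coefficientwise products with the powers of `ω` (`hadamard`,
`archSeries`). Since `1 - X / 2 * e 0 = (1 - X) ^ (1 / 2)`, both recursions can be solved for the
`s`-th series, by multiplication by `(1 - X) ^ (-1 / 2)`. Every path of size `N` has `N` slices, so
centring the cost by `α N` means replacing `ω` by `ω - α` (`cost_sub_const`).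

*Expansions.* No complex analysis is used. A series is said to behave like `C (1 - X) ^ (-β)`, with
relative error of order `(1 - X) ^ θ`, if the difference has small coefficients and small partial
sums (`Asy`, `Err`). The condition on the partial sums carries information only if the order `γ` of
the error is at most `0`: for `γ < 0` it says that the partial sums tend to `0`, that is, that the
expansion has no constant term. These expansions are preserved by the operations that occur in the
recursion: products, multiplication by powers of `1 - X`, and coefficientwise products with `ω`. By
induction on `s`, the leading constants obey the recursions that define `muE` and `muB`
(`ExcursionRec.asy`, `BridgeRec.asy`). The induction starts from the series `∑ c_k (ω k - α) z ^
k`, and this is where the admissibility of `α` is used: an elementary Tauberian argument turns its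
defining estimate as `z → 1` into a bound for partial sums (`IsAlpha.asy`). In the critical case `η
= p - 1 / 2` the partial sums are `O(log n)` for every `α` (`HasGrowth.asy_log`); the calculus
admits such a slowly varying factor (`IsGauge`) throughout.

*Limit law.* The limiting moments are `O(K ^ s * √s!)`, so they determine a law through its
characteristic function, and convergence of moments implies convergence in distribution
(`HasMoments.unique`, `HasMoments.tendsto`). A law with these moments exists as a limit point of the
tight sequence of rescaled laws for `ω k = k ^ p` (`exists_hasMoments`). For `p > 1 / 2` that cost
function may be used without centring, and it is nonnegative (`measure_Iio_zero`).
-/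

noncomputable section

namespace PAiry

open PowerSeries (coeff)
open Finset.HasAntidiagonal (antidiagonal)

/-! ### The power series `(1 - X) ^ (-β)` -/

/-- The coefficient of `X ^ n` in `(1 - X) ^ (-β)`, that is `β (β + 1) ⋯ (β + n - 1) / n!`. -/
def powCoeff (β : ℝ) : ℕ → ℝ
  | 0 => 1
  | n + 1 => powCoeff β n * (β + n) / (n + 1)

/-- The formal power series `(1 - X) ^ (-β)`. -/
def powSeries (β : ℝ) : PowerSeries ℝ := PowerSeries.mk (powCoeff β)

@[simp] theorem coeff_powSeries (β : ℝ) (n : ℕ) : coeff n (powSeries β) = powCoeff β n := by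
  simp [powSeries]

theorem one_sub_X_mul_coeff (F : PowerSeries ℝ) (n : ℕ) :
    coeff (n + 1) ((1 - PowerSeries.X) * F) = coeff (n + 1) F - coeff n F := by
  rw [sub_mul, one_mul, map_sub, PowerSeries.coeff_succ_X_mul]

theorem powSeries_ode (β : ℝ) :
    (1 - PowerSeries.X) * PowerSeries.derivative ℝ (powSeries β) =
      PowerSeries.C β * powSeries β := by
  ext n
  cases n with
  | zero =>
    have := PowerSeries.coeff_derivative (powSeries β) 0
    simp [powCoeff] at this ⊢
    exact this
  | succ n =>
    rw [one_sub_X_mul_coeff, PowerSeries.coeff_derivative, PowerSeries.coeff_derivative,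
      PowerSeries.coeff_C_mul]
    simp only [coeff_powSeries, powCoeff]
    push_cast
    field_simp
    ring

/-- `(1 - X) ^ (-β)` is characterised by its differential equation `(1 - X) F' = β F`. -/
theorem eq_powSeries_of_ode {β : ℝ} {F : PowerSeries ℝ} (h0 : coeff 0 F = 1)
    (h : (1 - PowerSeries.X) * PowerSeries.derivative ℝ F = PowerSeries.C β * F) :
    F = powSeries β := by
  ext n
  rw [coeff_powSeries]
  induction n with
  | zero => simpa [powCoeff] using h0
  | succ n ih =>
    have h1 := congrArg (coeff n) h
    have h2 : coeff n ((1 - PowerSeries.X) * PowerSeries.derivative ℝ F)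
        = coeff (n + 1) F * (n + 1) - n * coeff n F := by
      cases n with
      | zero =>
        have := PowerSeries.coeff_derivative F 0
        simp at this ⊢
        exact this
      | succ n =>
        rw [one_sub_X_mul_coeff, PowerSeries.coeff_derivative, PowerSeries.coeff_derivative]
        push_cast; ring
    rw [h2, PowerSeries.coeff_C_mul] at h1
    rw [powCoeff, ← ih]
    field_simp
    linarith

theorem powSeries_mul (α β : ℝ) : powSeries α * powSeries β = powSeries (α + β) := by
  apply eq_powSeries_of_ode
  · simp [powSeries, powCoeff]
  · have hα := powSeries_ode α
    have hβ := powSeries_ode β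
    rw [Derivation.leibniz, smul_eq_mul, smul_eq_mul, map_add]
    linear_combination powSeries α * hβ + powSeries β * hα

@[simp] theorem powSeries_zero : powSeries 0 = 1 := by
  refine (eq_powSeries_of_ode (by simp) ?_).symm
  rw [Derivation.map_one_eq_zero]
  simp

theorem powSeries_neg_one : powSeries (-1) = 1 - PowerSeries.X := by
  refine (eq_powSeries_of_ode (by simp) ?_).symm
  simp

theorem powCoeff_one (n : ℕ) : powCoeff 1 n = 1 := by
  induction n with
  | zero => rfl
  | succ n ih => rw [powCoeff, ih]; field_simp; ring

theorem powSeries_derivative (β : ℝ) :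
    PowerSeries.derivative ℝ (powSeries β) = PowerSeries.C β * powSeries (β + 1) := by
  have h := powSeries_ode β
  rw [← powSeries_neg_one] at h
  have h1 : powSeries 1 * powSeries (-1) = 1 := by rw [powSeries_mul]; simp
  have h2 := powSeries_mul β 1
  linear_combination powSeries 1 * h - PowerSeries.derivative ℝ (powSeries β) * h1 +
    PowerSeries.C β * h2

/-- Multiplication by `(1 - X)⁻¹` forms partial sums. -/
theorem coeff_powSeries_one_mul (F : PowerSeries ℝ) (n : ℕ) :
    coeff n (powSeries 1 * F) = ∑ k ∈ Finset.range (n + 1), coeff k F := by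
  rw [mul_comm, PowerSeries.coeff_mul, Finset.Nat.sum_antidiagonal_eq_sum_range_succ_mk]
  simp [powCoeff_one]

theorem powCoeff_pos {β : ℝ} (hβ : 0 < β) (n : ℕ) : 0 < powCoeff β n := by
  induction n with
  | zero => simp [powCoeff]
  | succ n ih => rw [powCoeff]; positivity

theorem powCoeff_eq_mul (β : ℝ) (n : ℕ) :
    powCoeff β n * (β + n) = β * powCoeff (β + 1) n := by
  induction n with
  | zero => simp [powCoeff]
  | succ n ih =>
    rw [powCoeff, powCoeff]
    push_cast
    linear_combination (β + (n + 1)) / (n + 1) * ih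

theorem powCoeff_eq_choose (β : ℝ) (n : ℕ) : Ring.choose (β + n - 1) n = powCoeff β n := by
  rw [← Ring.multichoose_eq]
  have h : ∀ m : ℕ, (ascPochhammer ℕ m).smeval β = m.factorial * powCoeff β m := by
    intro m
    induction m with
    | zero => simp [powCoeff]
    | succ m ih =>
      rw [ascPochhammer_succ_right, Polynomial.smeval_mul, ih, powCoeff, Nat.factorial_succ]
      have : ((Polynomial.X + (m : Polynomial ℕ)).smeval β) = β + m := by
        rw [Polynomial.smeval_add, Polynomial.smeval_X, Polynomial.smeval_natCast]; simp
      rw [this]; push_cast; field_simp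
  have h1 := Ring.factorial_nsmul_multichoose_eq_ascPochhammer β n
  rw [h, nsmul_eq_mul] at h1
  exact mul_left_cancel₀ (by positivity) h1

/-- The binomial series on `[0, 1)`. -/
theorem hasSum_powCoeff (β : ℝ) {z : ℝ} (h0 : 0 ≤ z) (h1 : z < 1) :
    HasSum (fun n => powCoeff β n * z ^ n) ((1 - z) ^ (-β)) := by
  have h := (Real.one_div_one_sub_rpow_hasFPowerSeriesOnBall_zero β).hasSum (y := z) (by
    simp [enorm_eq_nnnorm]
    rw [← NNReal.coe_lt_coe]; simpa [abs_of_nonneg h0])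
  simp only [FormalMultilinearSeries.ofScalars_apply_eq, powCoeff_eq_choose, smul_eq_mul,
    zero_add] at h
  rwa [Real.rpow_neg (by linarith), ← one_div]

/-! ### Asymptotics of the coefficients of `(1 - X) ^ (-β)` -/

/-- Upper half of the two-sided estimate of `Γ (x + b) / Γ x` that follows from the convexity
of `log ∘ Γ`. -/
theorem Gamma_add_le {x b : ℝ} (hx : 0 < x) (hb : 0 < b) :
    Real.Gamma (x + b) ≤ Real.Gamma x * (x + b) ^ b := by
  have hc := Real.convexOn_log_Gamma.slope_mono_adjacent (x := x) (y := x + b) (z := x + b + 1)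
    (by simpa using hx) (Set.mem_Ioi.2 (by linarith)) (by linarith) (by linarith)
  simp only [Function.comp] at hc
  rw [Real.Gamma_add_one (by linarith : x + b ≠ 0), Real.log_mul (by linarith)
    (Real.Gamma_pos_of_pos (by linarith)).ne'] at hc
  have : Real.log (Real.Gamma (x + b)) ≤ Real.log (Real.Gamma x * (x + b) ^ b) := by
    rw [Real.log_mul (Real.Gamma_pos_of_pos hx).ne' (by positivity), Real.log_rpow (by linarith)]
    have h3 : x + b - x = b := by ring
    have h4 : x + b + 1 - (x + b) = 1 := by ring
    rw [h3, h4, div_le_iff₀ hb] at hc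
    linarith
  exact (Real.log_le_log_iff (Real.Gamma_pos_of_pos (by linarith))
    (mul_pos (Real.Gamma_pos_of_pos hx) (by positivity))).1 this

/-- Lower half of the estimate of `Γ (x + b) / Γ x`. -/
theorem le_Gamma_add {x b : ℝ} (hx : 1 < x) (hb : 0 < b) :
    Real.Gamma x * (x - 1) ^ b ≤ Real.Gamma (x + b) := by
  have hc := Real.convexOn_log_Gamma.slope_mono_adjacent (x := x - 1) (y := x) (z := x + b)
    (Set.mem_Ioi.2 (by linarith)) (Set.mem_Ioi.2 (by linarith)) (by linarith) (by linarith)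
  simp only [Function.comp] at hc
  have hG : Real.Gamma x = (x - 1) * Real.Gamma (x - 1) := by
    rw [← Real.Gamma_add_one (by linarith : x - 1 ≠ 0)]; congr 1; ring
  have hx1 : 0 < x - 1 := by linarith
  have h1 : Real.log (Real.Gamma x) - Real.log (Real.Gamma (x - 1)) = Real.log (x - 1) := by
    rw [hG, Real.log_mul hx1.ne' (Real.Gamma_pos_of_pos hx1).ne']; ring
  have : Real.log (Real.Gamma x * (x - 1) ^ b) ≤ Real.log (Real.Gamma (x + b)) := by
    rw [Real.log_mul (Real.Gamma_pos_of_pos (by linarith)).ne' (by positivity), Real.log_rpow hx1]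
    have h3 : x - (x - 1) = 1 := by ring
    have h4 : x + b - x = b := by ring
    rw [h1, h3, h4, le_div_iff₀ hb] at hc
    linarith
  exact (Real.log_le_log_iff (mul_pos (Real.Gamma_pos_of_pos (by linarith)) (by positivity))
    (Real.Gamma_pos_of_pos (by linarith))).1 this

theorem powCoeff_eq_Gamma {β : ℝ} (hβ : 0 < β) (n : ℕ) :
    powCoeff β n = Real.Gamma (n + β) / (Real.Gamma β * n.factorial) := by
  have hG := (Real.Gamma_pos_of_pos hβ).ne'
  induction n with
  | zero => simp [powCoeff, hG]
  | succ n ih =>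
    have : Real.Gamma ((n + 1 : ℕ) + β) = (n + β) * Real.Gamma (n + β) := by
      rw [← Real.Gamma_add_one (by positivity)]; congr 1; push_cast; ring
    rw [powCoeff, ih, this, Nat.factorial_succ]
    push_cast
    field_simp
    ring

/-- `x ↦ x ^ b` is Lipschitz on compact subintervals of `(0, ∞)`. -/
theorem exists_abs_rpow_sub_rpow_le (b : ℝ) {u v : ℝ} (hu : 0 < u) :
    ∃ C, 0 ≤ C ∧ ∀ x ∈ Set.Icc u v, ∀ y ∈ Set.Icc u v, |x ^ b - y ^ b| ≤ C * |x - y| := by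
  have hcont : ContinuousOn (fun x : ℝ => b * x ^ (b - 1)) (Set.Icc u v) := by
    intro x hx
    exact (continuousAt_const.mul (Real.continuousAt_rpow_const _ _
      (Or.inl (by linarith [hx.1])))).continuousWithinAt
  obtain ⟨C, hC⟩ := isCompact_Icc.exists_bound_of_continuousOn hcont
  refine ⟨max C 0, le_max_right _ _, fun x hx y hy => ?_⟩
  have := (convex_Icc u v).norm_image_sub_le_of_norm_hasDerivWithin_le
    (f := fun x : ℝ => x ^ b) (f' := fun x : ℝ => b * x ^ (b - 1)) (C := max C 0)
    (fun z hz => (Real.hasDerivAt_rpow_const (Or.inl (by linarith [hz.1]))).hasDerivWithinAt)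
    (fun z hz => (hC z hz).trans (le_max_left _ _)) hy hx
  simpa using this

/-- A bound for all but finitely many terms against a positive sequence extends to all terms. -/
theorem exists_forall_abs_le {f g : ℕ → ℝ} (hg : ∀ n, 0 < g n) {C : ℝ} {m : ℕ}
    (h : ∀ n, m ≤ n → |f n| ≤ C * g n) : ∃ C, 0 ≤ C ∧ ∀ n, |f n| ≤ C * g n := by
  have hO : f =O[atTop] g := IsBigO.of_bound C (by
    filter_upwards [eventually_ge_atTop m] with n hn
    simpa [abs_of_pos (hg n)] using h n hn)
  obtain ⟨C, hC, hb⟩ := bound_of_isBigO_nat_atTop hO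
  exact ⟨C, hC.le, fun n => by simpa [abs_of_pos (hg n)] using hb (hg n).ne'⟩

theorem powCoeff_asymp_of_pos {β : ℝ} (hβ : 0 < β) : ∃ C, 0 ≤ C ∧ ∀ n : ℕ,
    |powCoeff β n - ((n : ℝ) + 1) ^ (β - 1) / Real.Gamma β| ≤ C * ((n : ℝ) + 1) ^ (β - 2) := by
  obtain ⟨K, hK0, hK⟩ := exists_abs_rpow_sub_rpow_le β (u := 1 / 2) (v := 1 + β) (by norm_num)
  have hG := Real.Gamma_pos_of_pos hβ
  refine exists_forall_abs_le (fun n => by positivity)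
    (C := 2 * (K * (1 + β) + |1 - β|) / Real.Gamma β) (m := 1) fun n hn => ?_
  have hn1 : (1 : ℝ) ≤ n := by exact_mod_cast hn
  set N : ℝ := (n : ℝ) + 1 with hN
  have hN0 : 0 < N := by positivity
  have hnb : N / 2 ≤ n + β := by linarith
  set P : ℝ := Real.Gamma (n + 1 + β) / n.factorial with hP
  have hPc : powCoeff β n = P / ((n + β) * Real.Gamma β) := by
    rw [powCoeff_eq_Gamma hβ, hP]
    have : Real.Gamma (n + 1 + β) = (n + β) * Real.Gamma (n + β) := by
      rw [← Real.Gamma_add_one (by positivity)]; congr 1; ring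
    rw [this]; field_simp
  have hfac : (n.factorial : ℝ) = Real.Gamma (n + 1) := (Real.Gamma_nat_eq_factorial n).symm
  have hP1 : P ≤ (N + β) ^ β := by
    rw [hP, div_le_iff₀ (by positivity), hfac, mul_comm]
    exact Gamma_add_le hN0 hβ
  have hP2 : (N - 1) ^ β ≤ P := by
    rw [hP, le_div_iff₀ (by positivity), hfac, mul_comm]
    exact le_Gamma_add (by linarith) hβ
  have hscale : ∀ t : ℝ, -1 / 2 ≤ t / N → t / N ≤ β →
      |(N + t) ^ β - N ^ β| ≤ K * |t| * N ^ (β - 1) := by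
    intro t h1 h2
    have := hK (1 + t / N) ⟨by linarith, by linarith⟩ 1 ⟨by norm_num, by linarith⟩
    have e : N + t = N * (1 + t / N) := by field_simp
    rw [e, Real.mul_rpow hN0.le (by linarith)]
    rw [Real.one_rpow] at this
    calc |N ^ β * (1 + t / N) ^ β - N ^ β| = N ^ β * |(1 + t / N) ^ β - 1| := by
          rw [← abs_of_pos (Real.rpow_pos_of_pos hN0 β), ← abs_mul,
            abs_of_pos (Real.rpow_pos_of_pos hN0 β)]; ring_nf
      _ ≤ N ^ β * (K * |1 + t / N - 1|) := by gcongr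
      _ = K * |t| * N ^ (β - 1) := by
          rw [Real.rpow_sub_one hN0.ne', add_sub_cancel_left, abs_div, abs_of_pos hN0]; field_simp
  have hPN : |P - N ^ β| ≤ K * (1 + β) * N ^ (β - 1) := by
    have h1 := hscale β (by have : 0 ≤ β / N := by positivity
                            linarith) (by rw [div_le_iff₀ hN0]; nlinarith)
    have h2 := hscale (-1) (by rw [le_div_iff₀ hN0]; linarith)
      (by have : -1 / N ≤ 0 := by rw [neg_div]; simp; positivity
          linarith)
    rw [abs_of_pos hβ] at h1
    rw [abs_neg, abs_one] at h2
    have e2 : N + -1 = N - 1 := by ring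
    rw [e2] at h2
    rw [abs_le] at h1 h2 ⊢
    have hx : 0 ≤ K * N ^ (β - 1) := by positivity
    constructor <;> nlinarith [h1.1, h1.2, h2.1, h2.2, mul_nonneg hx hβ.le]
  have key : powCoeff β n - N ^ (β - 1) / Real.Gamma β
      = ((P - N ^ β) + N ^ (β - 1) * (1 - β)) / ((n + β) * Real.Gamma β) := by
    rw [hPc, Real.rpow_sub_one hN0.ne']
    field_simp
    rw [hN]; ring
  have hden : 0 < (n + β) * Real.Gamma β := by positivity
  rw [key, abs_div, abs_of_pos hden, div_le_iff₀ hden]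
  have hN2 : N ^ (β - 1) = N ^ (β - 2) * N := by
    rw [← Real.rpow_add_one hN0.ne']; congr 1; ring
  calc |(P - N ^ β) + N ^ (β - 1) * (1 - β)| ≤ |P - N ^ β| + |N ^ (β - 1) * (1 - β)| :=
        abs_add_le _ _
    _ ≤ K * (1 + β) * N ^ (β - 1) + N ^ (β - 1) * |1 - β| := by
        rw [abs_mul, abs_of_pos (Real.rpow_pos_of_pos hN0 _)]; gcongr
    _ = 2 * (K * (1 + β) + |1 - β|) * N ^ (β - 2) * (N / 2) := by rw [hN2]; ring
    _ ≤ 2 * (K * (1 + β) + |1 - β|) * N ^ (β - 2) * (n + β) := by gcongr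
    _ = _ := by field_simp

/-- `[X ^ n] (1 - X) ^ (-β) = (n + 1) ^ (β - 1) / Γ β + O(n ^ (β - 2))`. For `β = 0` the value
`Γ 0 = 0` makes the main term vanish, as it should. -/
theorem powCoeff_asymp {β : ℝ} (hβ : -1 < β) : ∃ C, 0 ≤ C ∧ ∀ n : ℕ,
    |powCoeff β n - ((n : ℝ) + 1) ^ (β - 1) / Real.Gamma β| ≤ C * ((n : ℝ) + 1) ^ (β - 2) := by
  rcases lt_trichotomy β 0 with h | h | h
  · obtain ⟨K, hK0, hK⟩ := powCoeff_asymp_of_pos (β := β + 1) (by linarith)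
    refine exists_forall_abs_le (fun n => by positivity)
      (C := 2 / (1 + β) * (|β| * K + |1 - β| * |(Real.Gamma β)⁻¹|)) (m := 1) fun n hn => ?_
    have hn1 : (1 : ℝ) ≤ n := by exact_mod_cast hn
    have hK := hK n
    set N : ℝ := (n : ℝ) + 1 with hN
    have hN0 : 0 < N := by positivity
    have hnb : (1 + β) / 2 * N ≤ n + β := by
      rw [hN]; nlinarith [mul_nonneg (sub_nonneg.2 hn1) (by linarith : 0 ≤ 1 - β)]
    have hnb0 : 0 < n + β := by linarith
    have hc := powCoeff_eq_mul β n
    have hGa : Real.Gamma (β + 1) = β * Real.Gamma β := Real.Gamma_add_one h.ne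
    have hG0 : Real.Gamma β ≠ 0 := by
      refine Real.Gamma_ne_zero fun m hm => ?_
      rcases m with _ | m
      · simp at hm; linarith
      · push_cast at hm; have : (0 : ℝ) ≤ m := by positivity
        linarith
    have e1 : β + 1 - 1 = β := by ring
    have e2 : β + 1 - 2 = β - 1 := by ring
    rw [e1, e2, hGa] at hK
    have hN1 : N ^ β = N ^ (β - 1) * N := by
      rw [← Real.rpow_add_one hN0.ne']; congr 1; ring
    have hN2 : N ^ (β - 1) = N ^ (β - 2) * N := by
      rw [← Real.rpow_add_one hN0.ne']; congr 1; ring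
    have key : (powCoeff β n - N ^ (β - 1) / Real.Gamma β) * (n + β)
        = β * (powCoeff (β + 1) n - N ^ β / (β * Real.Gamma β))
          + N ^ (β - 1) * (1 - β) * (Real.Gamma β)⁻¹ := by
      have : β ≠ 0 := h.ne
      rw [hN1]
      field_simp
      rw [hN]
      linear_combination Real.Gamma β * hc
    have hb : |powCoeff β n - N ^ (β - 1) / Real.Gamma β| * (n + β) ≤
        2 / (1 + β) * (|β| * K + |1 - β| * |(Real.Gamma β)⁻¹|) * N ^ (β - 2) * (n + β) := by
      calc |powCoeff β n - N ^ (β - 1) / Real.Gamma β| * (n + β)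
          = |(powCoeff β n - N ^ (β - 1) / Real.Gamma β) * (n + β)| := by
            rw [abs_mul, abs_of_pos hnb0]
        _ ≤ |β| * (K * N ^ (β - 1)) + N ^ (β - 1) * |1 - β| * |(Real.Gamma β)⁻¹| := by
            rw [key]
            refine (abs_add_le _ _).trans ?_
            rw [abs_mul, abs_mul, abs_mul, abs_of_pos (Real.rpow_pos_of_pos hN0 (β - 1))]
            gcongr
        _ = 2 / (1 + β) * (|β| * K + |1 - β| * |(Real.Gamma β)⁻¹|) * N ^ (β - 2) *
              ((1 + β) / 2 * N) := by
            have : 1 + β ≠ 0 := by linarith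
            rw [hN2]; field_simp
        _ ≤ _ := by
            have : 0 < 1 + β := by linarith
            gcongr
    exact le_of_mul_le_mul_right hb hnb0
  · subst h
    refine ⟨1, zero_le_one, fun n => ?_⟩
    have : powCoeff 0 n = if n = 0 then 1 else 0 := by
      rw [← coeff_powSeries, powSeries_zero, PowerSeries.coeff_one]
    rw [this]
    split_ifs with hn
    · simp [hn]
    · simp; positivity
  · exact powCoeff_asymp_of_pos h

theorem abs_powCoeff_le {β : ℝ} (hβ : -1 < β) :
    ∃ C, 0 ≤ C ∧ ∀ n : ℕ, |powCoeff β n| ≤ C * ((n : ℝ) + 1) ^ (β - 1) := by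
  obtain ⟨C, hC0, hC⟩ := powCoeff_asymp hβ
  refine ⟨C + |(Real.Gamma β)⁻¹|, by positivity, fun n => ?_⟩
  have hN : (1 : ℝ) ≤ (n : ℝ) + 1 := by simp
  have h1 : ((n : ℝ) + 1) ^ (β - 2) ≤ ((n : ℝ) + 1) ^ (β - 1) :=
    Real.rpow_le_rpow_of_exponent_le hN (by linarith)
  calc |powCoeff β n| ≤ |powCoeff β n - ((n : ℝ) + 1) ^ (β - 1) / Real.Gamma β|
        + |((n : ℝ) + 1) ^ (β - 1) / Real.Gamma β| := by
          simpa using abs_add_le (powCoeff β n - ((n : ℝ) + 1) ^ (β - 1) / Real.Gamma β)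
            (((n : ℝ) + 1) ^ (β - 1) / Real.Gamma β)
    _ ≤ C * ((n : ℝ) + 1) ^ (β - 1) + |(Real.Gamma β)⁻¹| * ((n : ℝ) + 1) ^ (β - 1) := by
        gcongr
        · exact (hC n).trans (by gcongr)
        · rw [div_eq_mul_inv, abs_mul, mul_comm, abs_of_pos (a := ((n : ℝ) + 1) ^ (β - 1))
            (by positivity)]
    _ = _ := by ring

theorem rpow_le_mul_powCoeff {β : ℝ} (hβ : 0 < β) :
    ∃ C, 0 ≤ C ∧ ∀ n : ℕ, ((n : ℝ) + 1) ^ (β - 1) ≤ C * powCoeff β n := by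
  have hG := Real.Gamma_pos_of_pos hβ
  have hmain : ∀ n : ℕ, 1 ≤ n → |((n : ℝ) + 1) ^ (β - 1)| ≤
      (2 ^ β * (1 + β) * Real.Gamma β) * powCoeff β n := by
    intro n hn
    have hn1 : (1 : ℝ) ≤ n := by exact_mod_cast hn
    rw [abs_of_pos (by positivity), powCoeff_eq_Gamma hβ]
    have h2 := le_Gamma_add (x := n + 1) (b := β) (by linarith) hβ
    have h3 : Real.Gamma (n + 1 + β) = (n + β) * Real.Gamma (n + β) := by
      rw [← Real.Gamma_add_one (by positivity)]; congr 1; ring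
    rw [h3, add_sub_cancel_right, Real.Gamma_nat_eq_factorial] at h2
    have h4 : ((n : ℝ) + 1) ^ β ≤ 2 ^ β * (n : ℝ) ^ β := by
      rw [← Real.mul_rpow (by norm_num) (by positivity)]
      gcongr; linarith
    have h5 : n + β ≤ (1 + β) * ((n : ℝ) + 1) := by nlinarith
    have hGn : 0 < Real.Gamma (n + β) := Real.Gamma_pos_of_pos (by positivity)
    have e : 2 ^ β * (1 + β) * Real.Gamma β * (Real.Gamma (n + β) / (Real.Gamma β * n.factorial))
      = 2 ^ β * (1 + β) * Real.Gamma (n + β) / n.factorial := by field_simp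
    rw [e, le_div_iff₀ (by positivity), Real.rpow_sub_one (by positivity), div_mul_eq_mul_div,
      div_le_iff₀ (by positivity)]
    calc ((n : ℝ) + 1) ^ β * n.factorial ≤ 2 ^ β * (n : ℝ) ^ β * n.factorial := by gcongr
      _ = 2 ^ β * (n.factorial * (n : ℝ) ^ β) := by ring
      _ ≤ 2 ^ β * ((n + β) * Real.Gamma (n + β)) := by gcongr
      _ ≤ 2 ^ β * ((1 + β) * ((n : ℝ) + 1) * Real.Gamma (n + β)) := by gcongr
      _ = _ := by ring
  obtain ⟨C, hC, h⟩ := exists_forall_abs_le (fun n => powCoeff_pos hβ n) hmain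
  exact ⟨C, hC, fun n => (le_abs_self _).trans (h n)⟩

/-! ### Calculus of coefficient bounds -/

/-- A slowly varying factor that error terms may carry: in the applications it is either constantly
`1` or `1 + log (n + 1)`. -/
structure IsGauge (L : ℕ → ℝ) : Prop where
  mono : Monotone L
  one_le : ∀ n, 1 ≤ L n
  le_rpow : ∀ ε : ℝ, 0 < ε → ∃ C, 0 ≤ C ∧ ∀ n : ℕ, L n ≤ C * ((n : ℝ) + 1) ^ ε

theorem IsGauge.pos {L : ℕ → ℝ} (hL : IsGauge L) (n : ℕ) : 0 < L n :=
  zero_lt_one.trans_le (hL.one_le n)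

theorem isGauge_one : IsGauge fun _ => 1 where
  mono := monotone_const
  one_le _ := le_rfl
  le_rpow ε hε := ⟨1, zero_le_one, fun n => by
    rw [one_mul]; exact Real.one_le_rpow (by simp) hε.le⟩

theorem isGauge_log : IsGauge fun n => 1 + Real.log ((n : ℝ) + 1) where
  mono m n h := by
    have : (m : ℝ) ≤ n := by exact_mod_cast h
    dsimp only
    gcongr
  one_le n := by have := Real.log_nonneg (x := (n : ℝ) + 1) (by simp); linarith
  le_rpow ε hε := ⟨1 + 1 / ε, by positivity, fun n => by
    have h1 := Real.log_le_rpow_div (x := (n : ℝ) + 1) (by positivity) hε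
    have h2 : 1 ≤ ((n : ℝ) + 1) ^ ε := Real.one_le_rpow (by simp) hε.le
    calc 1 + Real.log ((n : ℝ) + 1) ≤ ((n : ℝ) + 1) ^ ε + ((n : ℝ) + 1) ^ ε / ε := by gcongr
      _ = _ := by ring⟩

/-- The `n`-th coefficient of `F` is `O((n + 1) ^ γ * L n)`. -/
def CoeffBound (L : ℕ → ℝ) (γ : ℝ) (F : PowerSeries ℝ) : Prop :=
  ∃ C, 0 ≤ C ∧ ∀ n : ℕ, |coeff n F| ≤ C * ((n : ℝ) + 1) ^ γ * L n

namespace CoeffBound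

variable {L : ℕ → ℝ} {γ δ : ℝ} {F G : PowerSeries ℝ}

theorem add (hF : CoeffBound L γ F) (hG : CoeffBound L γ G) : CoeffBound L γ (F + G) := by
  obtain ⟨C, hC, h⟩ := hF
  obtain ⟨D, hD, k⟩ := hG
  refine ⟨C + D, by positivity, fun n => ?_⟩
  rw [map_add, add_mul, add_mul]
  exact (abs_add_le _ _).trans (add_le_add (h n) (k n))

theorem smul (c : ℝ) (hF : CoeffBound L γ F) : CoeffBound L γ (c • F) := by
  obtain ⟨C, hC, h⟩ := hF
  refine ⟨|c| * C, by positivity, fun n => ?_⟩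
  rw [map_smul, smul_eq_mul, abs_mul, mul_assoc, mul_assoc, ← mul_assoc C]
  gcongr
  exact h n

theorem neg (hF : CoeffBound L γ F) : CoeffBound L γ (-F) := by
  simpa using hF.smul (-1)

theorem sub (hF : CoeffBound L γ F) (hG : CoeffBound L γ G) : CoeffBound L γ (F - G) := by
  simpa [sub_eq_add_neg] using hF.add hG.neg

theorem zero : CoeffBound L γ 0 :=
  ⟨0, le_rfl, fun n => by simp⟩

theorem sum {ι : Type*} {s : Finset ι} {F : ι → PowerSeries ℝ}
    (h : ∀ i ∈ s, CoeffBound L γ (F i)) : CoeffBound L γ (∑ i ∈ s, F i) :=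
  Finset.sum_induction F (CoeffBound L γ) (fun _ _ => add) zero h

theorem mono (hL : IsGauge L) (hF : CoeffBound L γ F) (h : γ ≤ δ) : CoeffBound L δ F := by
  obtain ⟨C, hC, hF⟩ := hF
  refine ⟨C, hC, fun n => (hF n).trans ?_⟩
  have := hL.pos n
  gcongr
  simp

/-- A bound without slowly varying factor implies the one with it. -/
theorem gauge (hL : IsGauge L) (hF : CoeffBound (fun _ => 1) γ F) : CoeffBound L γ F := by
  obtain ⟨C, hC, hF⟩ := hF
  refine ⟨C, hC, fun n => (hF n).trans ?_⟩
  have := hL.one_le n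
  gcongr

/-- The slowly varying factor can be traded for an arbitrarily small power. -/
theorem of_gauge (hL : IsGauge L) (hF : CoeffBound L γ F) (h : γ < δ) :
    CoeffBound (fun _ => 1) δ F := by
  obtain ⟨C, hC, hF⟩ := hF
  obtain ⟨D, hD, hLD⟩ := hL.le_rpow (δ - γ) (by linarith)
  refine ⟨C * D, by positivity, fun n => (hF n).trans ?_⟩
  calc C * ((n : ℝ) + 1) ^ γ * L n ≤ C * ((n : ℝ) + 1) ^ γ * (D * ((n : ℝ) + 1) ^ (δ - γ)) := by
        gcongr; exact hLD n
    _ = C * D * (((n : ℝ) + 1) ^ γ * ((n : ℝ) + 1) ^ (δ - γ)) := by ring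
    _ = _ := by rw [← Real.rpow_add (by positivity), add_sub_cancel, mul_one]

theorem powSeries {β : ℝ} (hβ : -1 < β) :
    CoeffBound (fun _ => 1) (β - 1) (PAiry.powSeries β) := by
  obtain ⟨C, hC, h⟩ := abs_powCoeff_le hβ
  exact ⟨C, hC, fun n => by simpa using h n⟩

/-- Products are controlled by comparing both factors with powers of `1 - X`. -/
theorem mul (hL : IsGauge L) {α β : ℝ} (hα : 0 < α) (hβ : 0 < β) (hF : CoeffBound L (α - 1) F)
    (hG : CoeffBound (fun _ => 1) (β - 1) G) : CoeffBound L (α + β - 1) (F * G) := by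
  obtain ⟨C, hC, hF⟩ := hF
  obtain ⟨D, hD, hG⟩ := hG
  obtain ⟨A, hA, ha⟩ := rpow_le_mul_powCoeff hα
  obtain ⟨B, hB, hb⟩ := rpow_le_mul_powCoeff hβ
  obtain ⟨K, hK, hk⟩ := abs_powCoeff_le (β := α + β) (by linarith)
  refine ⟨C * A * (D * B) * K, by positivity, fun n => ?_⟩
  rw [PowerSeries.coeff_mul]
  have hterm : ∀ x ∈ Finset.HasAntidiagonal.antidiagonal n, |coeff x.1 F * coeff x.2 G| ≤
      C * A * (D * B) * L n * (powCoeff α x.1 * powCoeff β x.2) := by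
    intro x hx
    have hx1 : x.1 ≤ n := by
      have := Finset.HasAntidiagonal.mem_antidiagonal.1 hx; omega
    have p1 := powCoeff_pos hα x.1
    have p2 := powCoeff_pos hβ x.2
    have p3 := hL.pos x.1
    have p4 := hL.pos n
    rw [abs_mul]
    calc |coeff x.1 F| * |coeff x.2 G|
        ≤ (C * (A * powCoeff α x.1) * L n) * (D * (B * powCoeff β x.2)) := by
          gcongr
          · exact (hF x.1).trans (by gcongr; exacts [ha _, hL.mono hx1])
          · refine (hG x.2).trans ?_
            rw [mul_one]
            gcongr
            exact hb _
      _ = _ := by ring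
  have hn := hL.pos n
  calc |∑ x ∈ Finset.HasAntidiagonal.antidiagonal n, coeff x.1 F * coeff x.2 G|
      ≤ ∑ x ∈ Finset.HasAntidiagonal.antidiagonal n, |coeff x.1 F * coeff x.2 G| := Finset.abs_sum_le_sum_abs _ _
    _ ≤ ∑ x ∈ Finset.HasAntidiagonal.antidiagonal n,
        C * A * (D * B) * L n * (powCoeff α x.1 * powCoeff β x.2) := Finset.sum_le_sum hterm
    _ = C * A * (D * B) * L n * powCoeff (α + β) n := by
        rw [← Finset.mul_sum, ← coeff_powSeries (α + β), ← powSeries_mul, PowerSeries.coeff_mul]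
        simp
    _ ≤ C * A * (D * B) * L n * (K * ((n : ℝ) + 1) ^ (α + β - 1)) := by
        gcongr
        exact (le_abs_self _).trans (hk n)
    _ = _ := by ring

theorem X_mul (hL : IsGauge L) (hF : CoeffBound L γ F) : CoeffBound L γ (PowerSeries.X * F) := by
  obtain ⟨C, hC, hF⟩ := hF
  refine ⟨C * 2 ^ |γ|, by positivity, fun n => ?_⟩
  have p4 := hL.pos n
  rcases n with _ | n
  · simp; positivity
  · rw [PowerSeries.coeff_succ_X_mul]
    have hm : L n ≤ L (n + 1) := hL.mono (Nat.le_succ n)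
    have p3 := hL.pos n
    have key : ((n : ℝ) + 1) ^ γ ≤ 2 ^ |γ| * (((n + 1 : ℕ) : ℝ) + 1) ^ γ := by
      push_cast
      rcases le_total 0 γ with h | h
      · have h2 : (1 : ℝ) ≤ 2 ^ |γ| := Real.one_le_rpow (by norm_num) (abs_nonneg _)
        calc ((n : ℝ) + 1) ^ γ ≤ ((n : ℝ) + 1 + 1) ^ γ := by gcongr; linarith
          _ ≤ _ := le_mul_of_one_le_left (by positivity) h2
      · rw [abs_of_nonpos h, Real.rpow_neg (by norm_num), ← div_eq_inv_mul,
          ← Real.div_rpow (by positivity) (by norm_num)]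
        apply Real.rpow_le_rpow_of_nonpos (by positivity) _ h
        linarith
    calc |coeff n F| ≤ C * ((n : ℝ) + 1) ^ γ * L n := hF n
      _ ≤ C * (2 ^ |γ| * (((n + 1 : ℕ) : ℝ) + 1) ^ γ) * L (n + 1) := by gcongr
      _ = _ := by ring

/-- The operator `X d/dX` costs one power of `n`, and it can be undone. -/
theorem X_mul_derivative (hL : IsGauge L) (hF : CoeffBound L γ F) :
    CoeffBound L (γ + 1) (PowerSeries.X * PowerSeries.derivative ℝ F) := by
  obtain ⟨C, hC, hF⟩ := hF
  refine ⟨C, hC, fun n => ?_⟩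
  have p4 := hL.pos n
  rcases n with _ | n
  · simp; positivity
  · rw [PowerSeries.coeff_succ_X_mul, PowerSeries.coeff_derivative, abs_mul,
      Real.rpow_add_one (by positivity)]
    calc |coeff (n + 1) F| * |(n : ℝ) + 1|
        ≤ (C * (((n + 1 : ℕ) : ℝ) + 1) ^ γ * L (n + 1)) * (((n + 1 : ℕ) : ℝ) + 1) := by
          gcongr
          · exact hF _
          · rw [abs_of_pos (by positivity)]; push_cast; linarith
      _ = _ := by ring

theorem of_X_mul_derivative (hL : IsGauge L)
    (hF : CoeffBound L (γ + 1) (PowerSeries.X * PowerSeries.derivative ℝ F)) :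
    CoeffBound L γ F := by
  obtain ⟨C, hC, hF⟩ := hF
  obtain ⟨K, hK, h⟩ := exists_forall_abs_le (f := fun n => coeff n F)
    (g := fun n => ((n : ℝ) + 1) ^ γ * L n) (C := 2 * C) (m := 1)
    (fun n => mul_pos (by positivity) (hL.pos n)) (fun n hn => by
      obtain ⟨n, rfl⟩ : ∃ k, n = k + 1 := ⟨n - 1, by omega⟩
      have h := hF (n + 1)
      rw [PowerSeries.coeff_succ_X_mul, PowerSeries.coeff_derivative, abs_mul,
        Real.rpow_add_one (by positivity), abs_of_pos (by positivity : (0 : ℝ) < n + 1)] at h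
      have p4 := hL.pos (n + 1)
      have : (((n + 1 : ℕ) : ℝ) + 1) ≤ 2 * ((n : ℝ) + 1) := by
        push_cast; have : (0 : ℝ) ≤ n := by positivity
        linarith
      refine le_of_mul_le_mul_right (h.trans ?_) (by positivity : (0 : ℝ) < n + 1)
      calc C * ((((n + 1 : ℕ) : ℝ) + 1) ^ γ * (((n + 1 : ℕ) : ℝ) + 1)) * L (n + 1)
          ≤ C * ((((n + 1 : ℕ) : ℝ) + 1) ^ γ * (2 * ((n : ℝ) + 1))) * L (n + 1) := by gcongr
        _ = _ := by ring)
  exact ⟨K, hK, fun n => by simpa [mul_assoc] using h n⟩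

end CoeffBound

/-! ### Error terms and series with a leading power of `1 - X` -/

/-- An error term of order `γ`: its coefficients are `O(n ^ (γ - 1))` and the partial sums of its
coefficients are `O(n ^ γ)`, up to the factor `L`. For `γ > 0` the second bound follows from the
first; for `γ ≤ 0` it encodes cancellations. -/
structure Err (L : ℕ → ℝ) (γ : ℝ) (F : PowerSeries ℝ) : Prop where
  coeff : CoeffBound L (γ - 1) F
  partialSum : CoeffBound L γ (powSeries 1 * F)

namespace Err

variable {L : ℕ → ℝ} {γ δ : ℝ} {F G : PowerSeries ℝ}

theorem add (hF : Err L γ F) (hG : Err L γ G) : Err L γ (F + G) :=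
  ⟨hF.1.add hG.1, by rw [mul_add]; exact hF.2.add hG.2⟩

theorem smul (c : ℝ) (hF : Err L γ F) : Err L γ (c • F) :=
  ⟨hF.1.smul c, by rw [mul_smul_comm]; exact hF.2.smul c⟩

theorem mono (hL : IsGauge L) (hF : Err L γ F) (h : γ ≤ δ) : Err L δ F :=
  ⟨hF.1.mono hL (by linarith), hF.2.mono hL h⟩

theorem of_pos (hL : IsGauge L) (hγ : 0 < γ) (hF : CoeffBound L (γ - 1) F) : Err L γ F := by
  refine ⟨hF, ?_⟩
  have := hF.mul hL hγ one_pos (CoeffBound.powSeries (β := 1) (by norm_num))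
  rwa [mul_comm, add_sub_cancel_right] at this

theorem powSeries {β : ℝ} (hβ : -1 < β) (hL : IsGauge L) : Err L β (PAiry.powSeries β) := by
  refine ⟨(CoeffBound.powSeries hβ).gauge hL, ?_⟩
  rw [powSeries_mul]
  have := (CoeffBound.powSeries (β := 1 + β) (by linarith)).gauge hL
  rwa [add_sub_cancel_left] at this

theorem X_mul (hL : IsGauge L) (hF : Err L γ F) : Err L γ (PowerSeries.X * F) :=
  ⟨hF.1.X_mul hL, by rw [mul_left_comm]; exact hF.2.X_mul hL⟩

/-- Multiplication by `(1 - X) ^ (-β)` with `β > 0`. The bound on the partial sums replaces a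
summation by parts: with `D = X d/dX`, both terms of `D (G F) = (D G) F + G (D F)` are controlled,
as `D (1 - X) ^ (-β) * F = β X (1 - X) ^ (-β) * (1 - X)⁻¹ F`. -/
theorem powSeries_mul (hL : IsGauge L) (hF : Err L γ F) (hγ : -1 < γ) {β : ℝ} (hβ : 0 < β) :
    Err L (γ + β) (PAiry.powSeries β * F) := by
  have hP := CoeffBound.powSeries (β := β) (by linarith)
  have h1 : CoeffBound L (γ + β) (PAiry.powSeries β * (PAiry.powSeries 1 * F)) := by
    have h2 : CoeffBound L (γ + 1 - 1) (PAiry.powSeries 1 * F) := by simpa using hF.2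
    have := h2.mul hL (by linarith) hβ hP
    rw [mul_comm]
    convert this using 1; ring
  refine ⟨CoeffBound.of_X_mul_derivative hL ?_, by rwa [mul_left_comm]⟩
  have h3 : CoeffBound L (γ + β) (PAiry.powSeries β * (PowerSeries.X *
      PowerSeries.derivative ℝ F)) := by
    have h2 : CoeffBound L (γ + 1 - 1) (PowerSeries.X * PowerSeries.derivative ℝ F) := by
      have := hF.1.X_mul_derivative hL
      convert this using 1; ring
    have := h2.mul hL (by linarith) hβ hP
    rw [mul_comm]
    convert this using 1; ring
  have e : PowerSeries.X * PowerSeries.derivative ℝ (PAiry.powSeries β * F)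
      = β • (PowerSeries.X * (PAiry.powSeries β * (PAiry.powSeries 1 * F)))
        + PAiry.powSeries β * (PowerSeries.X * PowerSeries.derivative ℝ F) := by
    rw [Derivation.leibniz, powSeries_derivative, ← PAiry.powSeries_mul, PowerSeries.smul_eq_C_mul]
    simp only [smul_eq_mul]
    ring
  rw [e]
  have := ((h1.X_mul hL).smul β).add h3
  convert this using 1; ring

end Err

/-- `F = C (1 - X) ^ (-β)` up to an error term that is smaller by the order `θ`. -/
def Asy (L : ℕ → ℝ) (θ β C : ℝ) (F : PowerSeries ℝ) : Prop :=
  Err L (β - θ) (F - C • powSeries β)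

namespace Asy

variable {L : ℕ → ℝ} {θ β β₁ β₂ C C₁ C₂ : ℝ} {F G : PowerSeries ℝ}

theorem powSeries (β : ℝ) : Asy L θ β 1 (PAiry.powSeries β) := by
  unfold Asy
  rw [one_smul, sub_self]
  exact ⟨.zero, by rw [mul_zero]; exact .zero⟩

theorem add (hF : Asy L θ β C₁ F) (hG : Asy L θ β C₂ G) : Asy L θ β (C₁ + C₂) (F + G) := by
  unfold Asy at *
  have := Err.add hF hG
  convert this using 1
  rw [add_smul]; ring

theorem smul (c : ℝ) (hF : Asy L θ β C F) : Asy L θ β (c * C) (c • F) := by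
  unfold Asy at *
  have := Err.smul c hF
  rwa [smul_sub, smul_smul] at this

theorem add_err (hF : Asy L θ β C F) (hG : Err L (β - θ) G) : Asy L θ β C (F + G) := by
  unfold Asy at *
  have := Err.add hF hG
  convert this using 1
  ring

theorem zero : Asy L θ β 0 0 := by
  simpa using (powSeries (L := L) (θ := θ) β).smul 0

theorem sum {ι : Type*} (s : Finset ι) {F : ι → PowerSeries ℝ} {C : ι → ℝ}
    (h : ∀ i ∈ s, Asy L θ β (C i) (F i)) : Asy L θ β (∑ i ∈ s, C i) (∑ i ∈ s, F i) := by
  classical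
  induction s using Finset.induction_on with
  | empty => simpa using zero
  | insert a s ha ih =>
    rw [Finset.sum_insert ha, Finset.sum_insert ha]
    exact (h a (Finset.mem_insert_self _ _)).add
      (ih fun i hi => h i (Finset.mem_insert_of_mem hi))

/-- A series of order `β` is an error term at that order. -/
theorem err (hL : IsGauge L) (hβ : -1 < β) (hθ : 0 ≤ θ) (hF : Asy L θ β C F) : Err L β F := by
  have := (Err.mono hL hF (by linarith : β - θ ≤ β)).add ((Err.powSeries hβ hL).smul C)
  simpa using this

theorem coeffBound (hL : IsGauge L) (hβ : -1 < β) (hθ : 0 < θ) (hF : Asy L θ β C F) :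
    CoeffBound (fun _ => 1) (β - 1) F := by
  have h1 : CoeffBound (fun _ => 1) (β - 1) (F - C • PAiry.powSeries β) :=
    (Err.coeff hF).of_gauge hL (by linarith)
  have := h1.add ((CoeffBound.powSeries hβ).smul C)
  simpa using this

theorem powSeries_mul (hL : IsGauge L) (hF : Asy L θ β C F) (hβ : -1 < β - θ) {α : ℝ}
    (hα : 0 < α) : Asy L θ (β + α) C (PAiry.powSeries α * F) := by
  unfold Asy at *
  have := Err.powSeries_mul hL hF hβ hα
  rw [mul_sub, mul_smul_comm, PAiry.powSeries_mul, add_comm α β] at this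
  convert this using 1; ring

theorem X_mul (hL : IsGauge L) (hF : Asy L θ β C F) (hβ : 0 < β) (hθ : θ ≤ 1) :
    Asy L θ β C (PowerSeries.X * F) := by
  unfold Asy at *
  have h1 : Err L (β - θ) (PAiry.powSeries (β - 1)) :=
    (Err.powSeries (by linarith) hL).mono hL (by linarith)
  have := (Err.X_mul hL hF).add (h1.smul (-C))
  convert this using 1
  rw [show β - 1 = -1 + β by ring, ← PAiry.powSeries_mul, powSeries_neg_one]
  simp only [PowerSeries.smul_eq_C_mul, map_neg]
  ring

theorem mul (hL : IsGauge L) (hθ : 0 < θ) (h1 : θ ≤ β₁) (h2 : θ ≤ β₂) (hF : Asy L θ β₁ C₁ F)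
    (hG : Asy L θ β₂ C₂ G) : Asy L θ (β₁ + β₂) (C₁ * C₂) (F * G) := by
  unfold Asy at *
  set R := F - C₁ • PAiry.powSeries β₁ with hR
  set S := G - C₂ • PAiry.powSeries β₂ with hS
  have hb1 : 0 < β₁ := by linarith
  have hb2 : 0 < β₂ := by linarith
  have e : F * G - (C₁ * C₂) • PAiry.powSeries (β₁ + β₂)
      = C₁ • (PAiry.powSeries β₁ * S) + C₂ • (PAiry.powSeries β₂ * R) + R * S := by
    rw [hR, hS, ← PAiry.powSeries_mul]
    simp only [PowerSeries.smul_eq_C_mul, map_mul]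
    ring
  rw [e]
  -- Half of the gain `θ` is given up in each error to make both orders positive.
  have hR' : CoeffBound (fun _ => 1) (β₁ - θ / 2 - 1) R := hF.coeff.of_gauge hL (by linarith)
  have hS' : CoeffBound (fun _ => 1) (β₂ - θ / 2 - 1) S := hG.coeff.of_gauge hL (by linarith)
  have hRS : Err L (β₁ + β₂ - θ) (R * S) := by
    refine Err.of_pos hL (by linarith) (CoeffBound.gauge hL ?_)
    have := hR'.mul isGauge_one (by linarith) (by linarith) hS'
    convert this using 1; ring
  have hA := Err.powSeries_mul hL hG (by linarith) hb1
  have hB := Err.powSeries_mul hL hF (by linarith) hb2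
  refine ((Err.smul C₁ ?_).add (Err.smul C₂ ?_)).add hRS
  · convert hA using 1; ring
  · convert hB using 1; ring

end Asy

/-! ### Coefficientwise products -/

/-- The coefficientwise product of a sequence with a power series. -/
def hadamard (f : ℕ → ℝ) (F : PowerSeries ℝ) : PowerSeries ℝ :=
  PowerSeries.mk fun n => f n * coeff n F

@[simp] theorem coeff_hadamard (f : ℕ → ℝ) (F : PowerSeries ℝ) (n : ℕ) :
    coeff n (hadamard f F) = f n * coeff n F := by simp [hadamard]

theorem CoeffBound.hadamard {L : ℕ → ℝ} {γ p : ℝ} {F : PowerSeries ℝ} (hL : IsGauge L)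
    {f : ℕ → ℝ} (hf : ∃ C, 0 ≤ C ∧ ∀ n : ℕ, |f n| ≤ C * ((n : ℝ) + 1) ^ p)
    (hF : CoeffBound L γ F) : CoeffBound L (γ + p) (PAiry.hadamard f F) := by
  obtain ⟨C, hC, hF⟩ := hF
  obtain ⟨D, hD, hf⟩ := hf
  refine ⟨C * D, by positivity, fun n => ?_⟩
  have := hL.pos n
  rw [coeff_hadamard, abs_mul, Real.rpow_add (by positivity)]
  calc |f n| * |coeff n F| ≤ (D * ((n : ℝ) + 1) ^ p) * (C * ((n : ℝ) + 1) ^ γ * L n) := by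
        gcongr; exacts [hf n, hF n]
    _ = _ := by ring

/-- Coefficientwise multiplication by a sequence `f n ∼ n ^ p` raises the order by `p`. -/
theorem Asy.hadamard {L : ℕ → ℝ} {θ β C p : ℝ} {F : PowerSeries ℝ} (hL : IsGauge L) {f : ℕ → ℝ}
    (hf : ∃ C, 0 ≤ C ∧ ∀ n : ℕ, |f n - ((n : ℝ) + 1) ^ p| ≤ C * ((n : ℝ) + 1) ^ (p - θ))
    (hθ : 0 < θ) (hθ1 : θ ≤ 1) (hθp : θ ≤ p) (hβ : 0 < β) (hF : Asy L θ β C F) :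
    Asy L θ (β + p) (C * (Real.Gamma (β + p) / Real.Gamma β)) (PAiry.hadamard f F) := by
  have hB := Asy.coeffBound hL (by linarith) hθ hF
  have hE := Err.coeff hF
  have hG := (Real.Gamma_pos_of_pos hβ).ne'
  have hG2 := (Real.Gamma_pos_of_pos (by linarith : 0 < β + p)).ne'
  refine Err.of_pos hL (by linarith) ?_
  -- There are four errors: those of `f` and `F`, and those of the coefficients of `(1 - X) ^ (-β)`
  -- and `(1 - X) ^ (-β - p)` against their asymptotic values.
  have t1 : CoeffBound L (β + p - θ - 1) (PAiry.hadamard (fun n => f n - ((n : ℝ) + 1) ^ p) F) := by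
    have := (hB.gauge hL).hadamard hL hf
    convert this using 1; ring
  have hpow : ∃ C, 0 ≤ C ∧ ∀ n : ℕ, |((n : ℝ) + 1) ^ p| ≤ C * ((n : ℝ) + 1) ^ p :=
    ⟨1, zero_le_one, fun n => by rw [abs_of_pos (by positivity), one_mul]⟩
  have t2 : CoeffBound L (β + p - θ - 1) (PAiry.hadamard (fun n => ((n : ℝ) + 1) ^ p)
      (F - C • PAiry.powSeries β)) := by
    have := hE.hadamard hL hpow
    convert this using 1; ring
  have t3 : CoeffBound L (β + p - θ - 1) (PAiry.hadamard (fun n => ((n : ℝ) + 1) ^ p)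
      (PowerSeries.mk fun n => powCoeff β n - ((n : ℝ) + 1) ^ (β - 1) / Real.Gamma β)) := by
    obtain ⟨D, hD, h⟩ := powCoeff_asymp (β := β) (by linarith)
    have h' : CoeffBound L (β - 2) (PowerSeries.mk fun n =>
        powCoeff β n - ((n : ℝ) + 1) ^ (β - 1) / Real.Gamma β) :=
      CoeffBound.gauge hL ⟨D, hD, fun n => by simpa using h n⟩
    exact (h'.hadamard hL hpow).mono hL (by linarith)
  have t4 : CoeffBound L (β + p - θ - 1) (PowerSeries.mk fun n =>
      powCoeff (β + p) n - ((n : ℝ) + 1) ^ (β + p - 1) / Real.Gamma (β + p)) := by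
    obtain ⟨D, hD, h⟩ := powCoeff_asymp (β := β + p) (by linarith)
    have h' : CoeffBound L (β + p - 2) (PowerSeries.mk fun n =>
        powCoeff (β + p) n - ((n : ℝ) + 1) ^ (β + p - 1) / Real.Gamma (β + p)) :=
      CoeffBound.gauge hL ⟨D, hD, fun n => by simpa using h n⟩
    exact h'.mono hL (by linarith)
  have := ((t1.add t2).add (t3.smul C)).sub (t4.smul (C * (Real.Gamma (β + p) / Real.Gamma β)))
  convert this using 1
  ext n
  simp only [map_sub, map_add, map_smul, coeff_hadamard, PowerSeries.coeff_mk, smul_eq_mul,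
    coeff_powSeries]
  have e : ((n : ℝ) + 1) ^ (β + p - 1) = ((n : ℝ) + 1) ^ p * ((n : ℝ) + 1) ^ (β - 1) := by
    rw [← Real.rpow_add (by positivity)]; congr 1; ring
  rw [e]
  field_simp
  ring

/-! ### Solving the recursion for the moment generating series -/

/-- If `e k` is the series of the `k`-th (exponential) moments of the cost of an excursion, this is
the series of the `s`-th moments of the cost of an excursion raised by one unit: the additional
slice below an excursion of size `n` costs `ω n`. -/
def archSeries (ω : ℕ → ℝ) (e : ℕ → PowerSeries ℝ) (s : ℕ) : PowerSeries ℝ :=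
  ∑ k ∈ Finset.range (s + 1), hadamard (fun n => ω n ^ k / k.factorial) (e (s - k))

/-- The recursion that the decomposition of an excursion at its first return imposes. -/
def ExcursionRec (ω : ℕ → ℝ) (e : ℕ → PowerSeries ℝ) : Prop :=
  ∀ s, e s = (if s = 0 then 1 else 0) +
    (1 / 4 : ℝ) • (PowerSeries.X * ∑ x ∈ antidiagonal s, archSeries ω e x.1 * e x.2)

/-- The recursion that the decomposition of a bridge at its first return imposes; the first arch
may lie on either side of the axis. -/
def BridgeRec (ω : ℕ → ℝ) (e b : ℕ → PowerSeries ℝ) : Prop :=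
  ∀ s, b s = (if s = 0 then 1 else 0) +
    (1 / 2 : ℝ) • (PowerSeries.X * ∑ x ∈ antidiagonal s, archSeries ω e x.1 * b x.2)

/-- The part of the arch series that involves the additional slice. -/
def sliceSeries (ω : ℕ → ℝ) (e : ℕ → PowerSeries ℝ) (s : ℕ) : PowerSeries ℝ :=
  ∑ k ∈ Finset.range s, hadamard (fun n => ω n ^ (k + 1) / (k + 1).factorial) (e (s - (k + 1)))

theorem archSeries_eq (ω : ℕ → ℝ) (e : ℕ → PowerSeries ℝ) (s : ℕ) :
    archSeries ω e s = e s + sliceSeries ω e s := by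
  rw [archSeries, Finset.sum_range_succ', add_comm, sliceSeries]
  congr 1
  ext n
  simp

theorem archSeries_zero (ω : ℕ → ℝ) (e : ℕ → PowerSeries ℝ) : archSeries ω e 0 = e 0 := by
  simp [archSeries_eq, sliceSeries]

theorem muE_add_two (p : ℝ) (n : ℕ) : muE p (n + 2) =
    muE p (n + 1) * (Real.Gamma ((n + 2) * (p + 1 / 2) - 1) /
      (2 * Real.Gamma ((n + 2) * (p + 1 / 2) - p - 1))) +
    ∑ x ∈ antidiagonal n, muE p (x.1 + 1) * muE p (x.2 + 1) := by
  rw [muE, Finset.Nat.sum_antidiagonal_eq_sum_range_succ_mk,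
    Fin.sum_univ_eq_sum_range fun k => muE p (k + 1) * muE p (n + 1 - k)]
  congr 1
  refine Finset.sum_congr rfl fun k hk => ?_
  rw [Nat.succ_sub (Nat.lt_succ_iff.1 (Finset.mem_range.1 hk))]

theorem muB_add_one (p : ℝ) (n : ℕ) : muB p (n + 1) =
    2 * ∑ x ∈ antidiagonal n, muE p (x.1 + 1) * muB p x.2 := by
  rw [muB, ← Finset.Nat.sum_antidiagonal_swap, Finset.Nat.sum_antidiagonal_eq_sum_range_succ_mk,
    Fin.sum_univ_eq_sum_range fun k => muB p k * muE p (n + 1 - k)]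
  congr 1
  refine Finset.sum_congr rfl fun k hk => ?_
  rw [Nat.succ_sub (Nat.lt_succ_iff.1 (Finset.mem_range.1 hk)), mul_comm]
  rfl

section

variable {ω : ℕ → ℝ} {e b : ℕ → PowerSeries ℝ}

theorem powSeries_half_mul : powSeries (1 / 2) * powSeries (-1 / 2) = 1 := by
  rw [powSeries_mul]; norm_num

theorem ExcursionRec.zero (he : ExcursionRec ω e) :
    1 - (1 / 2 : ℝ) • (PowerSeries.X * e 0) = powSeries (-1 / 2) := by
  have h := he 0
  simp only [Finset.Nat.antidiagonal_zero, Finset.sum_singleton, archSeries_zero, if_true] at h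
  have hP : powSeries (-1 / 2) * powSeries (-1 / 2) = 1 - PowerSeries.X := by
    rw [powSeries_mul, ← powSeries_neg_one]; norm_num
  rw [PowerSeries.smul_eq_C_mul] at h ⊢
  have hc : (PowerSeries.C (1 / 4) : PowerSeries ℝ) = PowerSeries.C (1 / 2) * PowerSeries.C (1 / 2)
      := by rw [← map_mul]; norm_num
  have h2 : (PowerSeries.C (1 / 2) : PowerSeries ℝ) * 2 = 1 := by
    rw [show (2 : PowerSeries ℝ) = PowerSeries.C 2 from (map_ofNat _ 2).symm, ← map_mul]; norm_num
  rw [hc] at h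
  have hprod : (1 - PowerSeries.C (1 / 2) * (PowerSeries.X * e 0) - powSeries (-1 / 2)) *
      (1 - PowerSeries.C (1 / 2) * (PowerSeries.X * e 0) + powSeries (-1 / 2)) = 0 := by
    linear_combination (-PowerSeries.X) * h - hP - PowerSeries.X * e 0 * h2
  rcases mul_eq_zero.1 hprod with h0 | h0
  · exact sub_eq_zero.1 h0
  · exfalso
    have := congrArg (coeff 0) h0
    simp [powSeries, powCoeff] at this

theorem ExcursionRec.coeff_zero (he : ExcursionRec ω e) (n : ℕ) :
    coeff n (e 0) = -2 * powCoeff (-1 / 2) (n + 1) := by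
  have h := congrArg (coeff (n + 1)) he.zero
  rw [map_sub, map_smul, PowerSeries.coeff_succ_X_mul, coeff_powSeries, PowerSeries.coeff_one,
    if_neg (Nat.succ_ne_zero n), smul_eq_mul] at h
  linarith

theorem ExcursionRec.coeffBound_zero (he : ExcursionRec ω e) :
    CoeffBound (fun _ => 1) (-1 / 2 - 1) (e 0) := by
  obtain ⟨C, hC, h⟩ := abs_powCoeff_le (β := -1 / 2) (by norm_num)
  refine ⟨2 * C, by positivity, fun n => ?_⟩
  rw [he.coeff_zero, abs_mul, mul_one, mul_assoc]
  have h1 := h (n + 1)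
  have h2 : (((n + 1 : ℕ) : ℝ) + 1) ^ (-1 / 2 - 1 : ℝ) ≤ ((n : ℝ) + 1) ^ (-1 / 2 - 1 : ℝ) :=
    Real.rpow_le_rpow_of_nonpos (by positivity) (by push_cast; linarith) (by norm_num)
  have h3 : |(-2 : ℝ)| = 2 := by norm_num
  rw [h3]
  gcongr
  exact h1.trans (by gcongr)

theorem BridgeRec.zero (he : ExcursionRec ω e) (hb : BridgeRec ω e b) :
    b 0 = powSeries (1 / 2) := by
  have h := hb 0
  simp only [Finset.Nat.antidiagonal_zero, Finset.sum_singleton, archSeries_zero, if_true] at h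
  have h1 := he.zero
  have h2 := powSeries_half_mul
  rw [PowerSeries.smul_eq_C_mul] at h h1
  linear_combination powSeries (1 / 2) * h - powSeries (1 / 2) * b 0 * h1 - b 0 * h2

/-- The linear equation for the `s`-th moment series, solved by division by
`1 - X / 2 * e 0 = (1 - X) ^ (1 / 2)`. -/
theorem ExcursionRec.solve (he : ExcursionRec ω e) {F H S : PowerSeries ℝ}
    (h : F = (1 / 4 : ℝ) • (PowerSeries.X * (e 0 * F + (F + H) * e 0 + S))) :
    F = (1 / 2 : ℝ) • (powSeries (1 / 2) * H) + (-1 / 2 : ℝ) • H +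
      (1 / 4 : ℝ) • (powSeries (1 / 2) * (PowerSeries.X * S)) := by
  have h1 := he.zero
  have h2 := powSeries_half_mul
  rw [PowerSeries.smul_eq_C_mul] at h h1
  simp only [PowerSeries.smul_eq_C_mul]
  have hc : (PowerSeries.C (1 / 4) : PowerSeries ℝ) = PowerSeries.C (1 / 2) * PowerSeries.C (1 / 2)
      := by rw [← map_mul]; norm_num
  have hc2 : (PowerSeries.C (1 / 2) : PowerSeries ℝ) * 2 = 1 := by
    rw [show (2 : PowerSeries ℝ) = PowerSeries.C 2 from (map_ofNat _ 2).symm, ← map_mul]; norm_num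
  have hc3 : (PowerSeries.C (-1 / 2) : PowerSeries ℝ) = -PowerSeries.C (1 / 2) := by
    rw [← map_neg]; norm_num
  rw [hc] at h ⊢
  rw [hc3]
  have h3 : (1 - PowerSeries.C (1 / 2) * (PowerSeries.X * e 0)) * F =
      PowerSeries.C (1 / 2) * H - PowerSeries.C (1 / 2) * H *
        (1 - PowerSeries.C (1 / 2) * (PowerSeries.X * e 0)) +
      PowerSeries.C (1 / 2) * PowerSeries.C (1 / 2) * (PowerSeries.X * S) := by
    linear_combination h + PowerSeries.C (1 / 2) * PowerSeries.X * e 0 * F * hc2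
  rw [h1] at h3
  linear_combination powSeries (1 / 2) * h3 - (F + PowerSeries.C (1 / 2) * H) * h2

theorem ExcursionRec.one (he : ExcursionRec ω e) :
    e 1 = (1 / 2 : ℝ) • (powSeries (1 / 2) * sliceSeries ω e 1)
      + (-1 / 2 : ℝ) • sliceSeries ω e 1 := by
  have h := he 1
  rw [Finset.Nat.antidiagonal_succ] at h
  simp only [Finset.Nat.antidiagonal_zero, Finset.map_singleton, Finset.sum_cons,
    Finset.sum_singleton, archSeries_zero, one_ne_zero, if_false, zero_add] at h
  have h' := he.solve (F := e 1) (H := sliceSeries ω e 1) (S := 0) (by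
    rw [← archSeries_eq, add_zero]
    simpa using h)
  simpa using h'

theorem ExcursionRec.add_two (he : ExcursionRec ω e) (n : ℕ) :
    e (n + 2) = (1 / 2 : ℝ) • (powSeries (1 / 2) * sliceSeries ω e (n + 2))
      + (-1 / 2 : ℝ) • sliceSeries ω e (n + 2)
      + (1 / 4 : ℝ) • (powSeries (1 / 2) * (PowerSeries.X *
        ∑ x ∈ antidiagonal n, archSeries ω e (x.1 + 1) * e (x.2 + 1))) := by
  refine he.solve ?_
  have h := he (n + 2)
  rw [Finset.Nat.sum_antidiagonal_succ, Finset.Nat.sum_antidiagonal_succ'] at h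
  simp only [archSeries_zero, Nat.add_eq_zero_iff, OfNat.ofNat_ne_zero, and_false, if_false,
    zero_add] at h
  rw [← archSeries_eq, h]
  congr 2
  rw [← h]
  ring

variable {L : ℕ → ℝ} {θ p : ℝ}

theorem pow_div_factorial_bound
    (hω : ∃ C, 0 ≤ C ∧ ∀ n : ℕ, |ω n - ((n : ℝ) + 1) ^ p| ≤ C * ((n : ℝ) + 1) ^ (p - θ))
    (hθ : 0 < θ) (k : ℕ) : ∃ C, 0 ≤ C ∧ ∀ n : ℕ,
      |ω n ^ k / k.factorial| ≤ C * ((n : ℝ) + 1) ^ (k * p) := by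
  obtain ⟨C, hC, h⟩ := hω
  refine ⟨(C + 1) ^ k, by positivity, fun n => ?_⟩
  have h1 : |ω n| ≤ (C + 1) * ((n : ℝ) + 1) ^ p := by
    have h2 : ((n : ℝ) + 1) ^ (p - θ) ≤ ((n : ℝ) + 1) ^ p :=
      Real.rpow_le_rpow_of_exponent_le (by simp) (by linarith)
    have h3 := abs_sub_abs_le_abs_sub (ω n) (((n : ℝ) + 1) ^ p)
    rw [abs_of_pos (by positivity : 0 < ((n : ℝ) + 1) ^ p)] at h3
    have := h n
    nlinarith
  rw [abs_div, abs_pow, Nat.abs_cast, mul_comm (k : ℝ) p, Real.rpow_mul (by positivity),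
    Real.rpow_natCast, ← mul_pow]
  calc |ω n| ^ k / k.factorial ≤ |ω n| ^ k / 1 := by
        gcongr; exact_mod_cast Nat.factorial_pos k
    _ ≤ _ := by rw [div_one]; gcongr

/-- The moment series of excursions behave like powers of `1 - X`, with the coefficients `muE`.
For `s = 1` this rests on the hypothesis `h1`, where the cancellation expressed by the choice of
the constant `α` enters; for `s ≥ 2` all orders are positive and sizes suffice. -/
theorem ExcursionRec.asy (hL : IsGauge L) (hθ : 0 < θ) (hθ2 : θ ≤ 1 / 2) (hθp : θ ≤ p)
    (hω : ∃ C, 0 ≤ C ∧ ∀ n : ℕ, |ω n - ((n : ℝ) + 1) ^ p| ≤ C * ((n : ℝ) + 1) ^ (p - θ))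
    (he : ExcursionRec ω e)
    (h1 : Asy L θ (p - 1 / 2) (Real.Gamma (p - 1 / 2) / √Real.pi) (hadamard ω (e 0))) (s : ℕ) :
    Asy L θ ((s + 1) * (p + 1 / 2) - 1 / 2) (4 * muE p (s + 1)) (e (s + 1)) ∧
    Asy L θ ((s + 1) * (p + 1 / 2) - 1 / 2) (4 * muE p (s + 1)) (archSeries ω e (s + 1)) := by
  have hp : 0 < p := by linarith
  induction s using Nat.strong_induction_on with
  | _ s ih =>
  -- It suffices to bound the slice series to the order that lies `1 / 2` below.
  have harch : ∀ c, Asy L θ ((s + 1) * (p + 1 / 2) - 1) c (sliceSeries ω e (s + 1)) →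
      Err L ((s + 1) * (p + 1 / 2) - 1 / 2 - θ) (sliceSeries ω e (s + 1)) := by
    intro c hc
    have hs : (0 : ℝ) ≤ s := by positivity
    exact (hc.err hL (by nlinarith) hθ.le).mono hL (by linarith)
  have hmul : ∀ c, Asy L θ ((s + 1) * (p + 1 / 2) - 1) c (sliceSeries ω e (s + 1)) →
      Asy L θ ((s + 1) * (p + 1 / 2) - 1 / 2) (1 / 2 * c)
        ((1 / 2 : ℝ) • (powSeries (1 / 2) * sliceSeries ω e (s + 1))
          + (-1 / 2 : ℝ) • sliceSeries ω e (s + 1)) := by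
    intro c hc
    refine Asy.add_err ?_ ((harch c hc).smul _)
    have hs : (0 : ℝ) ≤ s := by positivity
    have := (hc.powSeries_mul hL (by nlinarith) (α := 1 / 2) (by norm_num)).smul (1 / 2)
    convert this using 1; ring
  have hfin : Asy L θ ((s + 1) * (p + 1 / 2) - 1 / 2) (4 * muE p (s + 1)) (e (s + 1)) ∧
      ∃ c, Asy L θ ((s + 1) * (p + 1 / 2) - 1) c (sliceSeries ω e (s + 1)) := by
    rcases s with _ | n
    · have hs1 : sliceSeries ω e (0 + 1) = hadamard ω (e 0) := by
        simp [sliceSeries]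
      have hsl : Asy L θ (((0 : ℕ) + 1) * (p + 1 / 2) - 1) (Real.Gamma (p - 1 / 2) / √Real.pi)
          (sliceSeries ω e (0 + 1)) := by
        rw [hs1]; convert h1 using 1; push_cast; ring
      refine ⟨?_, _, hsl⟩
      have := hmul _ hsl
      rw [zero_add] at this ⊢
      rw [he.one]
      convert this using 1
      rw [muE]; ring
    · have hn : (0 : ℝ) ≤ n := by positivity
      have hnp : 0 ≤ n * p := by positivity
      -- The slice series: the leading term, and the terms with at least two additional factors.
      have hlead := ((ih n (Nat.lt_succ_self n)).1.hadamard hL hω hθ (by linarith) hθp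
        (by nlinarith))
      have hrest : Err L ((n + 1 + 1) * (p + 1 / 2) - 1 - θ) (∑ k ∈ Finset.range (n + 1),
          hadamard (fun m => ω m ^ (k + 2) / (k + 2).factorial) (e (n - k))) := by
        refine Err.of_pos hL (by nlinarith) (CoeffBound.sum fun k hk => ?_)
        have hkn : k ≤ n := Nat.lt_succ_iff.1 (Finset.mem_range.1 hk)
        have hb : CoeffBound (fun _ => 1) (((n - k : ℕ) : ℝ) * (p + 1 / 2) - 1 / 2 - 1)
            (e (n - k)) := by
          rcases Nat.eq_zero_or_pos (n - k) with h0 | h0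
          · rw [h0]; convert he.coeffBound_zero using 1; push_cast; ring
          · obtain ⟨m, hm⟩ : ∃ m, n - k = m + 1 := ⟨n - k - 1, by omega⟩
            rw [hm]
            have := (ih m (by omega)).1.coeffBound hL (by
              have : (0 : ℝ) ≤ m := by positivity
              nlinarith) hθ
            convert this using 1; push_cast; ring
        refine ((hb.hadamard isGauge_one (pow_div_factorial_bound hω hθ (k + 2))).gauge hL).mono
          hL ?_
        rw [Nat.cast_sub hkn]
        push_cast
        have : (0 : ℝ) ≤ k := by positivity
        nlinarith
      have hsl : ∃ c, Asy L θ ((n + 1 + 1) * (p + 1 / 2) - 1) c (sliceSeries ω e (n + 1 + 1)) ∧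
          c = 4 * muE p (n + 1) * (Real.Gamma ((n + 2) * (p + 1 / 2) - 1) /
            Real.Gamma ((n + 2) * (p + 1 / 2) - p - 1)) := by
        refine ⟨_, ?_, rfl⟩
        have e1 : sliceSeries ω e (n + 1 + 1) = hadamard ω (e (n + 1)) +
            ∑ k ∈ Finset.range (n + 1),
              hadamard (fun m => ω m ^ (k + 2) / (k + 2).factorial) (e (n - k)) := by
          rw [sliceSeries, Finset.sum_range_succ', add_comm]
          congr 1
          · ext m; simp
          · refine Finset.sum_congr rfl fun k _ => ?_
            congr 2
            omega
        rw [e1]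
        refine Asy.add_err ?_ hrest
        have e2 : ((n : ℝ) + 1) * (p + 1 / 2) - 1 / 2 + p = (n + 2) * (p + 1 / 2) - 1 := by ring
        have e3 : ((n : ℝ) + 1) * (p + 1 / 2) - 1 / 2 = (n + 2) * (p + 1 / 2) - p - 1 := by ring
        rw [e2, e3] at hlead
        convert hlead using 1
        ring
      obtain ⟨c, hsl, hc⟩ := hsl
      push_cast at hmul ⊢
      refine ⟨?_, c, hsl⟩
      rw [show n + 1 + 1 = n + 2 from rfl, he.add_two n]
      have hS : Asy L θ ((n + 1 + 1) * (p + 1 / 2) - 1) (∑ x ∈ antidiagonal n,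
          4 * muE p (x.1 + 1) * (4 * muE p (x.2 + 1)))
          (∑ x ∈ antidiagonal n, archSeries ω e (x.1 + 1) * e (x.2 + 1)) := by
        refine Asy.sum _ fun x hx => ?_
        have hx' := Finset.HasAntidiagonal.mem_antidiagonal.1 hx
        have hxr : (x.1 : ℝ) + x.2 = n := by exact_mod_cast hx'
        have k1 : (0 : ℝ) ≤ x.1 := by positivity
        have k2 : (0 : ℝ) ≤ x.2 := by positivity
        have := (ih x.1 (by omega)).2.mul hL hθ (by nlinarith) (by nlinarith) (ih x.2 (by omega)).1
        convert this using 1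
        rw [← hxr]; ring
      have hPS := ((hS.X_mul hL (by nlinarith) (by linarith)).powSeries_mul hL (by nlinarith)
        (α := 1 / 2) (by norm_num)).smul (1 / 4)
      have e4 : ((n : ℝ) + 1 + 1) * (p + 1 / 2) - 1 + 1 / 2
          = (n + 1 + 1) * (p + 1 / 2) - 1 / 2 := by ring
      rw [e4] at hPS
      have := (hmul c hsl).add hPS
      convert this using 1
      rw [muE_add_two, hc, mul_add, Finset.mul_sum, Finset.mul_sum]
      congr 1
      · ring
      · exact Finset.sum_congr rfl fun x _ => by ring
  obtain ⟨hE, c, hc⟩ := hfin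
  refine ⟨hE, ?_⟩
  rw [archSeries_eq]
  exact hE.add_err (harch c hc)

/-- The moment series of bridges behave like powers of `1 - X`, with the coefficients `muB`. -/
theorem BridgeRec.asy (hL : IsGauge L) (hθ : 0 < θ) (hθ2 : θ ≤ 1 / 2) (hθp : θ ≤ p)
    (he : ExcursionRec ω e) (hb : BridgeRec ω e b)
    (h1 : ∀ s : ℕ, Asy L θ ((s + 1) * (p + 1 / 2) - 1 / 2) (4 * muE p (s + 1))
      (archSeries ω e (s + 1))) (s : ℕ) :
    Asy L θ (s * (p + 1 / 2) + 1 / 2) (muB p s) (b s) := by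
  have hp : 0 < p := by linarith
  induction s using Nat.strong_induction_on with
  | _ s ih =>
  rcases s with _ | n
  · rw [BridgeRec.zero he hb, muB]
    convert Asy.powSeries (L := L) (θ := θ) (1 / 2) using 1
    simp
  · have hrec : b (n + 1) = (1 / 2 : ℝ) • (powSeries (1 / 2) * (PowerSeries.X *
        ∑ x ∈ antidiagonal n, archSeries ω e (x.1 + 1) * b x.2)) := by
      have h := hb (n + 1)
      rw [Finset.Nat.sum_antidiagonal_succ, if_neg (Nat.succ_ne_zero n), archSeries_zero] at h
      have h1 := he.zero
      have h2 := powSeries_half_mul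
      rw [PowerSeries.smul_eq_C_mul] at h h1 ⊢
      linear_combination powSeries (1 / 2) * h - powSeries (1 / 2) * b (n + 1) * h1
        - b (n + 1) * h2
    have hn : (0 : ℝ) ≤ n := by positivity
    have hnp : 0 ≤ n * p := by positivity
    have hS : Asy L θ ((n + 1) * (p + 1 / 2)) (∑ x ∈ antidiagonal n,
        4 * muE p (x.1 + 1) * muB p x.2)
        (∑ x ∈ antidiagonal n, archSeries ω e (x.1 + 1) * b x.2) := by
      refine Asy.sum _ fun x hx => ?_
      have hx' := Finset.HasAntidiagonal.mem_antidiagonal.1 hx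
      have hxr : (x.1 : ℝ) + x.2 = n := by exact_mod_cast hx'
      have k1 : (0 : ℝ) ≤ x.1 := by positivity
      have k2 : (0 : ℝ) ≤ x.2 := by positivity
      have := (h1 x.1).mul hL hθ (by nlinarith) (by nlinarith) (ih x.2 (by omega))
      convert this using 1
      rw [← hxr]; ring
    have hPS := ((hS.X_mul hL (by nlinarith) (by linarith)).powSeries_mul hL (by nlinarith)
      (α := 1 / 2) (by norm_num)).smul (1 / 2)
    rw [hrec]
    push_cast
    convert hPS using 1
    rw [muB_add_one, Finset.mul_sum, Finset.mul_sum]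
    exact Finset.sum_congr rfl fun x _ => by ring

end

/-! ### Heights and slices of lattice paths -/

@[simp] theorem height_zero (w : List DyckStep) : height w 0 = 0 := by simp [height]

theorem height_cons_U (w : List DyckStep) (k : ℕ) :
    height (DyckStep.U :: w) (k + 1) = 1 + height w k := by
  simp [height]; ring

theorem height_cons_D (w : List DyckStep) (k : ℕ) :
    height (DyckStep.D :: w) (k + 1) = -1 + height w k := by
  simp [height]; ring

theorem height_append_of_le (u v : List DyckStep) {k : ℕ} (h : k ≤ u.length) :
    height (u ++ v) k = height u k := by
  simp [height, List.take_append_of_le_length h]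

theorem height_append_add (u v : List DyckStep) (m : ℕ) :
    height (u ++ v) (u.length + m) = height u u.length + height v m := by
  simp [height, List.take_append, List.take_of_length_le (Nat.le_add_right u.length m)]; ring

theorem height_length (w : List DyckStep) :
    height w w.length = (w.count DyckStep.U : ℤ) - w.count DyckStep.D := by
  simp [height]

theorem length_eq_count_add (w : List DyckStep) :
    w.length = w.count DyckStep.U + w.count DyckStep.D := by
  induction w with
  | nil => rfl
  | cons s w ih => cases s <;> simp [ih] <;> omega

theorem height_succ_ge (w : List DyckStep) (k : ℕ) : height w k - 1 ≤ height w (k + 1) := by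
  induction w generalizing k with
  | nil => simp [height]
  | cons s w ih =>
    rcases k with _ | k
    · cases s <;> simp [height]
    · have := ih k
      cases s <;> simp only [height_cons_U, height_cons_D] <;> linarith

theorem height_of_length_le (w : List DyckStep) {k : ℕ} (h : w.length ≤ k) :
    height w k = height w w.length := by
  simp [height, List.take_of_length_le h]

theorem mem_excursions {N : ℕ} {l : List DyckStep} : l ∈ excursions N ↔
    l.count DyckStep.U = N ∧ l.count DyckStep.D = N ∧ ∀ k, 0 ≤ height l k := by
  simp only [excursions, Finset.mem_image, Finset.mem_univ, true_and, Subtype.exists, exists_prop]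
  constructor
  · rintro ⟨w, hw, rfl⟩
    refine ⟨hw, by rw [← w.semilength_eq_count_D, hw], fun k => ?_⟩
    have := w.count_D_le_count_U k
    simp only [height]
    omega
  · rintro ⟨hU, hD, hk⟩
    refine ⟨⟨l, by rw [hU, hD], fun k => ?_⟩, hU, rfl⟩
    have := hk k
    simp only [height] at this
    omega

/-- The path that consists of an excursion `u`, raised by one unit, followed by `v`. -/
def archAppend (u v : List DyckStep) : List DyckStep := DyckStep.U :: (u ++ DyckStep.D :: v)

theorem length_archAppend (u v : List DyckStep) :
    (archAppend u v).length = u.length + 2 + v.length := by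
  simp [archAppend]; ring

theorem height_archAppend_left (u v : List DyckStep) {k : ℕ} (h : k ≤ u.length) :
    height (archAppend u v) (k + 1) = 1 + height u k := by
  rw [archAppend, height_cons_U, height_append_of_le _ _ h]

theorem height_archAppend_right {u : List DyckStep} (v : List DyckStep)
    (hu : height u u.length = 0) (m : ℕ) :
    height (archAppend u v) (u.length + 2 + m) = height v m := by
  rw [archAppend, show u.length + 2 + m = u.length + (m + 1) + 1 by ring, height_cons_U,
    height_append_add, hu, height_cons_D]
  ring

theorem mem_slices {w : List DyckStep} {i j : ℕ} : (i, j) ∈ slices w ↔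
    i < j ∧ j < w.length ∧ height w (j + 1) = height w i ∧
      ∀ k, i < k → k ≤ j → |height w i| < |height w k| := by
  simp only [slices, Finset.mem_filter, Finset.mem_product, Finset.mem_range, Finset.mem_Ioc,
    and_imp]
  constructor
  · rintro ⟨⟨_, h2⟩, h3, h4, h5⟩
    exact ⟨h3, h2, h4, h5⟩
  · rintro ⟨h1, h2, h3, h4⟩
    exact ⟨⟨by omega, h2⟩, h1, h3, h4⟩

section

variable {u : List DyckStep} (v : List DyckStep)

theorem mem_slices_archAppend_zero (hu : height u u.length = 0) (hu0 : ∀ k, 0 ≤ height u k)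
    (j : ℕ) : (0, j) ∈ slices (archAppend u v) ↔ j = u.length + 1 := by
  have hret : height (archAppend u v) (u.length + 2) = 0 := by
    simpa using height_archAppend_right v hu 0
  rw [mem_slices, length_archAppend, height_zero]
  constructor
  · rintro ⟨h1, h2, h3, h4⟩
    by_contra hne
    rcases Nat.lt_or_ge j (u.length + 1) with h | h
    · rw [height_archAppend_left u v (by omega)] at h3
      have := hu0 j
      omega
    · have := h4 (u.length + 2) (by omega) (by omega)
      rw [hret] at this
      exact lt_irrefl _ this
  · rintro rfl
    refine ⟨by omega, by omega, hret, fun k h1 h2 => ?_⟩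
    obtain ⟨k, rfl⟩ : ∃ m, k = m + 1 := ⟨k - 1, by omega⟩
    rw [height_archAppend_left u v (by omega), abs_zero, abs_pos]
    have := hu0 k
    omega

theorem mem_slices_archAppend_left (hu : height u u.length = 0) (hu0 : ∀ k, 0 ≤ height u k)
    {i : ℕ} (hi : i ≤ u.length) (j : ℕ) :
    (i + 1, j + 1) ∈ slices (archAppend u v) ↔ (i, j) ∈ slices u := by
  have hret : height (archAppend u v) (u.length + 2) = 0 := by
    simpa using height_archAppend_right v hu 0
  have habs : ∀ k, |1 + height u k| = 1 + |height u k| := fun k => by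
    rw [abs_of_nonneg (hu0 k), abs_of_nonneg (by have := hu0 k; omega)]
  rw [mem_slices, mem_slices, length_archAppend, height_archAppend_left u v hi]
  constructor
  · rintro ⟨h1, h2, h3, h4⟩
    have hj : j < u.length := by
      by_contra hj
      rcases Nat.lt_or_ge u.length j with h | h
      · have := h4 (u.length + 2) (by omega) (by omega)
        rw [hret] at this
        exact absurd this (not_lt.2 (by simp))
      · have : j = u.length := by omega
        subst this
        rw [show u.length + 1 + 1 = u.length + 2 by ring, hret] at h3
        have := hu0 i
        omega
    refine ⟨by omega, hj, ?_, fun k hk1 hk2 => ?_⟩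
    · rw [height_archAppend_left u v (by omega)] at h3
      linarith
    · have := h4 (k + 1) (by omega) (by omega)
      rw [height_archAppend_left u v (by omega), habs, habs] at this
      linarith
  · rintro ⟨h1, h2, h3, h4⟩
    refine ⟨by omega, by omega, ?_, fun k hk1 hk2 => ?_⟩
    · rw [height_archAppend_left u v (by omega), h3]
    · obtain ⟨k, rfl⟩ : ∃ m, k = m + 1 := ⟨k - 1, by omega⟩
      have := h4 k (by omega) (by omega)
      rw [height_archAppend_left u v (by omega), habs, habs]
      linarith

theorem mem_slices_archAppend_right (hu : height u u.length = 0) (i j : ℕ) :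
    (u.length + 2 + i, u.length + 2 + j) ∈ slices (archAppend u v) ↔ (i, j) ∈ slices v := by
  rw [mem_slices, mem_slices, length_archAppend, height_archAppend_right v hu, add_assoc _ j 1,
    height_archAppend_right v hu]
  constructor
  · rintro ⟨h1, h2, h3, h4⟩
    refine ⟨by omega, by omega, h3, fun k hk1 hk2 => ?_⟩
    have := h4 (u.length + 2 + k) (by omega) (by omega)
    rwa [height_archAppend_right v hu] at this
  · rintro ⟨h1, h2, h3, h4⟩
    refine ⟨by omega, by omega, h3, fun k hk1 hk2 => ?_⟩
    obtain ⟨k, rfl⟩ : ∃ m, k = u.length + 2 + m := ⟨k - (u.length + 2), by omega⟩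
    rw [height_archAppend_right v hu]
    exact h4 k (by omega) (by omega)

/-- The slices of an arch followed by a path: the lowest slice of the arch, the slices of the
excursion inside the arch, and the slices of the path behind it. -/
theorem slices_archAppend (hu : height u u.length = 0) (hu0 : ∀ k, 0 ≤ height u k) :
    slices (archAppend u v) = insert (0, u.length + 1)
      ((slices u).image (fun x => (x.1 + 1, x.2 + 1)) ∪
        (slices v).image fun x => (u.length + 2 + x.1, u.length + 2 + x.2)) := by
  ext ⟨i, j⟩
  simp only [Finset.mem_insert, Finset.mem_union, Finset.mem_image, Prod.exists, Prod.mk.injEq]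
  constructor
  · intro h
    have hij : i < j := (mem_slices.1 h).1
    rcases Nat.eq_zero_or_pos i with rfl | hi
    · exact Or.inl ⟨rfl, (mem_slices_archAppend_zero v hu hu0 j).1 h⟩
    · right
      rcases Nat.lt_or_ge (u.length + 1) i with h' | h'
      · obtain ⟨a, rfl⟩ : ∃ a, i = u.length + 2 + a := ⟨i - (u.length + 2), by omega⟩
        obtain ⟨b, rfl⟩ : ∃ b, j = u.length + 2 + b := ⟨j - (u.length + 2), by omega⟩
        exact Or.inr ⟨a, b, (mem_slices_archAppend_right v hu a b).1 h, rfl, rfl⟩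
      · obtain ⟨a, rfl⟩ : ∃ a, i = a + 1 := ⟨i - 1, by omega⟩
        obtain ⟨b, rfl⟩ : ∃ b, j = b + 1 := ⟨j - 1, by omega⟩
        exact Or.inl ⟨a, b, (mem_slices_archAppend_left v hu hu0 (by omega) b).1 h, rfl, rfl⟩
  · rintro (⟨rfl, rfl⟩ | ⟨a, b, h, rfl, rfl⟩ | ⟨a, b, h, rfl, rfl⟩)
    · exact (mem_slices_archAppend_zero v hu hu0 _).2 rfl
    · have := mem_slices.1 h
      exact (mem_slices_archAppend_left v hu hu0 (by omega) b).2 h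
    · exact (mem_slices_archAppend_right v hu a b).2 h

theorem cost_archAppend (ω : ℕ → ℝ) (hu : height u u.length = 0) (hu0 : ∀ k, 0 ≤ height u k) :
    cost ω (archAppend u v) = ω (u.length / 2) + cost ω u + cost ω v := by
  rw [cost, slices_archAppend v hu hu0, Finset.sum_insert, Finset.sum_union, Finset.sum_image,
    Finset.sum_image, ← add_assoc]
  · congr 1
    · congr 1
      refine Finset.sum_congr rfl fun x _ => ?_
      simp [sliceLength]
    · refine Finset.sum_congr rfl fun x _ => ?_
      simp [sliceLength, Nat.add_sub_add_left]
  · rintro ⟨a, b⟩ _ ⟨c, d⟩ _ h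
    simpa using h
  · rintro ⟨a, b⟩ _ ⟨c, d⟩ _ h
    simpa using h
  · rw [Finset.disjoint_left]
    rintro ⟨i, j⟩ h1 h2
    simp only [Finset.mem_image, Prod.exists, Prod.mk.injEq] at h1 h2
    obtain ⟨a, b, h, rfl, rfl⟩ := h1
    obtain ⟨c, d, h', h3, h4⟩ := h2
    have := mem_slices.1 h
    omega
  · simp only [Finset.mem_union, Finset.mem_image, Prod.exists, Prod.mk.injEq, not_or]
    constructor
    · rintro ⟨a, b, -, h, -⟩; omega
    · rintro ⟨a, b, -, h, -⟩; omega

end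

/-! ### Decomposition of paths at the first return -/

theorem height_length_of_mem_paths {e : Ensemble} {N : ℕ} {l : List DyckStep}
    (h : l ∈ paths e N) : height l l.length = 0 := by
  rw [height_length]
  cases e with
  | excursion => obtain ⟨h1, h2, -⟩ := mem_excursions.1 h; rw [h1, h2, sub_self]
  | bridge => obtain ⟨h1, h2⟩ := mem_bridges.1 h; rw [h1, h2, sub_self]

theorem length_of_mem_paths {e : Ensemble} {N : ℕ} {l : List DyckStep}
    (h : l ∈ paths e N) : l.length = 2 * N := by
  rw [length_eq_count_add]
  cases e with
  | excursion => obtain ⟨h1, h2, -⟩ := mem_excursions.1 h; omega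
  | bridge => obtain ⟨h1, h2⟩ := mem_bridges.1 h; omega

/-- A path that ends below its starting point splits at its first step to height `-1`. -/
theorem exists_eq_append_D (t : List DyckStep) (ht : height t t.length < 0) :
    ∃ u v, t = u ++ DyckStep.D :: v ∧ height u u.length = 0 ∧ ∀ k, 0 ≤ height u k := by
  classical
  have hex : ∃ k, height t k < 0 := ⟨_, ht⟩
  obtain ⟨k, hk, hmin⟩ : ∃ k, height t (k + 1) < 0 ∧ ∀ m, m ≤ k → 0 ≤ height t m := by
    have h1 := Nat.find_spec hex
    rcases hf : Nat.find hex with _ | k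
    · rw [hf, height_zero] at h1
      exact absurd h1 (lt_irrefl _)
    · refine ⟨k, by rwa [hf] at h1, fun m hm => ?_⟩
      exact not_lt.1 (Nat.find_min hex (by omega))
  have hkl : k < t.length := by
    by_contra h
    have h1 := height_of_length_le t (k := k) (by omega)
    have h2 := hmin k le_rfl
    omega
  have hk0 : height t k = 0 := by
    have h1 := height_succ_ge t k
    have h2 := hmin k le_rfl
    omega
  have hlen : (t.take k).length = k := by simp; omega
  have hu : ∀ m, m ≤ k → height (t.take k) m = height t m := fun m hm => by
    simp [height, List.take_take, hm]
  have hsplit : t = t.take k ++ t[k] :: t.drop (k + 1) := by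
    rw [← List.drop_eq_getElem_cons hkl, List.take_append_drop]
  have hD : t[k] = DyckStep.D := by
    rcases t[k].dichotomy with h | h
    · rw [h] at hsplit
      have h1 := height_append_add (t.take k) (DyckStep.U :: t.drop (k + 1)) 1
      rw [← hsplit, hlen, hu k le_rfl, hk0] at h1
      simp [height_cons_U _ 0] at h1
      have h2 := height_cons_U (t.drop (k + 1)) 0
      rw [zero_add, height_zero] at h2
      omega
    · exact h
  rw [hD] at hsplit
  refine ⟨_, _, hsplit, by rw [hlen, hu k le_rfl, hk0], fun m => ?_⟩
  rcases Nat.le_total m k with h | h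
  · rw [hu m h]; exact hmin m h
  · rw [height_of_length_le _ (by omega), hlen, hu k le_rfl, hk0]

theorem archAppend_mem_paths {e : Ensemble} {i j : ℕ} {u v : List DyckStep}
    (hu : u ∈ excursions i) : archAppend u v ∈ paths e (i + j + 1) ↔ v ∈ paths e j := by
  have hu' := mem_excursions.1 hu
  have hu0 := height_length_of_mem_paths (e := .excursion) hu
  have hcU : (archAppend u v).count DyckStep.U = i + v.count DyckStep.U + 1 := by
    simp [archAppend, hu'.1]
  have hcD : (archAppend u v).count DyckStep.D = i + v.count DyckStep.D + 1 := by
    simp [archAppend, hu'.2.1]; omega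
  cases e with
  | bridge =>
    simp only [paths, mem_bridges, hcU, hcD]
    omega
  | excursion =>
    simp only [paths, mem_excursions, hcU, hcD]
    constructor
    · rintro ⟨h1, h2, h3⟩
      refine ⟨by omega, by omega, fun k => ?_⟩
      rw [← height_archAppend_right v hu0]
      exact h3 _
    · rintro ⟨h1, h2, h3⟩
      refine ⟨by omega, by omega, fun k => ?_⟩
      rcases k with _ | k
      · simp
      · rcases Nat.lt_or_ge u.length k with h | h
        · obtain ⟨m, rfl⟩ : ∃ m, k = u.length + 1 + m := ⟨k - (u.length + 1), by omega⟩
          rw [show u.length + 1 + m + 1 = u.length + 2 + m by ring,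
            height_archAppend_right v hu0]
          exact h3 m
        · rw [height_archAppend_left u v h]
          have := hu'.2.2 k
          omega

theorem archAppend_injective {u v u' v' : List DyckStep}
    (hu : height u u.length = 0) (hu' : height u' u'.length = 0)
    (hu0 : ∀ k, 0 ≤ height u k) (hu0' : ∀ k, 0 ≤ height u' k)
    (h : archAppend u v = archAppend u' v') : u = u' ∧ v = v' := by
  have key : ∀ {u v u' v' : List DyckStep}, height u u.length = 0 → (∀ k, 0 ≤ height u' k) →
      archAppend u v = archAppend u' v' → ¬ u.length < u'.length := by
    intro u v u' v' hu hu0' h hlt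
    have h1 := height_archAppend_right v hu 0
    rw [h, add_zero, height_archAppend_left u' v' (by omega), height_zero] at h1
    have := hu0' (u.length + 1)
    omega
  have hlen : u.length = u'.length :=
    le_antisymm (not_lt.1 (key hu' hu0 h.symm)) (not_lt.1 (key hu hu0' h))
  simp only [archAppend, List.cons.injEq, true_and] at h
  have := List.append_inj h hlen
  exact ⟨this.1, (List.cons.inj this.2).2⟩

/-- Summation over the paths that start with an up-step. -/
theorem sum_paths_head_U (e : Ensemble) (N : ℕ) (f : List DyckStep → ℝ) :
    ∑ l ∈ (paths e (N + 1)).filter (fun l => l.head? = some DyckStep.U), f l =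
      ∑ x ∈ antidiagonal N, ∑ u ∈ excursions x.1, ∑ v ∈ paths e x.2, f (archAppend u v) := by
  simp_rw [← Finset.sum_product' (f := fun u v => f (archAppend u v))]
  rw [Finset.sum_sigma']
  symm
  refine Finset.sum_bij (fun a _ => archAppend a.2.1 a.2.2) ?_ ?_ ?_ fun _ _ => rfl
  · rintro ⟨⟨i, j⟩, u, v⟩ h
    simp only [Finset.mem_sigma, Finset.HasAntidiagonal.mem_antidiagonal, Finset.mem_product] at h
    rw [Finset.mem_filter, ← h.1, archAppend_mem_paths h.2.1]
    exact ⟨h.2.2, rfl⟩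
  · rintro ⟨⟨i, j⟩, u, v⟩ h ⟨⟨i', j'⟩, u', v'⟩ h' heq
    simp only [Finset.mem_sigma, Finset.HasAntidiagonal.mem_antidiagonal,
      Finset.mem_product] at h h'
    obtain ⟨rfl, rfl⟩ := archAppend_injective
      (height_length_of_mem_paths (e := .excursion) h.2.1)
      (height_length_of_mem_paths (e := .excursion) h'.2.1)
      (mem_excursions.1 h.2.1).2.2 (mem_excursions.1 h'.2.1).2.2 heq
    have hi : i = i' := by
      rw [← (mem_excursions.1 h.2.1).1, ← (mem_excursions.1 h'.2.1).1]
    have hj : j = j' := by omega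
    subst hi; subst hj; rfl
  · intro l hl
    rw [Finset.mem_filter] at hl
    obtain ⟨hl, hU⟩ := hl
    obtain ⟨t, rfl⟩ : ∃ t, l = DyckStep.U :: t := by
      cases l with
      | nil => simp at hU
      | cons s t => simp at hU; exact ⟨t, by rw [hU]⟩
    have h0 := height_length_of_mem_paths hl
    rw [List.length_cons, height_cons_U] at h0
    obtain ⟨u, v, rfl, hu, hu0⟩ := exists_eq_append_D t (by omega)
    have hu1 : u.count DyckStep.U = u.count DyckStep.D := by
      rw [height_length] at hu; omega
    have hue : u ∈ excursions (u.count DyckStep.U) := mem_excursions.2 ⟨rfl, hu1.symm, hu0⟩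
    have hcount : (archAppend u v).count DyckStep.U = N + 1 := by
      cases e with
      | excursion => exact (mem_excursions.1 hl).1
      | bridge => exact (mem_bridges.1 hl).1
    have hN : u.count DyckStep.U + v.count DyckStep.U = N := by
      simp [archAppend] at hcount; omega
    refine ⟨⟨(u.count DyckStep.U, v.count DyckStep.U), u, v⟩, ?_, rfl⟩
    simp only [Finset.mem_sigma, Finset.HasAntidiagonal.mem_antidiagonal, Finset.mem_product]
    refine ⟨hN, hue, ?_⟩
    rw [← archAppend_mem_paths hue, hN]
    exact hl

theorem sum_excursions_succ (N : ℕ) (f : List DyckStep → ℝ) :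
    ∑ l ∈ excursions (N + 1), f l =
      ∑ x ∈ antidiagonal N, ∑ u ∈ excursions x.1, ∑ v ∈ excursions x.2, f (archAppend u v) := by
  have h := sum_paths_head_U .excursion N f
  simp only [paths] at h
  rw [← h, Finset.filter_true_of_mem]
  intro l hl
  obtain ⟨h1, h2, h3⟩ := mem_excursions.1 hl
  cases l with
  | nil => simp at h1
  | cons s t =>
    cases s with
    | U => rfl
    | D =>
      have := h3 1
      rw [show (1 : ℕ) = 0 + 1 from rfl, height_cons_D] at this
      simp at this

/-- Reflection of a step at the axis. -/
def flipStep : DyckStep → DyckStep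
  | .U => .D
  | .D => .U

theorem flipStep_flipStep (s : DyckStep) : flipStep (flipStep s) = s := by cases s <;> rfl

theorem map_flipStep_map_flipStep (l : List DyckStep) :
    (l.map flipStep).map flipStep = l := by
  rw [List.map_map]
  conv_rhs => rw [← List.map_id l]
  congr 1
  ext s
  exact flipStep_flipStep s

theorem count_map_flipStep (l : List DyckStep) : (l.map flipStep).count DyckStep.U =
    l.count DyckStep.D ∧ (l.map flipStep).count DyckStep.D = l.count DyckStep.U := by
  induction l with
  | nil => simp
  | cons s l ih => cases s <;> simp [flipStep, ih.1, ih.2]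

theorem height_map_flipStep (l : List DyckStep) (k : ℕ) :
    height (l.map flipStep) k = -height l k := by
  rw [height, ← List.map_take, (count_map_flipStep _).1, (count_map_flipStep _).2, height]
  ring

theorem cost_map_flipStep (ω : ℕ → ℝ) (l : List DyckStep) :
    cost ω (l.map flipStep) = cost ω l := by
  have : slices (l.map flipStep) = slices l := by
    ext ⟨i, j⟩
    simp only [mem_slices, height_map_flipStep, List.length_map, abs_neg, neg_inj]
  rw [cost, this, cost]

/-- A function of the cost is summed over the bridges by summing over the bridges that start with
an up-step; the others are their reflections. -/
theorem sum_bridges_succ (ω : ℕ → ℝ) (N : ℕ) (f : ℝ → ℝ) :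
    ∑ l ∈ bridges (N + 1), f (cost ω l) = 2 * ∑ x ∈ antidiagonal N, ∑ u ∈ excursions x.1,
      ∑ v ∈ bridges x.2, f (cost ω (archAppend u v)) := by
  have h := sum_paths_head_U .bridge N fun l => f (cost ω l)
  simp only [paths] at h
  rw [← h, ← Finset.sum_filter_add_sum_filter_not (bridges (N + 1))
    (fun l => l.head? = some DyckStep.U), two_mul]
  congr 1
  refine Finset.sum_bij' (fun l _ => l.map flipStep) (fun l _ => l.map flipStep) ?_ ?_
    (fun l _ => map_flipStep_map_flipStep l) (fun l _ => map_flipStep_map_flipStep l)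
    (fun l _ => by rw [cost_map_flipStep])
  all_goals
    intro l hl
    rw [Finset.mem_filter, mem_bridges] at hl ⊢
    obtain ⟨⟨h1, h2⟩, h3⟩ := hl
    refine ⟨⟨by rw [(count_map_flipStep l).1, h2], by rw [(count_map_flipStep l).2, h1]⟩, ?_⟩
    cases l with
    | nil => simp at h1
    | cons s t => cases s <;> simp [flipStep] at h3 ⊢

theorem excursions_zero : excursions 0 = {[]} := by
  ext l
  rw [mem_excursions, Finset.mem_singleton]
  constructor
  · rintro ⟨h1, h2, -⟩
    rw [← List.length_eq_zero_iff, length_eq_count_add]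
    omega
  · rintro rfl
    simp [height]

theorem bridges_zero : bridges 0 = {[]} := by
  ext l
  rw [mem_bridges, Finset.mem_singleton]
  constructor
  · rintro ⟨h1, h2⟩
    rw [← List.length_eq_zero_iff, length_eq_count_add]
    omega
  · rintro rfl
    simp

theorem cost_nil (ω : ℕ → ℝ) : cost ω [] = 0 := by
  simp [cost, slices]

theorem cost_archAppend_of_mem (ω : ℕ → ℝ) {i : ℕ} {u : List DyckStep} (hu : u ∈ excursions i)
    (v : List DyckStep) : cost ω (archAppend u v) = cost ω u + ω i + cost ω v := by
  rw [cost_archAppend v ω (height_length_of_mem_paths (e := .excursion) hu)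
    (mem_excursions.1 hu).2.2, length_of_mem_paths (e := .excursion) hu,
    Nat.mul_div_cancel_left _ (by norm_num)]
  ring

/-! ### The moment generating series -/

/-- The generating series of the sums of `cost ω w ^ s / s!` over the paths of each size, where
the variable is scaled so that the radius of convergence is `1`. -/
def momentSeries (e : Ensemble) (ω : ℕ → ℝ) (s : ℕ) : PowerSeries ℝ :=
  PowerSeries.mk fun N => ∑ l ∈ paths e N, cost ω l ^ s / s.factorial / 4 ^ N

theorem coeff_momentSeries (e : Ensemble) (ω : ℕ → ℝ) (s N : ℕ) :
    coeff N (momentSeries e ω s) = ∑ l ∈ paths e N, cost ω l ^ s / s.factorial / 4 ^ N := by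
  simp [momentSeries]

theorem add_pow_div_factorial (x y : ℝ) (n : ℕ) : (x + y) ^ n / n.factorial =
    ∑ a ∈ antidiagonal n, x ^ a.1 / a.1.factorial * (y ^ a.2 / a.2.factorial) := by
  rw [(Commute.all x y).add_pow', Finset.sum_div]
  refine Finset.sum_congr rfl fun a ha => ?_
  have ha := Finset.HasAntidiagonal.mem_antidiagonal.1 ha
  have h1 : (n.choose a.1 : ℝ) * (a.1.factorial * a.2.factorial) = n.factorial := by
    rw [← ha, ← Nat.add_choose_mul_factorial_mul_factorial, Nat.choose_symm_add]; push_cast; ring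
  rw [nsmul_eq_mul, ← h1]
  have : (n.choose a.1 : ℝ) ≠ 0 := by
    have := Nat.choose_pos (n := n) (k := a.1) (by omega)
    positivity
  field_simp

/-- The binomial theorem, with the cost of the additional slice as one summand. -/
theorem coeff_archSeries (ω : ℕ → ℝ) (i n : ℕ) :
    coeff n (archSeries ω (momentSeries .excursion ω) i) =
      ∑ u ∈ excursions n, (cost ω u + ω n) ^ i / i.factorial / 4 ^ n := by
  simp_rw [archSeries, map_sum, coeff_hadamard, coeff_momentSeries, paths, Finset.mul_sum]
  rw [Finset.sum_comm]
  refine Finset.sum_congr rfl fun u _ => ?_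
  rw [add_comm (cost ω u), add_pow_div_factorial,
    Finset.Nat.sum_antidiagonal_eq_sum_range_succ_mk, Finset.sum_div]
  exact Finset.sum_congr rfl fun k _ => by ring

/-- Products of moment series correspond to concatenation: `s`-th moments of an arch followed by a
path. -/
theorem coeff_sum_archSeries_mul (e : Ensemble) (ω : ℕ → ℝ) (s N : ℕ) :
    coeff N (∑ x ∈ antidiagonal s,
      archSeries ω (momentSeries .excursion ω) x.1 * momentSeries e ω x.2) =
    ∑ y ∈ antidiagonal N, ∑ u ∈ excursions y.1, ∑ v ∈ paths e y.2,
      cost ω (archAppend u v) ^ s / s.factorial / 4 ^ N := by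
  simp_rw [map_sum, PowerSeries.coeff_mul, coeff_archSeries, coeff_momentSeries,
    Finset.sum_mul_sum]
  rw [Finset.sum_comm]
  refine Finset.sum_congr rfl fun y hy => ?_
  have hy := Finset.HasAntidiagonal.mem_antidiagonal.1 hy
  rw [Finset.sum_comm]
  refine Finset.sum_congr rfl fun u hu => ?_
  rw [Finset.sum_comm]
  refine Finset.sum_congr rfl fun v _ => ?_
  rw [cost_archAppend_of_mem ω hu, add_pow_div_factorial, Finset.sum_div, ← hy, pow_add]
  exact Finset.sum_congr rfl fun x _ => by field_simp

theorem excursionRec (ω : ℕ → ℝ) : ExcursionRec ω (momentSeries .excursion ω) := by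
  intro s
  ext N
  rcases N with _ | N
  · rw [coeff_momentSeries]
    rcases s with _ | s <;> simp [paths, excursions_zero, cost_nil]
  · rw [map_add, map_smul, PowerSeries.coeff_succ_X_mul, coeff_sum_archSeries_mul,
      coeff_momentSeries, paths, sum_excursions_succ]
    have : coeff (N + 1) (if s = 0 then 1 else 0 : PowerSeries ℝ) = 0 := by
      split_ifs
      · rw [PowerSeries.coeff_one, if_neg (Nat.succ_ne_zero N)]
      · simp
    rw [this, zero_add, smul_eq_mul]
    simp_rw [Finset.mul_sum]
    refine Finset.sum_congr rfl fun x _ => Finset.sum_congr rfl fun u _ =>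
      Finset.sum_congr rfl fun v _ => ?_
    rw [pow_succ]; field_simp

theorem bridgeRec (ω : ℕ → ℝ) :
    BridgeRec ω (momentSeries .excursion ω) (momentSeries .bridge ω) := by
  intro s
  ext N
  rcases N with _ | N
  · rw [coeff_momentSeries]
    rcases s with _ | s <;> simp [paths, bridges_zero, cost_nil]
  · rw [map_add, map_smul, PowerSeries.coeff_succ_X_mul, coeff_sum_archSeries_mul,
      coeff_momentSeries, paths, sum_bridges_succ ω N fun c => c ^ s / s.factorial / 4 ^ (N + 1)]
    have : coeff (N + 1) (if s = 0 then 1 else 0 : PowerSeries ℝ) = 0 := by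
      split_ifs
      · rw [PowerSeries.coeff_one, if_neg (Nat.succ_ne_zero N)]
      · simp
    rw [this, zero_add, smul_eq_mul]
    simp_rw [Finset.mul_sum]
    refine Finset.sum_congr rfl fun x _ => Finset.sum_congr rfl fun u _ =>
      Finset.sum_congr rfl fun v _ => ?_
    rw [pow_succ]; ring

/-- A path of size `N` has `N` slices; in the form used later: a constant added to `ω` is paid
`N` times. -/
theorem cost_sub_const (ω : ℕ → ℝ) (α : ℝ) (N : ℕ) {e : Ensemble} {l : List DyckStep}
    (hl : l ∈ paths e N) : cost (fun k => ω k - α) l = cost ω l - α * N := by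
  -- The induction step for paths that start with an up-step; the others are reflected first.
  have hU : ∀ N : ℕ, (∀ n < N, ∀ (e : Ensemble) (l : List DyckStep), l ∈ paths e n →
      cost (fun k => ω k - α) l = cost ω l - α * n) → ∀ (e : Ensemble) (t : List DyckStep),
      DyckStep.U :: t ∈ paths e N →
      cost (fun k => ω k - α) (DyckStep.U :: t) = cost ω (DyckStep.U :: t) - α * N := by
    intro N ih e t hl
    have h0 := height_length_of_mem_paths hl
    rw [List.length_cons, height_cons_U] at h0
    obtain ⟨u, v, rfl, hu, hu0⟩ := exists_eq_append_D t (by omega)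
    have hu1 : u.count DyckStep.U = u.count DyckStep.D := by
      rw [height_length] at hu; omega
    have hue : u ∈ excursions (u.count DyckStep.U) := mem_excursions.2 ⟨rfl, hu1.symm, hu0⟩
    have hcount : (archAppend u v).count DyckStep.U = N := by
      cases e with
      | excursion => exact (mem_excursions.1 hl).1
      | bridge => exact (mem_bridges.1 hl).1
    have hN : N = u.count DyckStep.U + v.count DyckStep.U + 1 := by
      simp [archAppend] at hcount; omega
    have hve : v ∈ paths e (v.count DyckStep.U) := by
      rw [← archAppend_mem_paths hue, ← hN]; exact hl
    change cost _ (archAppend u v) = cost ω (archAppend u v) - _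
    rw [cost_archAppend_of_mem _ hue, cost_archAppend_of_mem _ hue,
      ih _ (by omega) .excursion u hue, ih _ (by omega) e v hve]
    rw [hN]; push_cast; ring
  induction N using Nat.strong_induction_on generalizing e l with
  | _ N ih =>
  have ih' : ∀ n < N, ∀ (e : Ensemble) (l : List DyckStep), l ∈ paths e n →
      cost (fun k => ω k - α) l = cost ω l - α * n := fun n hn e l hl => ih n hn hl
  rcases l with _ | ⟨s, t⟩
  · have := length_of_mem_paths hl
    have hN : N = 0 := by simpa using this.symm
    simp [cost_nil, hN]
  · cases s with
    | U => exact hU N ih' e t hl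
    | D =>
      rw [← cost_map_flipStep, ← cost_map_flipStep ω]
      refine hU N ih' .bridge (t.map flipStep) ?_
      have hb : DyckStep.D :: t ∈ bridges N := by
        cases e with
        | bridge => exact hl
        | excursion =>
          obtain ⟨h1, h2, -⟩ := mem_excursions.1 hl
          exact mem_bridges.2 ⟨h1, h2⟩
      obtain ⟨h1, h2⟩ := mem_bridges.1 hb
      have h3 := count_map_flipStep (DyckStep.D :: t)
      exact mem_bridges.2 ⟨h3.1.trans h2, h3.2.trans h1⟩

/-! ### Abelian and Tauberian estimates -/

theorem sum_rpow_le {γ : ℝ} (hγ : -1 < γ) : ∃ C, 0 ≤ C ∧ ∀ n : ℕ,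
    ∑ k ∈ Finset.range (n + 1), ((k : ℝ) + 1) ^ γ ≤ C * ((n : ℝ) + 1) ^ (γ + 1) := by
  have hF : CoeffBound (fun _ => 1) (γ + 1 - 1) (PowerSeries.mk fun k : ℕ => ((k : ℝ) + 1) ^ γ) :=
    ⟨1, zero_le_one, fun n => by
      rw [PowerSeries.coeff_mk, abs_of_pos (by positivity)]; simp⟩
  obtain ⟨C, hC, h⟩ := (Err.of_pos isGauge_one (by linarith) hF).partialSum
  refine ⟨C, hC, fun n => ?_⟩
  have := (le_abs_self _).trans (h n)
  rw [coeff_powSeries_one_mul] at this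
  simpa using this

theorem summable_rpow_mul_pow {γ : ℝ} (hγ : -1 < γ) : ∃ C, 0 ≤ C ∧ ∀ z : ℝ, 0 ≤ z → z < 1 →
    Summable (fun k : ℕ => ((k : ℝ) + 1) ^ γ * z ^ k) ∧
    ∑' k : ℕ, ((k : ℝ) + 1) ^ γ * z ^ k ≤ C * (1 - z) ^ (-(γ + 1)) := by
  obtain ⟨C, hC, h⟩ := rpow_le_mul_powCoeff (β := γ + 1) (by linarith)
  simp only [add_sub_cancel_right] at h
  refine ⟨C, hC, fun z hz0 hz1 => ?_⟩
  have hs := (hasSum_powCoeff (γ + 1) hz0 hz1).mul_left C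
  have hle : ∀ k : ℕ, ((k : ℝ) + 1) ^ γ * z ^ k ≤ C * (powCoeff (γ + 1) k * z ^ k) := fun k => by
    rw [← mul_assoc]
    gcongr
    exact h k
  have hsum := Summable.of_nonneg_of_le (fun k => by positivity) hle hs.summable
  exact ⟨hsum, hasSum_le hle hsum.hasSum hs⟩

theorem summable_mul_pow_of_abs_le {v : ℕ → ℝ} {γ C : ℝ}
    (hv : ∀ k : ℕ, |v k| ≤ C * ((k : ℝ) + 1) ^ γ) {z : ℝ} (hz0 : 0 ≤ z) (hz1 : z < 1) :
    Summable fun k => v k * z ^ k := by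
  obtain ⟨D, hD, h⟩ := summable_rpow_mul_pow (γ := max γ 0) (by
    have := le_max_right γ 0; linarith)
  have hC : 0 ≤ C := by
    have := (abs_nonneg _).trans (hv 0)
    simpa using this
  refine Summable.of_norm_bounded ((h z hz0 hz1).1.mul_left C) fun k => ?_
  rw [Real.norm_eq_abs, abs_mul, abs_of_nonneg (pow_nonneg hz0 k), ← mul_assoc]
  gcongr
  refine (hv k).trans ?_
  gcongr
  · simp
  · exact le_max_left _ _

/-- Points below and close to `1`. -/
theorem eventually_nhdsLT_one : ∀ᶠ z : ℝ in 𝓝[<] 1, 0 < z ∧ z < 1 := by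
  filter_upwards [Ioo_mem_nhdsLT (zero_lt_one (α := ℝ))] with z hz using hz

theorem isBigO_one_sub_rpow {a b : ℝ} (h : b ≤ a) :
    (fun z : ℝ => (1 - z) ^ a) =O[𝓝[<] 1] fun z : ℝ => (1 - z) ^ b := by
  refine IsBigO.of_bound 1 ?_
  filter_upwards [eventually_nhdsLT_one] with z hz
  have : 0 < 1 - z := by linarith [hz.2]
  rw [Real.norm_of_nonneg (by positivity), Real.norm_of_nonneg (by positivity), one_mul]
  exact Real.rpow_le_rpow_of_exponent_ge this (by linarith [hz.1]) h

/-- An elementary Tauberian theorem: for coefficients of size `k ^ (γ - 1)`, a bound for the power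
series near `1` gives a bound for the partial sums. The `n`-th partial sum is compared with the
value at `z = 1 - 1 / (n + 1)`. -/
theorem sum_range_bound_of_isBigO {v : ℕ → ℝ} {γ : ℝ} (hγ : -1 < γ)
    (hv : ∃ C, 0 ≤ C ∧ ∀ k : ℕ, |v k| ≤ C * ((k : ℝ) + 1) ^ (γ - 1))
    (hf : (fun z : ℝ => ∑' k, v k * z ^ k) =O[𝓝[<] 1] fun z : ℝ => (1 - z) ^ (-γ)) :
    ∃ C, 0 ≤ C ∧ ∀ n : ℕ, |∑ k ∈ Finset.range (n + 1), v k| ≤ C * ((n : ℝ) + 1) ^ γ := by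
  obtain ⟨C, hC, hv⟩ := hv
  obtain ⟨c, hc⟩ := hf.bound
  obtain ⟨A, hA, hA'⟩ := sum_rpow_le hγ
  obtain ⟨B, hB, hB'⟩ := summable_rpow_mul_pow hγ
  have htend : Tendsto (fun n : ℕ => 1 - 1 / ((n : ℝ) + 1)) atTop (𝓝[<] 1) := by
    refine tendsto_nhdsWithin_iff.2 ⟨?_, Eventually.of_forall fun n => ?_⟩
    · simpa using (tendsto_one_div_add_atTop_nhds_zero_nat (𝕜 := ℝ)).const_sub 1
    · have : (0 : ℝ) < 1 / ((n : ℝ) + 1) := by positivity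
      simp only [Set.mem_Iio]; linarith
  obtain ⟨m, hm⟩ := eventually_atTop.1 (htend.eventually hc)
  refine exists_forall_abs_le (C := c + C * (A + B)) (m := m) (fun n => by positivity)
    fun n hn => ?_
  set N : ℝ := (n : ℝ) + 1 with hN
  have hN0 : 0 < N := by positivity
  set z : ℝ := 1 - 1 / N with hz
  have hz0 : 0 ≤ z := by
    rw [hz, sub_nonneg, div_le_one hN0, hN]; simp
  have hz1 : z < 1 := by
    have : 0 < 1 / N := by positivity
    linarith
  have hz1' : 1 - z = N⁻¹ := by rw [hz]; simp
  have hfz : |∑' k, v k * z ^ k| ≤ c * N ^ γ := by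
    have := hm n hn
    rw [← hN, ← hz, hz1', Real.inv_rpow hN0.le, Real.rpow_neg hN0.le, inv_inv,
      Real.norm_eq_abs, Real.norm_of_nonneg (by positivity)] at this
    exact this
  have h1 : HasSum (fun k => if k ∈ Finset.range (n + 1) then v k else 0)
      (∑ k ∈ Finset.range (n + 1), v k) := by
    have := hasSum_sum_of_ne_finset_zero
      (L := SummationFilter.unconditional ℕ) (s := Finset.range (n + 1))
      (f := fun k => if k ∈ Finset.range (n + 1) then v k else 0) (fun k hk => if_neg hk)
    convert this using 1
    exact Finset.sum_congr rfl fun k hk => (if_pos hk).symm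
  have h2 := (summable_mul_pow_of_abs_le hv hz0 hz1).hasSum
  have h3 : HasSum (fun k : ℕ => if k ∈ Finset.range (n + 1) then ((k : ℝ) + 1) ^ γ else 0)
      (∑ k ∈ Finset.range (n + 1), ((k : ℝ) + 1) ^ γ) := by
    have := hasSum_sum_of_ne_finset_zero
      (L := SummationFilter.unconditional ℕ) (s := Finset.range (n + 1))
      (f := fun k : ℕ => if k ∈ Finset.range (n + 1) then ((k : ℝ) + 1) ^ γ else 0)
      (fun k hk => if_neg hk)
    convert this using 1
    exact Finset.sum_congr rfl fun k hk => (if_pos hk).symm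
  have h4 := ((h3.add (hB' z hz0 hz1).1.hasSum).mul_left (C * N⁻¹))
  have h5 := (h1.sub h2).norm_le_of_bounded h4 fun k => by
    rw [Real.norm_eq_abs]
    have hvk := hv k
    have hpk : ((k : ℝ) + 1) ^ γ = ((k : ℝ) + 1) ^ (γ - 1) * ((k : ℝ) + 1) := by
      rw [← Real.rpow_add_one (by positivity)]; congr 1; ring
    have hzk : 0 ≤ z ^ k := pow_nonneg hz0 k
    split_ifs with hk
    -- Bernoulli's inequality gains a factor `(k + 1) / N` in the terms up to `n`.
    · have hb : 1 - z ^ k ≤ ((k : ℝ) + 1) * N⁻¹ := by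
        have := one_add_mul_le_pow (a := -N⁻¹) (by
          have : N⁻¹ ≤ 1 := inv_le_one_of_one_le₀ (by rw [hN]; simp)
          linarith) k
        rw [show 1 + -N⁻¹ = z by rw [← hz1']; ring] at this
        have hinv : 0 < N⁻¹ := by positivity
        nlinarith
      have hb0 : 0 ≤ 1 - z ^ k := by
        have := pow_le_one₀ (n := k) hz0 hz1.le; linarith
      rw [show v k - v k * z ^ k = v k * (1 - z ^ k) by ring, abs_mul, abs_of_nonneg hb0]
      calc |v k| * (1 - z ^ k) ≤ (C * ((k : ℝ) + 1) ^ (γ - 1)) * (((k : ℝ) + 1) * N⁻¹) := by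
            gcongr
        _ = C * N⁻¹ * ((k : ℝ) + 1) ^ γ := by rw [hpk]; ring
        _ ≤ _ := by
            gcongr
            have : 0 ≤ ((k : ℝ) + 1) ^ γ * z ^ k := by positivity
            linarith
    -- The terms beyond `n` may be enlarged by that factor, which is at least `1`.
    · have hkN : N ≤ (k : ℝ) + 1 := by
        simp only [Finset.mem_range, not_lt] at hk
        have : ((n + 1 : ℕ) : ℝ) ≤ k := by exact_mod_cast hk
        push_cast at this
        linarith
      rw [zero_sub, abs_neg, abs_mul, abs_of_nonneg hzk, zero_add]
      have : 1 ≤ ((k : ℝ) + 1) * N⁻¹ := by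
        rw [← div_eq_mul_inv, le_div_iff₀ hN0]; linarith
      calc |v k| * z ^ k ≤ (C * ((k : ℝ) + 1) ^ (γ - 1)) * z ^ k := by gcongr
        _ ≤ (C * ((k : ℝ) + 1) ^ (γ - 1)) * z ^ k * (((k : ℝ) + 1) * N⁻¹) :=
            le_mul_of_one_le_right (by positivity) this
        _ = _ := by rw [hpk]; ring
  rw [Real.norm_eq_abs] at h5
  have h6 : ∑' k : ℕ, ((k : ℝ) + 1) ^ γ * z ^ k ≤ B * N ^ (γ + 1) := by
    have := (hB' z hz0 hz1).2
    rwa [hz1', Real.inv_rpow hN0.le, Real.rpow_neg hN0.le, inv_inv] at this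
  have h7 : N⁻¹ * N ^ (γ + 1) = N ^ γ := by
    rw [Real.rpow_add_one hN0.ne']; field_simp
  calc |∑ k ∈ Finset.range (n + 1), v k|
      ≤ |∑' k, v k * z ^ k| + |∑ k ∈ Finset.range (n + 1), v k - ∑' k, v k * z ^ k| := by
        have := abs_add_le (∑' k, v k * z ^ k)
          (∑ k ∈ Finset.range (n + 1), v k - ∑' k, v k * z ^ k)
        simpa using this
    _ ≤ c * N ^ γ + C * N⁻¹ * (A * N ^ (γ + 1) + B * N ^ (γ + 1)) := by
        refine add_le_add hfz (h5.trans ?_)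
        have := hA' n
        gcongr
    _ = c * N ^ γ + C * (A + B) * (N⁻¹ * N ^ (γ + 1)) := by ring
    _ = _ := by rw [h7]; ring

/-- For `-1 < γ < 0`, coefficients of size `k ^ (γ - 1)` are dominated by those of
`1 - (1 - z) ^ (-γ)`, which are nonnegative and sum to `1`. -/
theorem tsum_rpow_mul_one_sub_pow {γ : ℝ} (hγ : -1 < γ) (hγ0 : γ < 0) : ∃ C, 0 ≤ C ∧
    Summable (fun k : ℕ => ((k : ℝ) + 1) ^ (γ - 1)) ∧ ∀ z : ℝ, 0 ≤ z → z < 1 →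
      ∑' k : ℕ, ((k : ℝ) + 1) ^ (γ - 1) * (1 - z ^ k) ≤ C * (1 - z) ^ (-γ) := by
  obtain ⟨A, hA, hA'⟩ := rpow_le_mul_powCoeff (β := γ + 1) (by linarith)
  simp only [add_sub_cancel_right] at hA'
  have hneg : ∀ k : ℕ, (-γ) * powCoeff (γ + 1) (k + 1) ≤ -powCoeff γ (k + 1) * ((k : ℝ) + 2) ∧
      0 ≤ -powCoeff γ (k + 1) := fun k => by
    have h1 := powCoeff_eq_mul γ (k + 1)
    have h2 := powCoeff_pos (β := γ + 1) (by linarith) (k + 1)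
    have hk : (0 : ℝ) ≤ k := by positivity
    push_cast at h1
    have h3 : 0 ≤ -powCoeff γ (k + 1) := by
      by_contra h
      push Not at h
      have : 0 < powCoeff γ (k + 1) * (γ + (k + 1)) := mul_pos (by linarith) (by linarith)
      nlinarith
    exact ⟨by nlinarith, h3⟩
  have hs1 : HasSum (fun k => -powCoeff γ (k + 1)) 1 := by
    rw [hasSum_iff_tendsto_nat_of_nonneg (fun k => (hneg k).2)]
    have e : ∀ n, ∑ k ∈ Finset.range n, -powCoeff γ (k + 1) = 1 - powCoeff (γ + 1) n := by
      intro n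
      have h1 := coeff_powSeries_one_mul (powSeries γ) n
      rw [powSeries_mul, add_comm, coeff_powSeries, Finset.sum_range_succ'] at h1
      simp only [coeff_powSeries] at h1
      rw [h1, Finset.sum_neg_distrib]
      simp [powCoeff]
    simp_rw [e]
    have hlim : Tendsto (powCoeff (γ + 1)) atTop (𝓝 0) := by
      obtain ⟨K, hK, hK'⟩ := abs_powCoeff_le (β := γ + 1) (by linarith)
      refine squeeze_zero_norm (a := fun n : ℕ => K * ((n : ℝ) + 1) ^ (-(-γ)))
        (fun n => by simpa using hK' n) ?_
      have := ((tendsto_rpow_neg_atTop (y := -γ) (by linarith)).comp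
        (tendsto_natCast_atTop_atTop.atTop_add
          (tendsto_const_nhds (x := (1 : ℝ))))).const_mul K
      simpa using this
    simpa using hlim.const_sub 1
  have hdom : ∀ k : ℕ, (((k + 1 : ℕ) : ℝ) + 1) ^ (γ - 1) ≤
      A * (-γ)⁻¹ * -powCoeff γ (k + 1) := fun k => by
    have h1 := (hneg k).1
    have h2 := hA' (k + 1)
    have hk2 : (((k + 1 : ℕ) : ℝ) + 1) = (k : ℝ) + 2 := by push_cast; ring
    rw [hk2] at h2 ⊢
    rw [Real.rpow_sub_one (by positivity), div_le_iff₀ (by positivity)]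
    have hg : 0 < -γ := by linarith
    calc ((k : ℝ) + 2) ^ γ ≤ A * (-γ)⁻¹ * ((-γ) * powCoeff (γ + 1) (k + 1)) := by
          rw [mul_assoc, inv_mul_cancel_left₀ hg.ne']; exact h2
      _ ≤ A * (-γ)⁻¹ * (-powCoeff γ (k + 1) * ((k : ℝ) + 2)) := by gcongr
      _ = _ := by ring
  have hD : 0 ≤ A * (-γ)⁻¹ := mul_nonneg hA (inv_nonneg.2 (by linarith))
  refine ⟨A * (-γ)⁻¹, hD, ?_, fun z hz0 hz1 => ?_⟩
  · rw [← summable_nat_add_iff 1]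
    exact Summable.of_nonneg_of_le (fun k => by positivity) hdom (hs1.summable.mul_left _)
  · have hz := (hasSum_nat_add_iff' 1).2 (hasSum_powCoeff γ hz0 hz1)
    simp only [Finset.range_one, Finset.sum_singleton, powCoeff, pow_zero, mul_one] at hz
    have hz2 : HasSum (fun k => -powCoeff γ (k + 1) * (1 - z ^ (k + 1))) ((1 - z) ^ (-γ)) := by
      convert hs1.add hz using 1
      · ext k; simp only [powCoeff]; ring
      · ring
    have hle : ∀ k : ℕ, (((k + 1 : ℕ) : ℝ) + 1) ^ (γ - 1) * (1 - z ^ (k + 1)) ≤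
        A * (-γ)⁻¹ * (-powCoeff γ (k + 1) * (1 - z ^ (k + 1))) := fun k => by
      rw [← mul_assoc]
      have : 0 ≤ 1 - z ^ (k + 1) := by
        have := pow_le_one₀ (n := k + 1) hz0 hz1.le; linarith
      exact mul_le_mul_of_nonneg_right (hdom k) this
    have hnn : ∀ k : ℕ, 0 ≤ (((k + 1 : ℕ) : ℝ) + 1) ^ (γ - 1) * (1 - z ^ (k + 1)) := fun k => by
      have : 0 ≤ 1 - z ^ (k + 1) := by
        have := pow_le_one₀ (n := k + 1) hz0 hz1.le; linarith
      exact mul_nonneg (by positivity) this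
    have hsum : Summable fun k : ℕ => (((k + 1 : ℕ) : ℝ) + 1) ^ (γ - 1) * (1 - z ^ (k + 1)) :=
      Summable.of_nonneg_of_le hnn hle (hz2.summable.mul_left _)
    have h0 : ∑' k : ℕ, ((k : ℝ) + 1) ^ (γ - 1) * (1 - z ^ k) =
        ∑' k : ℕ, (((k + 1 : ℕ) : ℝ) + 1) ^ (γ - 1) * (1 - z ^ (k + 1)) := by
      have hsum' : Summable fun k : ℕ => ((k : ℝ) + 1) ^ (γ - 1) * (1 - z ^ k) :=
        (summable_nat_add_iff (f := fun k : ℕ => ((k : ℝ) + 1) ^ (γ - 1) * (1 - z ^ k)) 1).1 hsum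
      rw [hsum'.tsum_eq_zero_add]
      simp
    rw [h0]
    exact hasSum_le hle hsum.hasSum (hz2.mul_left _)

/-! ### The constant `α` -/

theorem card_excursions (N : ℕ) : (excursions N).card = catalan N := by
  rw [excursions, Finset.card_image_of_injective, Finset.card_univ,
    DyckWord.card_dyckWord_semilength_eq_catalan]
  exact fun u v h => Subtype.ext (DyckWord.ext h)

theorem coeff_momentSeries_excursion_zero (ω : ℕ → ℝ) (N : ℕ) :
    coeff N (momentSeries .excursion ω 0) = 2 * normCatalan N := by
  rw [coeff_momentSeries, normCatalan, pow_succ, pow_mul]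
  simp only [paths, pow_zero, Nat.factorial_zero, Nat.cast_one, div_one, Finset.sum_const,
    card_excursions, nsmul_eq_mul]
  norm_num
  field_simp

theorem normCatalan_eq (N : ℕ) : normCatalan N = -powCoeff (-1 / 2) (N + 1) := by
  have h1 := (excursionRec fun _ => 0).coeff_zero N
  rw [coeff_momentSeries_excursion_zero] at h1
  linarith

theorem normCatalan_eq_div (N : ℕ) : normCatalan N = powCoeff (1 / 2) N / (2 * ((N : ℝ) + 1)) := by
  have h1 := powCoeff_eq_mul (-1 / 2) N
  rw [show (-1 / 2 : ℝ) + 1 = 1 / 2 by norm_num] at h1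
  rw [normCatalan_eq, powCoeff, show (-1 / 2 : ℝ) + N = N - 1 / 2 by ring] at *
  rw [h1]
  field_simp

theorem normCatalan_asymp : ∃ C, 0 ≤ C ∧ ∀ k : ℕ,
    |normCatalan k - ((k : ℝ) + 1) ^ (-3 / 2 : ℝ) / (2 * √Real.pi)| ≤
      C * ((k : ℝ) + 1) ^ (-5 / 2 : ℝ) := by
  obtain ⟨C, hC, h⟩ := powCoeff_asymp (β := 1 / 2) (by norm_num)
  refine ⟨C / 2, by positivity, fun k => ?_⟩
  have hk : (0 : ℝ) < (k : ℝ) + 1 := by positivity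
  have e1 : ((k : ℝ) + 1) ^ (-3 / 2 : ℝ) = ((k : ℝ) + 1) ^ (1 / 2 - 1 : ℝ) / ((k : ℝ) + 1) := by
    rw [← Real.rpow_sub_one hk.ne']; norm_num
  have e2 : ((k : ℝ) + 1) ^ (-5 / 2 : ℝ) = ((k : ℝ) + 1) ^ (1 / 2 - 2 : ℝ) / ((k : ℝ) + 1) := by
    rw [← Real.rpow_sub_one hk.ne']; norm_num
  have h := h k
  rw [Real.Gamma_one_half_eq] at h
  have e3 : normCatalan k - ((k : ℝ) + 1) ^ (-3 / 2 : ℝ) / (2 * √Real.pi) =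
      (powCoeff (1 / 2) k - ((k : ℝ) + 1) ^ (1 / 2 - 1 : ℝ) / √Real.pi) / (2 * ((k : ℝ) + 1)) := by
    rw [normCatalan_eq_div, e1]
    have : √Real.pi ≠ 0 := by positivity
    field_simp
  rw [e3, e2, abs_div, abs_of_pos (by positivity : 0 < 2 * ((k : ℝ) + 1)),
    div_le_iff₀ (by positivity)]
  refine h.trans (le_of_eq ?_)
  field_simp

theorem abs_normCatalan_le : ∃ C, 0 ≤ C ∧ ∀ k : ℕ,
    |normCatalan k| ≤ C * ((k : ℝ) + 1) ^ (-3 / 2 : ℝ) := by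
  obtain ⟨C, hC, h⟩ := (excursionRec fun _ => 0).coeffBound_zero
  refine ⟨C / 2, by positivity, fun k => ?_⟩
  have h := h k
  rw [coeff_momentSeries_excursion_zero, abs_mul, abs_two,
    show (-1 / 2 - 1 : ℝ) = -3 / 2 by norm_num] at h
  linarith

/-- The growth condition in a form that is valid for all `k`. -/
theorem HasGrowth.exists_bound {ω : ℕ → ℝ} {p η : ℝ} (h : HasGrowth ω p η) :
    ∃ C, 0 ≤ C ∧ ∀ k : ℕ, |ω k - ((k : ℝ) + 1) ^ p| ≤ C * ((k : ℝ) + 1) ^ (p - min η 1) := by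
  obtain ⟨K, hK, hKb⟩ := exists_abs_rpow_sub_rpow_le p (u := 1 / 2) (v := 1) (by norm_num)
  obtain ⟨c, hc0, hc⟩ := h.exists_pos
  obtain ⟨m, hm⟩ := eventually_atTop.1 hc.bound
  refine exists_forall_abs_le (C := c * 2 ^ |p - η| + K) (m := max m 1) (fun n => by positivity)
    fun n hn => ?_
  have hn1 : (1 : ℝ) ≤ n := by exact_mod_cast (le_max_right m 1).trans hn
  have h1 := hm n ((le_max_left m 1).trans hn)
  have hn0 : (0 : ℝ) < n := by linarith
  set N : ℝ := (n : ℝ) + 1 with hN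
  have hN0 : 0 < N := by positivity
  have hN1 : 1 ≤ N := by rw [hN]; linarith
  rw [Real.norm_eq_abs, Real.norm_of_nonneg (by positivity)] at h1
  have h2 : (n : ℝ) ^ (p - η) ≤ 2 ^ |p - η| * N ^ (p - η) := by
    rcases le_total 0 (p - η) with h | h
    · have h2 : (1 : ℝ) ≤ 2 ^ |p - η| := Real.one_le_rpow (by norm_num) (abs_nonneg _)
      calc (n : ℝ) ^ (p - η) ≤ N ^ (p - η) := by gcongr; linarith
        _ ≤ _ := le_mul_of_one_le_left (by positivity) h2
    · rw [abs_of_nonpos h, Real.rpow_neg (by norm_num), ← div_eq_inv_mul,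
        ← Real.div_rpow (by positivity) (by norm_num)]
      exact Real.rpow_le_rpow_of_nonpos (by positivity) (by linarith) h
  have h3 : |(n : ℝ) ^ p - N ^ p| ≤ K * N ^ (p - 1) := by
    have hq : (n : ℝ) / N ∈ Set.Icc (1 / 2 : ℝ) 1 :=
      ⟨by rw [le_div_iff₀ hN0]; linarith, by rw [div_le_one hN0]; linarith⟩
    have := hKb _ hq 1 ⟨by norm_num, le_rfl⟩
    rw [Real.one_rpow, Real.div_rpow hn0.le hN0.le] at this
    have hNp : 0 < N ^ p := by positivity
    have e : |(n : ℝ) / N - 1| = N⁻¹ := by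
      rw [show (n : ℝ) / N - 1 = -N⁻¹ by field_simp; rw [hN]; ring, abs_neg,
        abs_of_pos (by positivity)]
    rw [e] at this
    calc |(n : ℝ) ^ p - N ^ p| = N ^ p * |(n : ℝ) ^ p / N ^ p - 1| := by
          rw [← abs_of_pos hNp, ← abs_mul, abs_of_pos hNp, mul_sub, mul_div_cancel₀ _ hNp.ne',
            mul_one]
      _ ≤ N ^ p * (K * N⁻¹) := by gcongr
      _ = _ := by rw [Real.rpow_sub_one hN0.ne']; ring
  have h4 : N ^ (p - η) ≤ N ^ (p - min η 1) :=
    Real.rpow_le_rpow_of_exponent_le hN1 (by linarith [min_le_left η 1])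
  have h5 : N ^ (p - 1) ≤ N ^ (p - min η 1) :=
    Real.rpow_le_rpow_of_exponent_le hN1 (by linarith [min_le_right η 1])
  calc |ω n - N ^ p| ≤ |ω n - (n : ℝ) ^ p| + |(n : ℝ) ^ p - N ^ p| := by
        simpa using abs_add_le (ω n - (n : ℝ) ^ p) ((n : ℝ) ^ p - N ^ p)
    _ ≤ c * (2 ^ |p - η| * N ^ (p - η)) + K * N ^ (p - 1) := by
        refine add_le_add (h1.trans ?_) h3
        gcongr
    _ ≤ c * (2 ^ |p - η| * N ^ (p - min η 1)) + K * N ^ (p - min η 1) := by gcongr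
    _ = _ := by ring

/-- The coefficients of `∑ c_k ω(k) z ^ k` after removal of the singular part
`Γ(p - 1/2) / (2 √π) (1 - z) ^ (1/2 - p)`. -/
def regularCoeff (ω : ℕ → ℝ) (p : ℝ) (k : ℕ) : ℝ :=
  normCatalan k * ω k - Real.Gamma (p - 1 / 2) / (2 * √Real.pi) * powCoeff (p - 1 / 2) k

theorem Gamma_sub_half_ne_zero {p : ℝ} (hp : 0 < p) (hp2 : p ≠ 1 / 2) :
    Real.Gamma (p - 1 / 2) ≠ 0 := by
  refine Real.Gamma_ne_zero fun m hm => ?_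
  rcases m with _ | m
  · simp at hm; exact hp2 (by linarith)
  · push_cast at hm; have : (0 : ℝ) ≤ m := by positivity
    linarith

/-- The singular part is chosen such that the leading terms of both contributions to
`regularCoeff` cancel. -/
theorem regularCoeff_bound {ω : ℕ → ℝ} {p δ : ℝ} (hp : 0 < p) (hp2 : p ≠ 1 / 2) (hδ1 : δ ≤ 1)
    (hω : ∃ C, 0 ≤ C ∧ ∀ k : ℕ, |ω k - ((k : ℝ) + 1) ^ p| ≤ C * ((k : ℝ) + 1) ^ (p - δ)) :
    ∃ C, 0 ≤ C ∧ ∀ k : ℕ, |regularCoeff ω p k| ≤ C * ((k : ℝ) + 1) ^ (p - 1 / 2 - δ - 1) := by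
  obtain ⟨A, hA, hω⟩ := hω
  obtain ⟨B, hB, hc⟩ := abs_normCatalan_le
  obtain ⟨D, hD, hd⟩ := normCatalan_asymp
  obtain ⟨K, hK, hk⟩ := powCoeff_asymp (β := p - 1 / 2) (by linarith)
  set κ : ℝ := Real.Gamma (p - 1 / 2) / (2 * √Real.pi) with hκ
  refine ⟨B * A + D + |κ| * K, by positivity, fun k => ?_⟩
  have hω := hω k
  have hc := hc k
  have hd := hd k
  have hk := hk k
  set N : ℝ := (k : ℝ) + 1 with hN
  have hN0 : 0 < N := by positivity
  have hN1 : 1 ≤ N := by rw [hN]; simp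
  have hG := Gamma_sub_half_ne_zero hp hp2
  have e0 : N ^ (-3 / 2 : ℝ) * N ^ p = N ^ (p - 1 / 2 - 1) := by
    rw [← Real.rpow_add hN0]; congr 1; ring
  have e : regularCoeff ω p k = normCatalan k * (ω k - N ^ p) +
      (normCatalan k - N ^ (-3 / 2 : ℝ) / (2 * √Real.pi)) * N ^ p -
      κ * (powCoeff (p - 1 / 2) k - N ^ (p - 1 / 2 - 1) / Real.Gamma (p - 1 / 2)) := by
    rw [regularCoeff, ← e0, ← hκ]
    have : κ / Real.Gamma (p - 1 / 2) = 1 / (2 * √Real.pi) := by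
      rw [hκ, div_right_comm, div_self hG]
    linear_combination (-(N ^ (-3 / 2 : ℝ) * N ^ p)) * this
  have b1 : |normCatalan k * (ω k - N ^ p)| ≤ B * A * N ^ (p - 1 / 2 - δ - 1) := by
    rw [abs_mul]
    calc |normCatalan k| * |ω k - N ^ p| ≤ (B * N ^ (-3 / 2 : ℝ)) * (A * N ^ (p - δ)) := by gcongr
      _ = B * A * (N ^ (-3 / 2 : ℝ) * N ^ (p - δ)) := by ring
      _ = _ := by rw [← Real.rpow_add hN0]; congr 2; ring
  have b2 : |(normCatalan k - N ^ (-3 / 2 : ℝ) / (2 * √Real.pi)) * N ^ p| ≤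
      D * N ^ (p - 1 / 2 - δ - 1) := by
    rw [abs_mul, abs_of_pos (by positivity : 0 < N ^ p)]
    calc |normCatalan k - N ^ (-3 / 2 : ℝ) / (2 * √Real.pi)| * N ^ p
        ≤ (D * N ^ (-5 / 2 : ℝ)) * N ^ p := by gcongr
      _ = D * N ^ (-5 / 2 + p) := by rw [mul_assoc, ← Real.rpow_add hN0]
      _ ≤ _ := mul_le_mul_of_nonneg_left
        (Real.rpow_le_rpow_of_exponent_le hN1 (by linarith)) hD
  have b3 : |κ * (powCoeff (p - 1 / 2) k - N ^ (p - 1 / 2 - 1) / Real.Gamma (p - 1 / 2))| ≤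
      |κ| * K * N ^ (p - 1 / 2 - δ - 1) := by
    rw [abs_mul, mul_assoc]
    gcongr
    exact hk.trans (mul_le_mul_of_nonneg_left
      (Real.rpow_le_rpow_of_exponent_le hN1 (by linarith)) hK)
  rw [e]
  calc _ ≤ _ := abs_sub _ _
    _ ≤ |normCatalan k * (ω k - N ^ p)| +
        |(normCatalan k - N ^ (-3 / 2 : ℝ) / (2 * √Real.pi)) * N ^ p| + _ :=
        add_le_add (abs_add_le _ _) le_rfl
    _ ≤ _ := by linarith

/-- The constant `α` is the value at `1` of the regularised series, as far as the error term
allows this to be seen. -/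
theorem isAlpha_iff {ω : ℕ → ℝ} {p η α : ℝ} (hp : 0 < p) (hp2 : p ≠ 1 / 2)
    (hω : HasGrowth ω p η) : IsAlpha ω p η α ↔
      (fun z : ℝ => (∑' k, regularCoeff ω p k * z ^ k) - α) =O[𝓝[<] 1]
        fun z : ℝ => (1 - z) ^ (-(p - 1 / 2 - min η (1 / 2))) := by
  obtain ⟨C, hC, h⟩ := regularCoeff_bound hp hp2 (min_le_right η 1) hω.exists_bound
  rw [IsAlpha, show 1 / 2 - p + min η (1 / 2) = -(p - 1 / 2 - min η (1 / 2)) by ring]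
  refine isBigO_congr ?_ EventuallyEq.rfl
  filter_upwards [eventually_nhdsLT_one] with z hz
  have h1 := summable_mul_pow_of_abs_le h hz.1.le hz.2
  have h2 := (hasSum_powCoeff (p - 1 / 2) hz.1.le hz.2).mul_left
    (Real.Gamma (p - 1 / 2) / (2 * √Real.pi))
  have h3 := (h1.hasSum.add h2).tsum_eq
  have h4 : ∀ k, normCatalan k * ω k * z ^ k = regularCoeff ω p k * z ^ k +
      Real.Gamma (p - 1 / 2) / (2 * √Real.pi) * (powCoeff (p - 1 / 2) k * z ^ k) := fun k => by
    rw [regularCoeff]; ring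
  simp_rw [h4]
  rw [h3, show -(p - 1 / 2) = 1 / 2 - p by ring]
  ring

/-- With `γ = p - 1/2 - min η (1/2)`, the constant is the sum of the regular coefficients if this
series converges with the required rate (`γ < 0`), and any constant is absorbed by the error term
if `γ ≥ 0`. -/
theorem exists_isAlpha {ω : ℕ → ℝ} {p η : ℝ} (hp : 0 < p) (hp2 : p ≠ 1 / 2)
    (hω : HasGrowth ω p η) (hne : ¬(η = p - 1 / 2 ∧ η ≤ 1 / 2)) : ∃ α, IsAlpha ω p η α := by
  simp_rw [isAlpha_iff hp hp2 hω]
  obtain ⟨C, hC, h⟩ := regularCoeff_bound hp hp2 (min_le_right η 1) hω.exists_bound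
  set γ : ℝ := p - 1 / 2 - min η (1 / 2) with hγ
  have hmin : min η (1 / 2) ≤ min η 1 := min_le_min le_rfl (by norm_num)
  have hmin2 : min η (1 / 2) ≤ 1 / 2 := min_le_right _ _
  have h' : ∀ k : ℕ, |regularCoeff ω p k| ≤ C * ((k : ℝ) + 1) ^ (γ - 1) := fun k => by
    refine (h k).trans ?_
    gcongr
    · simp
    · linarith
  rcases lt_trichotomy γ 0 with h0 | h0 | h0
  · obtain ⟨D, hD, hs, hD'⟩ := tsum_rpow_mul_one_sub_pow (γ := γ) (by linarith) h0
    have hsum : Summable (regularCoeff ω p) :=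
      Summable.of_norm_bounded (hs.mul_left C) fun k => by simpa using h' k
    refine ⟨∑' k, regularCoeff ω p k, IsBigO.of_bound (C * D) ?_⟩
    filter_upwards [eventually_nhdsLT_one] with z hz
    have hz1 := summable_mul_pow_of_abs_le h' hz.1.le hz.2
    have hpos : 0 < 1 - z := by linarith [hz.2]
    rw [← hz1.tsum_sub hsum, Real.norm_of_nonneg (by positivity : 0 ≤ (1 - z) ^ (-γ)), mul_assoc]
    have hmaj : Summable fun k : ℕ => ((k : ℝ) + 1) ^ (γ - 1) * (1 - z ^ k) := by
      refine Summable.of_nonneg_of_le (fun k => ?_) (fun k => ?_) hs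
      · have := pow_le_one₀ (n := k) hz.1.le hz.2.le
        exact mul_nonneg (by positivity) (by linarith)
      · have := pow_nonneg hz.1.le k
        exact mul_le_of_le_one_right (by positivity) (by linarith)
    refine (tsum_of_norm_bounded (hmaj.hasSum.mul_left C) fun k => ?_).trans
      (mul_le_mul_of_nonneg_left (hD' z hz.1.le hz.2) hC)
    have h1 : 0 ≤ 1 - z ^ k := by
      have := pow_le_one₀ (n := k) hz.1.le hz.2.le
      linarith
    rw [show regularCoeff ω p k * z ^ k - regularCoeff ω p k =
      -(regularCoeff ω p k * (1 - z ^ k)) by ring, norm_neg, Real.norm_eq_abs, abs_mul,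
      abs_of_nonneg h1, ← mul_assoc]
    gcongr
    exact h' k
  · -- The borderline case: it can only occur for `p = 1`, with `η` beyond `1 / 2`.
    have hη2 : 1 / 2 < η := by
      by_contra hle
      push Not at hle
      rw [min_eq_left hle] at hγ
      exact hne ⟨by linarith, hle⟩
    have hs : Summable fun k : ℕ => ((k : ℝ) + 1) ^ (p - 1 / 2 - min η 1 - 1) := by
      rw [min_eq_right hη2.le] at hγ
      have hlt : 1 / 2 < min η 1 := lt_min hη2 (by norm_num)
      have := (summable_nat_add_iff 1).2 (Real.summable_nat_rpow
        (p := p - 1 / 2 - min η 1 - 1) |>.2 (by linarith))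
      simpa using this
    refine ⟨0, IsBigO.of_bound (∑' k : ℕ, C * ((k : ℝ) + 1) ^ (p - 1 / 2 - min η 1 - 1)) ?_⟩
    filter_upwards [eventually_nhdsLT_one] with z hz
    rw [h0, neg_zero, Real.rpow_zero, norm_one, mul_one, sub_zero]
    refine tsum_of_norm_bounded (hs.mul_left C).hasSum fun k => ?_
    rw [Real.norm_eq_abs, abs_mul, abs_of_nonneg (pow_nonneg hz.1.le k)]
    exact (mul_le_of_le_one_right (abs_nonneg _) (pow_le_one₀ hz.1.le hz.2.le)).trans (h k)
  · obtain ⟨D, hD, hD'⟩ := summable_rpow_mul_pow (γ := γ - 1) (by linarith)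
    refine ⟨0, IsBigO.of_bound (C * D) ?_⟩
    filter_upwards [eventually_nhdsLT_one] with z hz
    obtain ⟨h1, h2⟩ := hD' z hz.1.le hz.2
    have hpos : 0 < 1 - z := by linarith [hz.2]
    rw [sub_zero, Real.norm_of_nonneg (by positivity : 0 ≤ (1 - z) ^ (-γ)), mul_assoc]
    rw [sub_add_cancel] at h2
    refine (tsum_of_norm_bounded (h1.hasSum.mul_left C) fun k => ?_).trans
      (mul_le_mul_of_nonneg_left h2 hC)
    rw [Real.norm_eq_abs, abs_mul, abs_of_nonneg (pow_nonneg hz.1.le k), ← mul_assoc]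
    have := pow_nonneg hz.1.le k
    gcongr
    exact h' k

theorem IsAlpha.unique {ω : ℕ → ℝ} {p η α α' : ℝ} (hlt : p - 1 / 2 < min η (1 / 2))
    (h : IsAlpha ω p η α) (h' : IsAlpha ω p η α') : α = α' := by
  have h1 := h.sub h'
  have h2 : (fun _ : ℝ => α' - α) =O[𝓝[<] 1]
      fun z : ℝ => (1 - z) ^ (1 / 2 - p + min η (1 / 2)) := by
    refine h1.congr_left fun z => ?_
    ring
  have h3 : Tendsto (fun z : ℝ => (1 - z) ^ (1 / 2 - p + min η (1 / 2))) (𝓝[<] 1) (𝓝 0) := by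
    have : Tendsto (fun z : ℝ => (1 - z)) (𝓝[<] 1) (𝓝 0) := by
      have : Tendsto (fun z : ℝ => 1 - z) (𝓝 1) (𝓝 (1 - 1)) := tendsto_id.const_sub 1
      rw [sub_self] at this
      exact this.mono_left nhdsWithin_le_nhds
    have h4 := this.rpow_const (p := 1 / 2 - p + min η (1 / 2)) (Or.inr (by linarith))
    rwa [Real.zero_rpow (by linarith)] at h4
  have h4 := h2.trans_tendsto h3
  have := tendsto_nhds_unique h4 tendsto_const_nhds
  linarith

/-- Subtracting `α` from `ω` removes the constant term, up to a term of order `(1 - z) ^ (1/2)`. -/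
theorem IsAlpha.isBigO_sub {ω : ℕ → ℝ} {p η α : ℝ} (hp : 0 < p) (hp2 : p ≠ 1 / 2)
    (hω : HasGrowth ω p η) (h : IsAlpha ω p η α) :
    (fun z : ℝ => ∑' k, regularCoeff (fun k => ω k - α) p k * z ^ k) =O[𝓝[<] 1]
      fun z : ℝ => (1 - z) ^ (-(p - 1 / 2 - min p (min η (1 / 2)))) := by
  obtain ⟨C, hC, hb⟩ := regularCoeff_bound hp hp2 (min_le_right η 1) hω.exists_bound
  obtain ⟨D, hD, hd⟩ := abs_normCatalan_le
  rw [isAlpha_iff hp hp2 hω] at h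
  have h1 := h.trans (isBigO_one_sub_rpow (b := -(p - 1 / 2 - min p (min η (1 / 2))))
    (by linarith [min_le_right p (min η (1 / 2))]))
  -- The generating function of the normalized Catalan numbers is `(1 - (1 - z) ^ (1 / 2)) / z`.
  have h2 : (fun z : ℝ => α * (1 - (1 - (1 - z) ^ (1 / 2 : ℝ)) / z)) =O[𝓝[<] 1]
      fun z : ℝ => (1 - z) ^ (-(p - 1 / 2 - min p (min η (1 / 2)))) := by
    refine IsBigO.trans ?_ (isBigO_one_sub_rpow (a := 1 / 2)
      (by linarith [min_le_left p (min η (1 / 2))]))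
    refine IsBigO.const_mul_left (IsBigO.of_bound 1 ?_) _
    filter_upwards [eventually_nhdsLT_one] with z hz
    set t := (1 - z) ^ (1 / 2 : ℝ) with ht
    have hpos : 0 < 1 - z := by linarith [hz.2]
    have ht0 : 0 < t := by positivity
    have htz : z = 1 - t * t := by
      rw [ht, ← Real.rpow_add hpos]; norm_num
    have h1t : 1 - t ≠ 0 := by
      intro h0
      have : t = 1 := by linarith
      rw [this] at htz
      linarith [hz.1]
    have e : 1 - (1 - t) / z = t / (1 + t) := by
      rw [htz, show 1 - t * t = (1 - t) * (1 + t) by ring]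
      have : 1 + t ≠ 0 := by positivity
      field_simp
      ring
    rw [e, one_mul, Real.norm_of_nonneg (by positivity), Real.norm_of_nonneg ht0.le]
    exact div_le_self ht0.le (by linarith)
  refine (h1.add h2).congr' ?_ EventuallyEq.rfl
  filter_upwards [eventually_nhdsLT_one] with z hz
  have s1 := (summable_mul_pow_of_abs_le hb hz.1.le hz.2).hasSum
  have s2 : HasSum (fun k => normCatalan k * z ^ k) ((1 - (1 - z) ^ (1 / 2 : ℝ)) / z) := by
    have s := (hasSum_nat_add_iff' 1).2 (hasSum_powCoeff (-1 / 2) hz.1.le hz.2)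
    simp only [Finset.range_one, Finset.sum_singleton, powCoeff, pow_zero, mul_one] at s
    have s' := s.mul_left (-z⁻¹)
    have hz0 : z ≠ 0 := hz.1.ne'
    have ef : (fun k => normCatalan k * z ^ k) = fun i : ℕ =>
        -z⁻¹ * (powCoeff (-1 / 2) i * (-1 / 2 + i) / (i + 1) * z ^ (i + 1)) := by
      ext k
      rw [normCatalan_eq, powCoeff, pow_succ]
      field_simp
    have ea : (1 - (1 - z) ^ (1 / 2 : ℝ)) / z = -z⁻¹ * ((1 - z) ^ (-(-1 / 2 : ℝ)) - 1) := by
      rw [show -(-1 / 2 : ℝ) = 1 / 2 by norm_num]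
      field_simp
      ring
    rw [ef, ea]
    exact s'
  have s3 := (s1.sub (s2.mul_left α)).tsum_eq
  have s4 : ∀ k, regularCoeff (fun k => ω k - α) p k * z ^ k =
      regularCoeff ω p k * z ^ k - α * (normCatalan k * z ^ k) := fun k => by
    simp only [regularCoeff]; ring
  simp_rw [s4]
  rw [s3]
  ring

theorem HasGrowth.sub_const_bound {ω : ℕ → ℝ} {p η : ℝ} (hω : HasGrowth ω p η) (α : ℝ) :
    ∃ C, 0 ≤ C ∧ ∀ k : ℕ, |ω k - α - ((k : ℝ) + 1) ^ p| ≤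
      C * ((k : ℝ) + 1) ^ (p - min p (min η (1 / 2))) := by
  obtain ⟨C, hC, h⟩ := hω.exists_bound
  refine ⟨C + |α|, by positivity, fun k => ?_⟩
  have h1 : (1 : ℝ) ≤ ((k : ℝ) + 1) ^ (p - min p (min η (1 / 2))) :=
    Real.one_le_rpow (by simp) (by linarith [min_le_left p (min η (1 / 2))])
  have hle : min p (min η (1 / 2)) ≤ min η 1 :=
    (min_le_right _ _).trans (min_le_min le_rfl (by norm_num))
  have h2 : ((k : ℝ) + 1) ^ (p - min η 1) ≤ ((k : ℝ) + 1) ^ (p - min p (min η (1 / 2))) :=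
    Real.rpow_le_rpow_of_exponent_le (by simp) (by linarith)
  calc |ω k - α - ((k : ℝ) + 1) ^ p| = |(ω k - ((k : ℝ) + 1) ^ p) - α| := by ring_nf
    _ ≤ |ω k - ((k : ℝ) + 1) ^ p| + |α| := abs_sub _ _
    _ ≤ C * ((k : ℝ) + 1) ^ (p - min p (min η (1 / 2))) +
        |α| * ((k : ℝ) + 1) ^ (p - min p (min η (1 / 2))) := by
      refine add_le_add ((h k).trans (by gcongr)) (le_mul_of_one_le_right (abs_nonneg _) h1)
    _ = _ := by ring

/-- From partial sums of the regular coefficients to the first slice series. -/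
theorem asy_hadamard_of_sum_bound {L : ℕ → ℝ} (hL : IsGauge L) {ω : ℕ → ℝ} {p θ : ℝ}
    (h1 : ∃ C, 0 ≤ C ∧ ∀ k : ℕ, |regularCoeff ω p k| ≤ C * ((k : ℝ) + 1) ^ (p - 1 / 2 - θ - 1))
    (h2 : ∃ C, 0 ≤ C ∧ ∀ n : ℕ, |∑ k ∈ Finset.range (n + 1), regularCoeff ω p k| ≤
      C * ((n : ℝ) + 1) ^ (p - 1 / 2 - θ) * L n) :
    Asy L θ (p - 1 / 2) (Real.Gamma (p - 1 / 2) / √Real.pi)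
      (hadamard ω (momentSeries .excursion ω 0)) := by
  have e : hadamard ω (momentSeries .excursion ω 0) -
      (Real.Gamma (p - 1 / 2) / √Real.pi) • powSeries (p - 1 / 2) =
      (2 : ℝ) • PowerSeries.mk (regularCoeff ω p) := by
    ext k
    rw [map_sub, map_smul, map_smul, coeff_hadamard, coeff_momentSeries_excursion_zero,
      PowerSeries.coeff_mk, regularCoeff, coeff_powSeries, smul_eq_mul, smul_eq_mul]
    have : √Real.pi ≠ 0 := by positivity
    field_simp
  unfold Asy
  rw [e]
  refine Err.smul 2 ⟨?_, ?_⟩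
  · obtain ⟨C, hC, h⟩ := h1
    exact CoeffBound.gauge hL ⟨C, hC, fun n => by simpa using h n⟩
  · obtain ⟨C, hC, h⟩ := h2
    refine ⟨C, hC, fun n => ?_⟩
    rw [coeff_powSeries_one_mul]
    simpa using h n

theorem IsAlpha.asy {ω : ℕ → ℝ} {p η α : ℝ} (hp : 0 < p) (hp2 : p ≠ 1 / 2)
    (hω : HasGrowth ω p η) (h : IsAlpha ω p η α) :
    Asy (fun _ => 1) (min p (min η (1 / 2))) (p - 1 / 2) (Real.Gamma (p - 1 / 2) / √Real.pi)
      (hadamard (fun k => ω k - α) (momentSeries .excursion (fun k => ω k - α) 0)) := by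
  have hθ : min p (min η (1 / 2)) ≤ 1 / 2 := (min_le_right _ _).trans (min_le_right _ _)
  have h1 := regularCoeff_bound hp hp2 (hθ.trans (by norm_num)) (hω.sub_const_bound α)
  refine asy_hadamard_of_sum_bound isGauge_one h1 ?_
  obtain ⟨C, hC, h2⟩ := sum_range_bound_of_isBigO (by linarith) h1 (h.isBigO_sub hp hp2 hω)
  exact ⟨C, hC, fun n => by simpa using h2 n⟩

/-- In the resonant case `η = p - 1/2 ≤ 1/2` the regular coefficients are `O(1 / k)`, whatever `α`
is, and their partial sums are `O(log n)`. -/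
theorem HasGrowth.asy_log {ω : ℕ → ℝ} {p η : ℝ} (hp : 0 < p) (hp2 : p ≠ 1 / 2)
    (hω : HasGrowth ω p η) (hη : η = p - 1 / 2) (hη2 : η ≤ 1 / 2) (α : ℝ) :
    Asy (fun n => 1 + Real.log ((n : ℝ) + 1)) (min p (min η (1 / 2))) (p - 1 / 2)
      (Real.Gamma (p - 1 / 2) / √Real.pi)
      (hadamard (fun k => ω k - α) (momentSeries .excursion (fun k => ω k - α) 0)) := by
  have hθ : min p (min η (1 / 2)) = p - 1 / 2 := by
    rw [min_eq_left hη2, min_eq_right (by linarith), hη]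
  have h1 := regularCoeff_bound hp hp2
    (by rw [hθ]; linarith) (hω.sub_const_bound α)
  refine asy_hadamard_of_sum_bound isGauge_log h1 ?_
  obtain ⟨C, hC, h1⟩ := h1
  refine ⟨C, hC, fun n => ?_⟩
  rw [hθ, sub_self, Real.rpow_zero, mul_one]
  have hh : ∑ k ∈ Finset.range (n + 1), ((k : ℝ) + 1)⁻¹ ≤ 1 + Real.log ((n : ℝ) + 1) := by
    have := harmonic_le_one_add_log (n + 1)
    rw [harmonic] at this
    push_cast at this
    exact this
  calc |∑ k ∈ Finset.range (n + 1), regularCoeff (fun k => ω k - α) p k|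
      ≤ ∑ k ∈ Finset.range (n + 1), |regularCoeff (fun k => ω k - α) p k| :=
        Finset.abs_sum_le_sum_abs _ _
    _ ≤ ∑ k ∈ Finset.range (n + 1), C * ((k : ℝ) + 1)⁻¹ := Finset.sum_le_sum fun k _ => by
        have := h1 k
        rwa [hθ, sub_self, zero_sub, Real.rpow_neg_one] at this
    _ ≤ _ := by rw [← Finset.mul_sum]; gcongr

/-! ### The method of moments -/

/-- Taylor's formula for `exp (c y)` on `y ≥ 0`, with `c` purely imaginary of norm at most `1`. -/
theorem norm_exp_sub_sum_le {c : ℂ} (hc : c.re = 0) (hc1 : ‖c‖ ≤ 1) (n : ℕ) {y : ℝ} (hy : 0 ≤ y) :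
    ‖Complex.exp (c * y) - ∑ m ∈ Finset.range n, (c * y) ^ m / m.factorial‖ ≤
      y ^ n / n.factorial := by
  induction n generalizing y with
  | zero => simp [Complex.norm_exp, hc]
  | succ n ih =>
    have hderiv : ∀ x : ℝ, HasDerivAt (fun y : ℝ => Complex.exp (c * y) -
        ∑ m ∈ Finset.range (n + 1), (c * y) ^ m / m.factorial)
        (c * (Complex.exp (c * x) - ∑ m ∈ Finset.range n, (c * x) ^ m / m.factorial)) x := by
      intro x
      have h0 : HasDerivAt (fun y : ℝ => c * (y : ℂ)) c x := by
        simpa using (Complex.ofRealCLM.hasDerivAt (x := x)).const_mul c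
      have h1 := h0.cexp
      have h2 : HasDerivAt (fun y : ℝ => ∑ m ∈ Finset.range n,
          (c * (y : ℂ)) ^ (m + 1) / (m + 1).factorial)
          (∑ m ∈ Finset.range n, c * ((c * x) ^ m / m.factorial)) x := by
        refine HasDerivAt.fun_sum fun m _ => ?_
        refine ((h0.pow (m + 1)).div_const ((m + 1).factorial : ℂ)).congr_deriv ?_
        rw [Nat.factorial_succ]
        push_cast
        have : (m : ℂ) + 1 ≠ 0 := by exact_mod_cast Nat.succ_ne_zero m
        have : (m.factorial : ℂ) ≠ 0 := by exact_mod_cast Nat.factorial_ne_zero m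
        field_simp
      have h3 := h1.fun_sub (h2.add_const (1 : ℂ))
      have hfun : (fun y : ℝ => Complex.exp (c * y) -
          ∑ m ∈ Finset.range (n + 1), (c * y) ^ m / m.factorial) = fun y : ℝ =>
          Complex.exp (c * y) -
            (∑ m ∈ Finset.range n, (c * (y : ℂ)) ^ (m + 1) / (m + 1).factorial + 1) := by
        ext y
        rw [Finset.sum_range_succ']
        simp
      rw [hfun]
      refine h3.congr_deriv ?_
      rw [← Finset.mul_sum]; ring
    have hB : ∀ x : ℝ, HasDerivAt (fun x : ℝ => x ^ (n + 1) / ((n + 1).factorial : ℝ))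
        (x ^ n / n.factorial) x := by
      intro x
      refine ((hasDerivAt_pow (n + 1) x).div_const ((n + 1).factorial : ℝ)).congr_deriv ?_
      rw [Nat.factorial_succ]
      push_cast
      field_simp
    refine image_norm_le_of_norm_deriv_right_le_deriv_boundary (a := 0) (b := y)
      (fun x _ => (hderiv x).continuousAt.continuousWithinAt)
      (fun x _ => (hderiv x).hasDerivWithinAt) ?_ hB (fun x hx => ?_) (Set.right_mem_Icc.2 hy)
    · rw [Finset.sum_range_succ']
      simp
    · rw [norm_mul]
      exact (mul_le_of_le_one_left (norm_nonneg _) hc1).trans (ih hx.1)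

theorem norm_exp_mul_I_sub_sum_le (n : ℕ) (y : ℝ) :
    ‖Complex.exp (y * Complex.I) - ∑ m ∈ Finset.range n, (y * Complex.I) ^ m / m.factorial‖ ≤
      |y| ^ n / n.factorial := by
  rcases le_total 0 y with h | h
  · have := norm_exp_sub_sum_le (c := Complex.I) (by simp) (by simp) n h
    rw [abs_of_nonneg h]
    simpa [mul_comm] using this
  · have := norm_exp_sub_sum_le (c := -Complex.I) (by simp) (by simp) n (y := -y) (by linarith)
    rw [abs_of_nonpos h]
    simpa [mul_comm] using this

/-- The characteristic function is approximated by its Taylor polynomial; even order keeps the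
remainder free of absolute moments. -/
theorem norm_charFun_sub_sum_le (μ : ProbabilityMeasure ℝ)
    (hint : ∀ s : ℕ, Integrable (fun x : ℝ => x ^ s) (μ : Measure ℝ)) (t : ℝ) (n : ℕ) :
    ‖charFun (μ : Measure ℝ) t - ∑ k ∈ Finset.range (2 * n),
      (t * Complex.I) ^ k / k.factorial * ((∫ x, x ^ k ∂(μ : Measure ℝ) : ℝ) : ℂ)‖ ≤
      t ^ (2 * n) / (2 * n).factorial * ∫ x, x ^ (2 * n) ∂(μ : Measure ℝ) := by
  have h1 : ∀ k, Integrable (fun x : ℝ => (t * Complex.I) ^ k / k.factorial * ((x ^ k : ℝ) : ℂ))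
      (μ : Measure ℝ) := fun k => (hint k).ofReal.const_mul _
  have h2 : Integrable (fun x : ℝ => Complex.exp (t * x * Complex.I)) (μ : Measure ℝ) := by
    refine Integrable.of_bound (C := 1) (by fun_prop) (Eventually.of_forall fun x => ?_)
    rw [Complex.norm_exp]
    simp
  have h3 : charFun (μ : Measure ℝ) t - ∑ k ∈ Finset.range (2 * n),
      (t * Complex.I) ^ k / k.factorial * ((∫ x, x ^ k ∂(μ : Measure ℝ) : ℝ) : ℂ) =
      ∫ x : ℝ, (Complex.exp (t * x * Complex.I) - ∑ k ∈ Finset.range (2 * n),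
        (t * Complex.I) ^ k / k.factorial * ((x ^ k : ℝ) : ℂ)) ∂(μ : Measure ℝ) := by
    rw [integral_sub h2 (integrable_finsetSum _ fun k _ => h1 k),
      integral_finsetSum _ fun k _ => h1 k, charFun_apply_real]
    congr 1
    refine Finset.sum_congr rfl fun k _ => ?_
    rw [integral_const_mul, integral_complex_ofReal]
  rw [h3, ← integral_const_mul]
  refine norm_integral_le_of_norm_le ((hint (2 * n)).const_mul _)
    (Eventually.of_forall fun x => ?_)
  have := norm_exp_mul_I_sub_sum_le (2 * n) (t * x)
  have e : |t * x| ^ (2 * n) / (2 * n).factorial =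
      t ^ (2 * n) / (2 * n).factorial * x ^ (2 * n) := by
    rw [(even_two_mul n).pow_abs, mul_pow]; ring
  rw [e] at this
  have e2 : ∀ k : ℕ, (t * Complex.I) ^ k / k.factorial * ((x ^ k : ℝ) : ℂ) =
      (((t * x : ℝ) : ℂ) * Complex.I) ^ k / k.factorial := fun k => by
    push_cast; ring
  simp_rw [e2]
  rw [Complex.ofReal_mul] at this ⊢
  exact this

/-- Moments that do not grow too fast determine the measure. -/
theorem HasMoments.unique {ρ ρ' : ProbabilityMeasure ℝ} {m : ℕ → ℝ}
    (hm : ∀ t : ℝ, Tendsto (fun n : ℕ => t ^ (2 * n) / (2 * n).factorial * m (2 * n)) atTop (𝓝 0))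
    (h : HasMoments ρ m) (h' : HasMoments ρ' m) : ρ = ρ' := by
  have hext : (ρ : Measure ℝ) = ρ' := by
    refine Measure.ext_of_charFun (funext fun t => ?_)
    have key : ∀ n : ℕ, ‖charFun (ρ : Measure ℝ) t - charFun (ρ' : Measure ℝ) t‖ ≤
        2 * (t ^ (2 * n) / (2 * n).factorial * m (2 * n)) := fun n => by
      have h1 := norm_charFun_sub_sum_le ρ (fun s => (h s).1) t n
      have h2 := norm_charFun_sub_sum_le ρ' (fun s => (h' s).1) t n
      simp_rw [(h _).2] at h1
      simp_rw [(h' _).2] at h2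
      have := norm_sub_le_norm_sub_add_norm_sub (charFun (ρ : Measure ℝ) t)
        (∑ k ∈ Finset.range (2 * n), (t * Complex.I) ^ k / k.factorial * ((m k : ℝ) : ℂ))
        (charFun (ρ' : Measure ℝ) t)
      rw [norm_sub_rev (∑ k ∈ _, _)] at this
      linarith
    have h0 := ge_of_tendsto' ((hm t).const_mul 2) key
    rw [mul_zero] at h0
    exact sub_eq_zero.1 (norm_le_zero_iff.1 h0)
  exact Subtype.ext hext

/-- Convergence of all moments to those of a law with moments of moderate growth implies
convergence in distribution. -/
theorem HasMoments.tendsto {μ : ℕ → ProbabilityMeasure ℝ} {ρ : ProbabilityMeasure ℝ} {m : ℕ → ℝ}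
    (hm : ∀ t : ℝ, Tendsto (fun n : ℕ => t ^ (2 * n) / (2 * n).factorial * m (2 * n)) atTop (𝓝 0))
    (h : HasMoments ρ m)
    (hint : ∀ N (s : ℕ), Integrable (fun x : ℝ => x ^ s) (μ N : Measure ℝ))
    (hlim : ∀ s : ℕ, Tendsto (fun N => ∫ x, x ^ s ∂(μ N : Measure ℝ)) atTop (𝓝 (m s))) :
    Tendsto μ atTop (𝓝 ρ) := by
  rw [ProbabilityMeasure.tendsto_iff_tendsto_charFun]
  intro t
  rw [Metric.tendsto_atTop]
  intro ε hε
  obtain ⟨n, hn⟩ := ((hm t).eventually (gt_mem_nhds (by linarith : 0 < ε / 4))).exists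
  have hpoly : Tendsto (fun N => ∑ k ∈ Finset.range (2 * n), (t * Complex.I) ^ k / k.factorial *
      ((∫ x, x ^ k ∂(μ N : Measure ℝ) : ℝ) : ℂ)) atTop
      (𝓝 (∑ k ∈ Finset.range (2 * n), (t * Complex.I) ^ k / k.factorial * ((m k : ℝ) : ℂ))) :=
    tendsto_finsetSum _ fun k _ =>
      ((Complex.continuous_ofReal.tendsto _).comp (hlim k)).const_mul _
  have hrem : Tendsto (fun N => t ^ (2 * n) / (2 * n).factorial *
      ∫ x, x ^ (2 * n) ∂(μ N : Measure ℝ)) atTop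
      (𝓝 (t ^ (2 * n) / (2 * n).factorial * m (2 * n))) := (hlim (2 * n)).const_mul _
  obtain ⟨N₁, hN₁⟩ := Metric.tendsto_atTop.1 hpoly (ε / 4) (by linarith)
  obtain ⟨N₂, hN₂⟩ := eventually_atTop.1 (hrem.eventually (gt_mem_nhds hn))
  refine ⟨max N₁ N₂, fun N hN => ?_⟩
  have b1 := hN₁ N ((le_max_left _ _).trans hN)
  have b2 := hN₂ N ((le_max_right _ _).trans hN)
  have h1 := norm_charFun_sub_sum_le ρ (fun s => (h s).1) t n
  simp_rw [(h _).2] at h1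
  have h2 := norm_charFun_sub_sum_le (μ N) (hint N) t n
  rw [dist_eq_norm] at b1 ⊢
  set S := ∑ k ∈ Finset.range (2 * n), (t * Complex.I) ^ k / k.factorial *
    ((∫ x, x ^ k ∂(μ N : Measure ℝ) : ℝ) : ℂ)
  set S' := ∑ k ∈ Finset.range (2 * n), (t * Complex.I) ^ k / k.factorial * ((m k : ℝ) : ℂ)
  have t1 := norm_sub_le_norm_sub_add_norm_sub (charFun (μ N : Measure ℝ) t) S
    (charFun (ρ : Measure ℝ) t)
  have t2 := norm_sub_le_norm_sub_add_norm_sub S S' (charFun (ρ : Measure ℝ) t)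
  rw [norm_sub_rev S' (charFun (ρ : Measure ℝ) t)] at t2
  linarith

/-- Truncation of a real number to `[-M, M]`. -/
def truncate (M y : ℝ) : ℝ := max (-M) (min M y)

theorem abs_truncate_le {M : ℝ} (hM : 0 < M) (y : ℝ) : |truncate M y| ≤ M := by
  rw [truncate, abs_le]
  exact ⟨le_max_left _ _, max_le (by linarith) (min_le_left _ _)⟩

theorem abs_sub_truncate_le {M : ℝ} (hM : 0 < M) (y : ℝ) : |y - truncate M y| ≤ y ^ 2 / M := by
  rw [le_div_iff₀ hM, truncate]
  rcases le_total y (-M) with h | h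
  · rw [min_eq_right (by linarith), max_eq_left h, abs_of_nonpos (by linarith)]
    nlinarith
  · rcases le_total y M with h' | h'
    · rw [min_eq_right h', max_eq_right h]
      simp
      positivity
    · rw [min_eq_left h', max_eq_right (by linarith), abs_of_nonneg (by linarith)]
      nlinarith

theorem continuous_truncate (M : ℝ) : Continuous (truncate M) := by
  unfold truncate
  fun_prop

theorem integrable_truncate_pow {M : ℝ} (hM : 0 < M) (μ : ProbabilityMeasure ℝ) (s : ℕ) :
    Integrable (fun x : ℝ => truncate M (x ^ s)) (μ : Measure ℝ) :=
  Integrable.of_bound (C := M) ((continuous_truncate M).comp (continuous_pow s)).aestronglyMeasurable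
    (Eventually.of_forall fun x => by simpa using abs_truncate_le hM (x ^ s))

theorem abs_integral_sub_truncate_le {M : ℝ} (hM : 0 < M) (μ : ProbabilityMeasure ℝ)
    (hint : ∀ s : ℕ, Integrable (fun x : ℝ => x ^ s) (μ : Measure ℝ)) (s : ℕ) :
    |∫ x, x ^ s ∂(μ : Measure ℝ) - ∫ x, truncate M (x ^ s) ∂(μ : Measure ℝ)| ≤
      (∫ x, x ^ (2 * s) ∂(μ : Measure ℝ)) / M := by
  rw [← integral_sub (hint s) (integrable_truncate_pow hM μ s), ← integral_div,
    ← Real.norm_eq_abs]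
  refine norm_integral_le_of_norm_le ((hint (2 * s)).div_const M) (Eventually.of_forall fun x => ?_)
  have := abs_sub_truncate_le hM (x ^ s)
  rwa [← pow_mul, mul_comm s 2] at this

theorem tendsto_integral_truncate {l : Filter ℕ} {μ : ℕ → ProbabilityMeasure ℝ}
    {ρ : ProbabilityMeasure ℝ} (h : Tendsto μ l (𝓝 ρ)) {M : ℝ} (hM : 0 < M) (s : ℕ) :
    Tendsto (fun N => ∫ x, truncate M (x ^ s) ∂(μ N : Measure ℝ)) l
      (𝓝 (∫ x, truncate M (x ^ s) ∂(ρ : Measure ℝ))) :=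
  ProbabilityMeasure.tendsto_iff_forall_integral_tendsto.1 h
    (BoundedContinuousFunction.ofNormedAddCommGroup (fun x : ℝ => truncate M (x ^ s))
      ((continuous_truncate M).comp (continuous_pow s)) M
      fun x => by simpa using abs_truncate_le hM (x ^ s))

/-- Limits of moments are moments: if the moments of a sequence of laws converge, then some law
has the limits as its moments. -/
theorem exists_hasMoments {μ : ℕ → ProbabilityMeasure ℝ} {m : ℕ → ℝ}
    (hint : ∀ N (s : ℕ), Integrable (fun x : ℝ => x ^ s) (μ N : Measure ℝ))
    (hlim : ∀ s : ℕ, Tendsto (fun N => ∫ x, x ^ s ∂(μ N : Measure ℝ)) atTop (𝓝 (m s))) :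
    ∃ ρ : ProbabilityMeasure ℝ, HasMoments ρ m := by
  -- Bounded second moments give tightness.
  obtain ⟨K, hK⟩ := (hlim 2).bddAbove_range
  have hK' : ∀ N, ∫ x, x ^ 2 ∂(μ N : Measure ℝ) ≤ K := fun N => hK ⟨N, rfl⟩
  have htight : IsTightMeasureSet {x | ∃ ν ∈ Set.range μ, (ν : Measure ℝ) = x} := by
    refine isTightMeasureSet_of_tendsto_measure_norm_gt ?_
    have hub : ∀ r : ℝ, 0 < r → (⨆ ν ∈ {x | ∃ ν ∈ Set.range μ, ((ν : ProbabilityMeasure ℝ) :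
        Measure ℝ) = x}, (ν : Measure ℝ) {x | r < ‖x‖}) ≤ ENNReal.ofReal (K / r ^ 2) := by
      intro r hr
      refine iSup₂_le ?_
      rintro _ ⟨_, ⟨N, rfl⟩, rfl⟩
      have h1 := mul_meas_ge_le_integral_of_nonneg (μ := (μ N : Measure ℝ))
        (f := fun x : ℝ => x ^ 2) (Eventually.of_forall fun x => sq_nonneg x) (hint N 2) (r ^ 2)
      have h2 : (μ N : Measure ℝ).real {x : ℝ | r ^ 2 ≤ x ^ 2} ≤ K / r ^ 2 := by
        rw [le_div_iff₀ (by positivity), mul_comm]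
        exact h1.trans (hK' N)
      have h3 : (μ N : Measure ℝ) {x : ℝ | r < ‖x‖} ≤ (μ N : Measure ℝ) {x : ℝ | r ^ 2 ≤ x ^ 2} := by
        refine measure_mono fun x hx => ?_
        simp only [Set.mem_ofPred_eq, Real.norm_eq_abs] at hx ⊢
        rw [← sq_abs x]
        gcongr
      refine h3.trans ?_
      rw [← ENNReal.ofReal_toReal (measure_ne_top (μ N : Measure ℝ) {x : ℝ | r ^ 2 ≤ x ^ 2})]
      exact ENNReal.ofReal_le_ofReal h2
    have hlim0 : Tendsto (fun r : ℝ => ENNReal.ofReal (K / r ^ 2)) atTop (𝓝 0) := by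
      have : Tendsto (fun r : ℝ => K / r ^ 2) atTop (𝓝 0) :=
        tendsto_const_nhds.div_atTop (tendsto_pow_atTop two_ne_zero)
      simpa using ENNReal.tendsto_ofReal this
    refine tendsto_of_tendsto_of_tendsto_of_le_of_le' tendsto_const_nhds hlim0
      (Eventually.of_forall fun _ => zero_le) ?_
    filter_upwards [eventually_gt_atTop 0] with r hr using hub r hr
  -- By Prokhorov's theorem the laws converge along an ultrafilter.
  have hcomp := isCompact_closure_of_isTightMeasureSet htight
  obtain ⟨ρ, -, hρ⟩ := hcomp.ultrafilter_le_nhds ((Ultrafilter.of (atTop : Filter ℕ)).map μ)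
    (by
      refine le_principal_iff.2 ?_
      rw [Ultrafilter.mem_coe, Ultrafilter.mem_map]
      exact Filter.univ_mem' fun N => subset_closure ⟨N, rfl⟩)
  set U : Filter ℕ := (Ultrafilter.of (atTop : Filter ℕ) : Filter ℕ) with hU
  have hUle : U ≤ atTop := Ultrafilter.of_le _
  have hconv : Tendsto μ U (𝓝 ρ) := hρ
  -- Truncated even moments pass to the limit, and then the truncation is removed by Fatou's lemma.
  have hev : ∀ s : ℕ, ∀ M : ℝ, 0 < M →
      ∫ x, truncate M (x ^ (2 * s)) ∂(ρ : Measure ℝ) ≤ m (2 * s) := fun s M hM => by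
    refine le_of_tendsto_of_tendsto' (tendsto_integral_truncate hconv hM (2 * s))
      ((hlim (2 * s)).mono_left hUle) fun N => ?_
    refine integral_mono (integrable_truncate_pow hM (μ N) _) (hint N _) fun x => ?_
    have : 0 ≤ x ^ (2 * s) := by rw [pow_mul]; positivity
    exact max_le (by linarith) (min_le_right _ _)
  have hinteven : ∀ s : ℕ, Integrable (fun x : ℝ => x ^ (2 * s)) (ρ : Measure ℝ) := fun s => by
    refine ⟨(continuous_pow _).aestronglyMeasurable, ?_⟩
    have hnn : ∀ x : ℝ, 0 ≤ x ^ (2 * s) := fun x => by rw [pow_mul]; positivity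
    rw [hasFiniteIntegral_iff_ofReal (Eventually.of_forall hnn)]
    have hfatou : ∫⁻ x, ENNReal.ofReal (x ^ (2 * s)) ∂(ρ : Measure ℝ) ≤
        liminf (fun n : ℕ => ∫⁻ x, ENNReal.ofReal (truncate ((n : ℝ) + 1) (x ^ (2 * s)))
          ∂(ρ : Measure ℝ)) atTop := by
      refine le_trans (le_of_eq ?_) (lintegral_liminf_le fun n => ?_)
      · refine lintegral_congr fun x => ?_
        refine (Tendsto.liminf_eq ?_).symm
        refine tendsto_const_nhds.congr' ?_
        filter_upwards [eventually_ge_atTop ⌈x ^ (2 * s)⌉₊] with n hn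
        have h1 : x ^ (2 * s) ≤ n := (Nat.le_ceil _).trans (by exact_mod_cast hn)
        have := hnn x
        rw [truncate, min_eq_right (by linarith), max_eq_right (by linarith)]
      · exact (((continuous_truncate _).comp (continuous_pow _)).measurable).ennreal_ofReal
    refine (hfatou.trans (liminf_le_of_le (by isBoundedDefault) (a := ENNReal.ofReal (m (2 * s)))
      fun b hb => ?_)).trans_lt ENNReal.ofReal_lt_top
    obtain ⟨n, hn⟩ := hb.exists
    refine hn.trans ?_
    rw [← ofReal_integral_eq_lintegral_ofReal (integrable_truncate_pow (by positivity) ρ _)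
      (Eventually.of_forall fun x => ?_)]
    · exact ENNReal.ofReal_le_ofReal (hev s _ (by positivity))
    · have := hnn x
      have hn0 : (0 : ℝ) ≤ n := by positivity
      exact le_max_of_le_right (le_min (by positivity) this)
  have hintρ : ∀ s : ℕ, Integrable (fun x : ℝ => x ^ s) (ρ : Measure ℝ) := fun s => by
    refine Integrable.mono' ((hinteven s).add (integrable_const (1 : ℝ)))
      (continuous_pow _).aestronglyMeasurable (Eventually.of_forall fun x => ?_)
    rw [Real.norm_eq_abs]
    simp only [Pi.add_apply]
    have : |x ^ s| ^ 2 = x ^ (2 * s) := by rw [sq_abs, ← pow_mul, mul_comm]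
    nlinarith [sq_nonneg (|x ^ s| - 1), abs_nonneg (x ^ s)]
  refine ⟨ρ, fun s => ⟨hintρ s, ?_⟩⟩
  -- The moment of order `2 s` makes the moment of order `s` uniformly integrable.
  have hM : ∀ M : ℝ, 0 < M → |∫ x, x ^ s ∂(ρ : Measure ℝ) - m s| ≤
      ((∫ x, x ^ (2 * s) ∂(ρ : Measure ℝ)) + m (2 * s)) / M := by
    intro M hM
    have h1 := abs_integral_sub_truncate_le hM ρ hintρ s
    have h2 : |m s - ∫ x, truncate M (x ^ s) ∂(ρ : Measure ℝ)| ≤ m (2 * s) / M := by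
      refine le_of_tendsto_of_tendsto' (((hlim s).mono_left hUle).sub
        (tendsto_integral_truncate hconv hM s)).abs
        (((hlim (2 * s)).mono_left hUle).div_const M) fun N => ?_
      exact abs_integral_sub_truncate_le hM (μ N) (hint N) s
    rw [abs_sub_comm] at h2
    have := abs_sub_le (∫ x, x ^ s ∂(ρ : Measure ℝ)) (∫ x, truncate M (x ^ s) ∂(ρ : Measure ℝ)) (m s)
    rw [add_div]
    linarith
  have hlimM : Tendsto (fun M : ℝ => ((∫ x, x ^ (2 * s) ∂(ρ : Measure ℝ)) + m (2 * s)) / M)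
      atTop (𝓝 0) := tendsto_const_nhds.div_atTop tendsto_id
  have h0 := ge_of_tendsto hlimM (by
    filter_upwards [eventually_gt_atTop 0] with M hM0 using hM M hM0)
  have := abs_nonpos_iff.1 h0
  linarith

/-- A limit of laws on `[0, ∞)` is carried by `[0, ∞)`. -/
theorem measure_Iio_zero_of_tendsto {μ : ℕ → ProbabilityMeasure ℝ} {ρ : ProbabilityMeasure ℝ}
    (h : Tendsto μ atTop (𝓝 ρ)) (h0 : ∀ N, (μ N : Measure ℝ) (Set.Iio 0) = 0) :
    (ρ : Measure ℝ) (Set.Iio 0) = 0 := by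
  have h1 := ProbabilityMeasure.le_liminf_measure_open_of_tendsto h (isOpen_Iio (a := (0 : ℝ)))
  simp_rw [h0] at h1
  simpa using h1

/-! ### Growth of the limiting moments -/

theorem catalan_le_catalan_succ (n : ℕ) : catalan n ≤ catalan (n + 1) := by
  rw [catalan_succ']
  refine le_trans ?_ (Finset.single_le_sum (f := fun x : ℕ × ℕ => catalan x.1 * catalan x.2)
    (fun _ _ => Nat.zero_le _)
    (Finset.HasAntidiagonal.mem_antidiagonal.2 (zero_add n) : (0, n) ∈ antidiagonal n))
  simp

theorem catalan_le_four_pow (n : ℕ) : catalan n ≤ 4 ^ n := by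
  rw [catalan_eq_centralBinom_div]
  refine (Nat.div_le_self _ _).trans ?_
  rw [Nat.centralBinom, show (4 : ℕ) = 2 ^ 2 by norm_num, ← pow_mul]
  exact Nat.choose_le_two_pow _ _

theorem factorial_rpow_mul_le {p : ℝ} (hp : 0 < p) {i j n : ℕ} (h : i + j = n) :
    (i.factorial : ℝ) ^ p * (j.factorial : ℝ) ^ p ≤ (n.factorial : ℝ) ^ p := by
  rw [← Real.mul_rpow (by positivity) (by positivity)]
  refine Real.rpow_le_rpow (by positivity) ?_ hp.le
  have := Nat.le_of_dvd (Nat.factorial_pos _) (Nat.factorial_mul_factorial_dvd_factorial_add i j)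
  rw [h] at this
  exact_mod_cast this

/-- The Catalan numbers solve the quadratic part of the recursion exactly, the powers of factorials
absorb the quotients of Gamma values in its linear part. The factors `1 / 2` leave a share of `1 / 4`
to each of both parts. -/
theorem abs_muE_succ_le {p : ℝ} (hp : 0 < p) : ∃ R, 1 ≤ R ∧ ∀ n : ℕ,
    |muE p (n + 1)| ≤ 1 / 2 * R ^ (n + 1) * ((n + 1).factorial : ℝ) ^ p * catalan n := by
  set q : ℝ := p + 1 / 2 with hq
  have hq0 : 0 < q := by positivity
  set R : ℝ := max 1 (max (q ^ p) (2 * |muE p 1|)) with hR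
  have hR1 : 1 ≤ R := le_max_left _ _
  have hR2 : q ^ p ≤ R := (le_max_left _ _).trans (le_max_right _ _)
  have hR3 : 2 * |muE p 1| ≤ R := (le_max_right _ _).trans (le_max_right _ _)
  refine ⟨R, hR1, fun n => ?_⟩
  induction n using Nat.strong_induction_on with
  | _ n ih =>
  rcases n with _ | n
  · simp
    linarith
  · have hn : (0 : ℝ) ≤ n := by positivity
    have hnp : 0 ≤ n * p := by positivity
    have hx : 0 < ((n : ℝ) + 2) * q - p - 1 := by rw [hq]; nlinarith
    have hG := Real.Gamma_pos_of_pos hx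
    have hratio : |Real.Gamma ((n + 2) * q - 1) / (2 * Real.Gamma ((n + 2) * q - p - 1))| ≤
        1 / 2 * (R * ((n : ℝ) + 2) ^ p) := by
      have h1 := Gamma_add_le hx hp
      rw [show ((n : ℝ) + 2) * q - p - 1 + p = (n + 2) * q - 1 by ring] at h1
      have h2 : 0 < ((n : ℝ) + 2) * q - 1 := by linarith
      rw [abs_of_pos (div_pos (Real.Gamma_pos_of_pos h2) (by positivity)),
        div_le_iff₀ (by positivity)]
      have h3 : (((n : ℝ) + 2) * q - 1) ^ p ≤ R * ((n : ℝ) + 2) ^ p := by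
        calc (((n : ℝ) + 2) * q - 1) ^ p ≤ (((n : ℝ) + 2) * q) ^ p := by
              gcongr; linarith
          _ = ((n : ℝ) + 2) ^ p * q ^ p := Real.mul_rpow (by positivity) hq0.le
          _ ≤ ((n : ℝ) + 2) ^ p * R := by gcongr
          _ = _ := mul_comm _ _
      calc Real.Gamma ((n + 2) * q - 1)
          ≤ Real.Gamma ((n + 2) * q - p - 1) * (((n : ℝ) + 2) * q - 1) ^ p := h1
        _ ≤ Real.Gamma ((n + 2) * q - p - 1) * (R * ((n : ℝ) + 2) ^ p) := by gcongr
        _ = _ := by ring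
    have hfac : (((n + 2).factorial : ℕ) : ℝ) ^ p =
        ((n : ℝ) + 2) ^ p * ((n + 1).factorial : ℝ) ^ p := by
      rw [← Real.mul_rpow (by positivity) (by positivity), Nat.factorial_succ]
      push_cast
      congr 2
      ring
    have hcat : (catalan n : ℝ) ≤ catalan (n + 1) := by exact_mod_cast catalan_le_catalan_succ n
    have t1 : |muE p (n + 1) * (Real.Gamma ((n + 2) * q - 1) /
        (2 * Real.Gamma ((n + 2) * q - p - 1)))| ≤
        1 / 4 * R ^ (n + 2) * ((n + 2).factorial : ℝ) ^ p * catalan (n + 1) := by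
      rw [abs_mul]
      calc _ ≤ (1 / 2 * R ^ (n + 1) * ((n + 1).factorial : ℝ) ^ p * catalan n) *
            (1 / 2 * (R * ((n : ℝ) + 2) ^ p)) := by
            gcongr
            exact ih n (Nat.lt_succ_self n)
        _ = 1 / 4 * R ^ (n + 2) * ((n + 2).factorial : ℝ) ^ p * catalan n := by
            rw [hfac]; ring
        _ ≤ _ := by gcongr
    have t2 : |∑ x ∈ antidiagonal n, muE p (x.1 + 1) * muE p (x.2 + 1)| ≤
        1 / 4 * R ^ (n + 2) * ((n + 2).factorial : ℝ) ^ p * catalan (n + 1) := by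
      rw [catalan_succ']
      push_cast
      rw [Finset.mul_sum]
      refine (Finset.abs_sum_le_sum_abs _ _).trans (Finset.sum_le_sum fun x hx => ?_)
      have hx' := Finset.HasAntidiagonal.mem_antidiagonal.1 hx
      rw [abs_mul]
      calc |muE p (x.1 + 1)| * |muE p (x.2 + 1)|
          ≤ (1 / 2 * R ^ (x.1 + 1) * ((x.1 + 1).factorial : ℝ) ^ p * catalan x.1) *
            (1 / 2 * R ^ (x.2 + 1) * ((x.2 + 1).factorial : ℝ) ^ p * catalan x.2) := by
            gcongr
            · exact ih x.1 (by omega)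
            · exact ih x.2 (by omega)
        _ = 1 / 4 * R ^ (n + 2) * (((x.1 + 1).factorial : ℝ) ^ p * ((x.2 + 1).factorial : ℝ) ^ p) *
            (catalan x.1 * catalan x.2) := by
            rw [← hx', show x.1 + x.2 + 2 = (x.1 + 1) + (x.2 + 1) by ring, pow_add]; ring
        _ ≤ _ := by
            gcongr
            exact factorial_rpow_mul_le hp (by omega)
    rw [muE_add_two]
    calc _ ≤ _ := abs_add_le _ _
      _ ≤ _ := add_le_add t1 t2
      _ = _ := by ring

theorem abs_muE_le {p : ℝ} (hp : 0 < p) : ∃ R, 1 ≤ R ∧ ∀ s : ℕ,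
    |muE p s| ≤ R ^ s * (s.factorial : ℝ) ^ p := by
  obtain ⟨R, hR, h⟩ := abs_muE_succ_le hp
  refine ⟨4 * R, by linarith, fun s => ?_⟩
  rcases s with _ | n
  · simp [muE]; rw [abs_div]; norm_num
  · refine (h n).trans ?_
    have h4 : (catalan n : ℝ) ≤ 4 ^ n := by exact_mod_cast catalan_le_four_pow n
    calc 1 / 2 * R ^ (n + 1) * ((n + 1).factorial : ℝ) ^ p * catalan n
        ≤ 1 / 2 * R ^ (n + 1) * ((n + 1).factorial : ℝ) ^ p * 4 ^ n := by gcongr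
      _ ≤ 4 * R ^ (n + 1) * ((n + 1).factorial : ℝ) ^ p * 4 ^ n := by gcongr; norm_num
      _ = _ := by rw [mul_pow]; ring

/-- The convolution of two geometric sequences, as needed for the ratio `3` between the growth
constants of `muB` and `muE`. -/
theorem sum_antidiagonal_geom (R : ℝ) (n : ℕ) :
    ∑ x ∈ antidiagonal n, R ^ (x.1 + 1) * (3 * R) ^ x.2 =
      ((3 * R) ^ (n + 1) - R ^ (n + 1)) / 2 := by
  induction n with
  | zero => simp; ring
  | succ n ih =>
    rw [Finset.Nat.sum_antidiagonal_succ']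
    simp_rw [pow_succ (3 * R), ← mul_assoc]
    rw [← Finset.sum_mul, ← Finset.sum_mul, ih]
    ring

theorem abs_muB_le {p : ℝ} (hp : 0 < p) : ∃ R, 1 ≤ R ∧ ∀ s : ℕ,
    |muB p s| ≤ R ^ s * (s.factorial : ℝ) ^ p := by
  obtain ⟨R, hR, h⟩ := abs_muE_le hp
  refine ⟨3 * R, by linarith, fun s => ?_⟩
  induction s using Nat.strong_induction_on with
  | _ s ih =>
  rcases s with _ | n
  · simp [muB]
  · rw [muB_add_one, abs_mul, abs_two]
    have hsum : |∑ x ∈ antidiagonal n, muE p (x.1 + 1) * muB p x.2| ≤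
        ∑ x ∈ antidiagonal n, R ^ (x.1 + 1) * (3 * R) ^ x.2 * ((n + 1).factorial : ℝ) ^ p := by
      refine (Finset.abs_sum_le_sum_abs _ _).trans (Finset.sum_le_sum fun x hx => ?_)
      have hx' := Finset.HasAntidiagonal.mem_antidiagonal.1 hx
      rw [abs_mul]
      calc |muE p (x.1 + 1)| * |muB p x.2|
          ≤ (R ^ (x.1 + 1) * ((x.1 + 1).factorial : ℝ) ^ p) *
            ((3 * R) ^ x.2 * (x.2.factorial : ℝ) ^ p) := by
            gcongr
            · exact h _
            · exact ih x.2 (by omega)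
        _ = R ^ (x.1 + 1) * (3 * R) ^ x.2 *
            (((x.1 + 1).factorial : ℝ) ^ p * (x.2.factorial : ℝ) ^ p) := by ring
        _ ≤ _ := by
            gcongr
            exact factorial_rpow_mul_le hp (by omega)
    rw [← Finset.sum_mul, sum_antidiagonal_geom] at hsum
    have hRp : 0 < R ^ (n + 1) := by positivity
    calc 2 * |∑ x ∈ antidiagonal n, muE p (x.1 + 1) * muB p x.2|
        ≤ 2 * (((3 * R) ^ (n + 1) - R ^ (n + 1)) / 2 * ((n + 1).factorial : ℝ) ^ p) := by gcongr
      _ ≤ 2 * (((3 * R) ^ (n + 1)) / 2 * ((n + 1).factorial : ℝ) ^ p) := by gcongr; linarith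
      _ = _ := by ring

/-- `Γ (s q + a)` grows at least like `r ^ s * s! ^ q`. -/
theorem Gamma_lower_bound {q : ℝ} (hq : 0 < q) (a : ℝ) : ∃ c r : ℝ, 0 < c ∧ 0 < r ∧ ∃ s₀ : ℕ,
    ∀ s : ℕ, s₀ ≤ s → c * r ^ s * (s.factorial : ℝ) ^ q ≤ Real.Gamma (s * q + a) := by
  obtain ⟨s₀, hs₀⟩ := exists_nat_gt ((|a| + 1 + q) / (q / 2))
  rw [div_lt_iff₀ (by positivity)] at hs₀
  have hbig : ∀ s : ℕ, s₀ ≤ s → q / 2 * ((s : ℝ) + 1) ≤ s * q + a - 1 := fun s hs => by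
    have h1 : (s₀ : ℝ) ≤ s := by exact_mod_cast hs
    have h2 := neg_abs_le a
    nlinarith [mul_le_mul_of_nonneg_right h1 (by positivity : 0 ≤ q / 2)]
  set r : ℝ := (q / 2) ^ q with hr
  have hr0 : 0 < r := by positivity
  have hG0 : 0 < Real.Gamma (s₀ * q + a) := by
    refine Real.Gamma_pos_of_pos ?_
    have := hbig s₀ le_rfl
    have : 0 < q / 2 * ((s₀ : ℝ) + 1) := by positivity
    linarith
  refine ⟨Real.Gamma (s₀ * q + a) / (r ^ s₀ * (s₀.factorial : ℝ) ^ q), r, by positivity, hr0, s₀,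
    fun s hs => ?_⟩
  induction s, hs using Nat.le_induction with
  | base => rw [mul_assoc, div_mul_cancel₀ _ (by positivity)]
  | succ s hs ih =>
    have hb := hbig s hs
    have hb0 : 0 < q / 2 * ((s : ℝ) + 1) := by positivity
    have h1 := le_Gamma_add (x := s * q + a) (b := q) (by linarith) hq
    rw [show (s : ℝ) * q + a + q = ((s + 1 : ℕ) : ℝ) * q + a by push_cast; ring] at h1
    refine le_trans ?_ h1
    have h2 : r * ((s : ℝ) + 1) ^ q ≤ (s * q + a - 1) ^ q := by
      rw [hr, ← Real.mul_rpow (by positivity) (by positivity)]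
      gcongr
    have hf : (((s + 1).factorial : ℕ) : ℝ) ^ q = ((s : ℝ) + 1) ^ q * (s.factorial : ℝ) ^ q := by
      rw [← Real.mul_rpow (by positivity) (by positivity), Nat.factorial_succ]
      push_cast; rfl
    rw [hf, pow_succ]
    have hGs : 0 < Real.Gamma (s * q + a) := Real.Gamma_pos_of_pos (by linarith)
    set c := Real.Gamma (s₀ * q + a) / (r ^ s₀ * (s₀.factorial : ℝ) ^ q)
    calc c * (r ^ s * r) * (((s : ℝ) + 1) ^ q * (s.factorial : ℝ) ^ q)
        = (c * r ^ s * (s.factorial : ℝ) ^ q) * (r * ((s : ℝ) + 1) ^ q) := by ring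
      _ ≤ Real.Gamma (s * q + a) * (s * q + a - 1) ^ q := by gcongr

theorem tendsto_pow_div_factorial_mul_of_le {m : ℕ → ℝ} {C K : ℝ} {s₀ : ℕ}
    (h : ∀ s : ℕ, s₀ ≤ s → |m s| ≤ C * K ^ s * (s.factorial : ℝ) ^ (1 / 2 : ℝ)) (hK : 0 < K)
    (t : ℝ) : Tendsto (fun s : ℕ => t ^ s / s.factorial * m s) atTop (𝓝 0) := by
  have h1 := FloorSemiring.tendsto_pow_div_factorial_atTop ((|t| * K) ^ 2)
  have h2 := (h1.rpow_const (p := 1 / 2) (Or.inr (by norm_num))).const_mul C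
  rw [Real.zero_rpow (by norm_num), mul_zero] at h2
  refine squeeze_zero_norm' ?_ h2
  filter_upwards [eventually_ge_atTop s₀] with s hs
  have hf : (0 : ℝ) < s.factorial := by positivity
  have e1 : (((|t| * K) ^ 2) ^ s / (s.factorial : ℝ)) ^ (1 / 2 : ℝ) =
      (|t| * K) ^ s / (s.factorial : ℝ) ^ (1 / 2 : ℝ) := by
    rw [Real.div_rpow (by positivity) hf.le, ← pow_mul, mul_comm 2 s, pow_mul, ← Real.sqrt_eq_rpow,
      Real.sqrt_sq (by positivity)]
  have e2 : (s.factorial : ℝ) = (s.factorial : ℝ) ^ (1 / 2 : ℝ) * (s.factorial : ℝ) ^ (1 / 2 : ℝ) := by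
    rw [← Real.rpow_add hf]; norm_num
  rw [e1, Real.norm_eq_abs, abs_mul, abs_div, abs_pow, Nat.abs_cast]
  calc |t| ^ s / s.factorial * |m s|
      ≤ |t| ^ s / s.factorial * (C * K ^ s * (s.factorial : ℝ) ^ (1 / 2 : ℝ)) := by
        gcongr; exact h s hs
    _ = _ := by
        rw [mul_pow]
        nth_rewrite 1 [e2]
        have : (s.factorial : ℝ) ^ (1 / 2 : ℝ) ≠ 0 := by positivity
        field_simp

/-- The moments of the limit law grow at most like `K ^ s * √(s!)`, as for a Gaussian law. -/
theorem tendsto_pow_div_factorial_mul_limitMoment (e : Ensemble) {p : ℝ} (hp : 0 < p) (t : ℝ) :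
    Tendsto (fun s : ℕ => t ^ s / s.factorial * limitMoment e p s) atTop (𝓝 0) := by
  have key : ∀ (D a : ℝ) (ν : ℕ → ℝ), 0 < D →
      (∃ R, 1 ≤ R ∧ ∀ s : ℕ, |ν s| ≤ R ^ s * (s.factorial : ℝ) ^ p) →
      Tendsto (fun s : ℕ => t ^ s / s.factorial *
        (D * s.factorial / Real.Gamma (s * (p + 1 / 2) + a) * ν s)) atTop (𝓝 0) := by
    rintro D a ν hD ⟨R, hR, hν⟩
    obtain ⟨c, r, hc, hr, s₀, hG⟩ := Gamma_lower_bound (q := p + 1 / 2) (by linarith) a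
    have hR0 : 0 < R := by linarith
    refine tendsto_pow_div_factorial_mul_of_le (C := D / c) (K := R / r) (s₀ := s₀)
      (fun s hs => ?_) (by positivity) t
    have hf : (0 : ℝ) < s.factorial := by positivity
    have hlow := hG s hs
    have hlow0 : 0 < c * r ^ s * (s.factorial : ℝ) ^ (p + 1 / 2) := by positivity
    rw [abs_mul, abs_div, abs_of_pos (by positivity : 0 < D * s.factorial),
      abs_of_pos (hlow0.trans_le hlow)]
    calc D * s.factorial / Real.Gamma (s * (p + 1 / 2) + a) * |ν s|
        ≤ D * s.factorial / (c * r ^ s * (s.factorial : ℝ) ^ (p + 1 / 2)) *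
          (R ^ s * (s.factorial : ℝ) ^ p) := by
          gcongr
          exact hν s
      _ = _ := by
          have e2 : (s.factorial : ℝ) =
              (s.factorial : ℝ) ^ (1 / 2 : ℝ) * (s.factorial : ℝ) ^ (1 / 2 : ℝ) := by
            rw [← Real.rpow_add hf]; norm_num
          rw [Real.rpow_add hf, div_pow]
          nth_rewrite 1 [e2]
          have : (s.factorial : ℝ) ^ (1 / 2 : ℝ) ≠ 0 := by positivity
          have : (s.factorial : ℝ) ^ p ≠ 0 := by positivity
          field_simp
  cases e with
  | excursion =>
    have := key (4 * √Real.pi) (-1 / 2) (muE p) (by positivity) (abs_muE_le hp)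
    refine this.congr fun s => ?_
    rw [limitMoment, show (s : ℝ) * (p + 1 / 2) + -1 / 2 = s * (p + 1 / 2) - 1 / 2 by ring]
  | bridge => exact key (√Real.pi) (1 / 2) (muB p) (by positivity) (abs_muB_le hp)

theorem tendsto_even_limitMoment (e : Ensemble) {p : ℝ} (hp : 0 < p) (t : ℝ) :
    Tendsto (fun n : ℕ => t ^ (2 * n) / (2 * n).factorial * limitMoment e p (2 * n))
      atTop (𝓝 0) :=
  (tendsto_pow_div_factorial_mul_limitMoment e hp t).comp
    (tendsto_id.const_mul_atTop' (by norm_num : 0 < 2))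

/-! ### Moments of the rescaled costs -/

theorem toMeasure_map_uniformOfFinset {ι : Type*} (s : Finset ι) (hs : s.Nonempty) (f : ι → ℝ) :
    ((PMF.uniformOfFinset s hs).map f).toMeasure =
      (s.card : ENNReal)⁻¹ • ∑ l ∈ s, Measure.dirac (f l) := by
  classical
  ext A hA
  rw [PMF.toMeasure_apply_eq_toOuterMeasure_apply _ hA, PMF.toOuterMeasure_map_apply,
    PMF.toOuterMeasure_uniformOfFinset_apply, Measure.smul_apply, Measure.finsetSum_apply,
    smul_eq_mul, ENNReal.div_eq_inv_mul]
  congr 1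
  rw [Finset.card_filter]
  push_cast
  refine Finset.sum_congr rfl fun l _ => ?_
  rw [Measure.dirac_apply' _ hA]
  simp [Set.indicator_apply]

theorem coe_rescaledLaw (e : Ensemble) (ω : ℕ → ℝ) (p α : ℝ) (N : ℕ) :
    (rescaledLaw e ω p α N : Measure ℝ) = ((paths e N).card : ENNReal)⁻¹ •
      ∑ l ∈ paths e N, Measure.dirac ((cost ω l - α * N) / (N : ℝ) ^ (p + 1 / 2)) :=
  toMeasure_map_uniformOfFinset _ (paths_nonempty e N) _

theorem integrable_pow_rescaledLaw (e : Ensemble) (ω : ℕ → ℝ) (p α : ℝ) (N s : ℕ) :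
    Integrable (fun x : ℝ => x ^ s) (rescaledLaw e ω p α N : Measure ℝ) := by
  have h0 : ((paths e N).card : ENNReal) ≠ 0 := by
    exact_mod_cast (Finset.card_pos.2 (paths_nonempty e N)).ne'
  rw [coe_rescaledLaw]
  refine Integrable.smul_measure ?_ (ENNReal.inv_ne_top.2 h0)
  rw [integrable_finsetSum_measure]
  exact fun l _ => integrable_dirac (by simp [enorm_lt_top])

/-- The moments of the rescaled cost are quotients of coefficients of moment series; subtracting
`α N` from the cost amounts to subtracting the constant `α` from the cost function, because a path
of size `N` has exactly `N` slices. -/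
theorem integral_pow_rescaledLaw (e : Ensemble) (ω : ℕ → ℝ) (p α : ℝ) (N s : ℕ) :
    ∫ x, x ^ s ∂(rescaledLaw e ω p α N : Measure ℝ) = s.factorial *
      (coeff N (momentSeries e (fun k => ω k - α) s) / coeff N (momentSeries e (fun k => ω k - α) 0) /
        (N : ℝ) ^ (s * (p + 1 / 2))) := by
  have h0 : ((paths e N).card : ℝ) ≠ 0 := by
    exact_mod_cast (Finset.card_pos.2 (paths_nonempty e N)).ne'
  have hs : (s.factorial : ℝ) ≠ 0 := by positivity
  rw [coe_rescaledLaw, integral_smul_measure, integral_finsetSum_measure fun l _ =>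
    integrable_dirac (by simp [enorm_lt_top]), coeff_momentSeries, coeff_momentSeries]
  have e1 : (N : ℝ) ^ (s * (p + 1 / 2)) = ((N : ℝ) ^ (p + 1 / 2)) ^ s := by
    rw [mul_comm, Real.rpow_mul (Nat.cast_nonneg N), Real.rpow_natCast]
  have e2 : ∑ l ∈ paths e N, cost (fun k => ω k - α) l ^ s / s.factorial / 4 ^ N =
      ∑ l ∈ paths e N, (cost ω l - α * N) ^ s / s.factorial / 4 ^ N :=
    Finset.sum_congr rfl fun l hl => by rw [cost_sub_const ω α N hl]
  rw [e1, e2]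
  simp only [integral_dirac, pow_zero, Nat.factorial_zero, Nat.cast_one, div_one, Finset.sum_const,
    nsmul_eq_mul, ENNReal.toReal_inv, ENNReal.toReal_natCast, smul_eq_mul, div_pow]
  simp only [← Finset.sum_div]
  field_simp

theorem isBigO_rpow_sub_one (y : ℝ) :
    (fun N : ℕ => (((N : ℝ) + 1) / N) ^ y - 1) =O[atTop] fun N : ℕ => (N : ℝ)⁻¹ := by
  have h1 : HasDerivAt (fun t : ℝ => t ^ y) (y * 1 ^ (y - 1)) 1 :=
    Real.hasDerivAt_rpow_const (Or.inl one_ne_zero)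
  have h2 : Tendsto (fun N : ℕ => ((N : ℝ) + 1) / N) atTop (𝓝 1) := by
    have := (tendsto_inv_atTop_nhds_zero_nat (𝕜 := ℝ)).const_add 1
    rw [add_zero] at this
    refine this.congr' ?_
    filter_upwards [eventually_gt_atTop 0] with N hN
    field_simp
  have h3 := h1.isBigO_sub.comp_tendsto h2
  simp only [Function.comp_def, Real.one_rpow] at h3
  refine h3.congr' EventuallyEq.rfl ?_
  filter_upwards [eventually_gt_atTop 0] with N hN
  field_simp
  ring

/-- Division of two asymptotic expansions with power-law error terms. -/
theorem isBigO_ratio_sub {L : ℕ → ℝ} (hL : IsGauge L) {θ : ℝ} (hθ0 : 0 ≤ θ) (hθ : θ ≤ 1)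
    {x y A B : ℝ} (hB : B ≠ 0) {a d : ℕ → ℝ}
    (ha : ∃ C, 0 ≤ C ∧ ∀ N : ℕ, |a N - A * ((N : ℝ) + 1) ^ (x + y)| ≤
      C * ((N : ℝ) + 1) ^ (x + y - θ) * L N)
    (hd : ∃ C, 0 ≤ C ∧ ∀ N : ℕ, |d N - B * ((N : ℝ) + 1) ^ x| ≤ C * ((N : ℝ) + 1) ^ (x - 1)) :
    (fun N : ℕ => a N / d N / (N : ℝ) ^ y - A / B) =O[atTop]
      fun N : ℕ => (N : ℝ) ^ (-θ) * L N := by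
  obtain ⟨C, hC, ha⟩ := ha
  obtain ⟨D, hD, hd⟩ := hd
  -- Normalised, the quotient is `u w / v`, and the three factors tend to `A`, `1` and `B`.
  set u : ℕ → ℝ := fun N => a N / ((N : ℝ) + 1) ^ (x + y) with hu
  set v : ℕ → ℝ := fun N => d N / ((N : ℝ) + 1) ^ x with hv
  set w : ℕ → ℝ := fun N => (((N : ℝ) + 1) / N) ^ y with hw
  set g : ℕ → ℝ := fun N => (N : ℝ) ^ (-θ) * L N with hg
  have hinv : (fun N : ℕ => (N : ℝ)⁻¹) =O[atTop] g := by
    refine IsBigO.of_bound 1 ?_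
    filter_upwards [eventually_ge_atTop 1] with N hN
    have hN1 : (1 : ℝ) ≤ N := by exact_mod_cast hN
    have hLN := hL.one_le N
    have h1 : (N : ℝ) ^ (-1 : ℝ) ≤ (N : ℝ) ^ (-θ) := Real.rpow_le_rpow_of_exponent_le hN1 (by linarith)
    rw [Real.rpow_neg_one] at h1
    have h2 : (0 : ℝ) ≤ (N : ℝ)⁻¹ := by positivity
    rw [one_mul, Real.norm_of_nonneg h2, Real.norm_of_nonneg (by positivity)]
    nlinarith
  have hU : (fun N => u N - A) =O[atTop] g := by
    refine IsBigO.of_bound C ?_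
    filter_upwards [eventually_ge_atTop 1] with N hN
    have hN0 : (0 : ℝ) < N := by exact_mod_cast hN
    have hLN := hL.one_le N
    have hN' : (0 : ℝ) < ((N : ℝ) + 1) ^ (x + y) := by positivity
    have h1 : u N - A = (a N - A * ((N : ℝ) + 1) ^ (x + y)) / ((N : ℝ) + 1) ^ (x + y) := by
      simp only [hu]; field_simp
    rw [h1, norm_div, Real.norm_eq_abs, Real.norm_of_nonneg hN'.le,
      Real.norm_of_nonneg (by positivity), div_le_iff₀ hN']
    refine (ha N).trans ?_
    rw [Real.rpow_sub (by positivity), div_eq_mul_inv, ← Real.rpow_neg (by positivity)]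
    have h2 : ((N : ℝ) + 1) ^ (-θ) ≤ (N : ℝ) ^ (-θ) :=
      Real.rpow_le_rpow_of_nonpos hN0 (by linarith) (by linarith)
    calc C * (((N : ℝ) + 1) ^ (x + y) * ((N : ℝ) + 1) ^ (-θ)) * L N
        ≤ C * (((N : ℝ) + 1) ^ (x + y) * (N : ℝ) ^ (-θ)) * L N := by gcongr
      _ = _ := by ring
  have hV : (fun N => v N - B) =O[atTop] fun N : ℕ => (N : ℝ)⁻¹ := by
    refine IsBigO.of_bound D ?_
    filter_upwards [eventually_ge_atTop 1] with N hN
    have hN0 : (0 : ℝ) < N := by exact_mod_cast hN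
    have hN' : (0 : ℝ) < ((N : ℝ) + 1) ^ x := by positivity
    have h1 : v N - B = (d N - B * ((N : ℝ) + 1) ^ x) / ((N : ℝ) + 1) ^ x := by
      simp only [hv]; field_simp
    rw [h1, norm_div, Real.norm_eq_abs, Real.norm_of_nonneg hN'.le,
      Real.norm_of_nonneg (by positivity), div_le_iff₀ hN']
    refine (hd N).trans ?_
    rw [Real.rpow_sub_one (by positivity)]
    have h2 : ((N : ℝ) + 1)⁻¹ ≤ (N : ℝ)⁻¹ := by gcongr; linarith
    calc D * (((N : ℝ) + 1) ^ x / ((N : ℝ) + 1)) = D * ((N : ℝ) + 1)⁻¹ * ((N : ℝ) + 1) ^ x := by ring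
      _ ≤ _ := by gcongr
  have hVt : Tendsto v atTop (𝓝 B) := by
    have := (hV.trans_tendsto tendsto_inv_atTop_nhds_zero_nat).add_const B
    simpa using this
  have hVi : (fun N => (v N)⁻¹) =O[atTop] fun _ => (1 : ℝ) := (hVt.inv₀ hB).isBigO_one ℝ
  have hW : (fun N => w N - 1) =O[atTop] g := (isBigO_rpow_sub_one y).trans hinv
  have hWt : Tendsto w atTop (𝓝 1) := by
    have := ((isBigO_rpow_sub_one y).trans_tendsto tendsto_inv_atTop_nhds_zero_nat).add_const 1
    simpa using this
  have h1 : (fun N => u N * w N - A) =O[atTop] g := by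
    have h2 := (hU.mul (hWt.isBigO_one ℝ)).add ((hW.const_mul_left A).mul
      (isBigO_refl (fun _ : ℕ => (1 : ℝ)) atTop))
    refine (h2.congr_left fun N => ?_).congr_right fun N => mul_one _
    ring
  have h3 : (fun N => (v N)⁻¹ - B⁻¹) =O[atTop] g := by
    have h4 := ((hV.trans hinv).const_mul_left (-B⁻¹)).mul hVi
    refine (h4.congr' ?_ EventuallyEq.rfl).congr_right fun N => mul_one _
    filter_upwards [hVt.eventually_ne hB] with N hN
    field_simp
    ring
  have h5 := (h1.mul hVi).add ((h3.const_mul_left A).mul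
    (isBigO_refl (fun _ : ℕ => (1 : ℝ)) atTop))
  refine (h5.congr' ?_ EventuallyEq.rfl).congr_right fun N => mul_one _
  filter_upwards [eventually_ge_atTop 1] with N hN
  have hN0 : (0 : ℝ) < N := by exact_mod_cast hN
  have e1 : a N / d N / (N : ℝ) ^ y = u N * w N * (v N)⁻¹ := by
    simp only [hu, hv, hw]
    rw [Real.div_rpow (by positivity) hN0.le, Real.rpow_add (by positivity)]
    field_simp
  rw [e1]
  ring

theorem Asy.coeff_asymp {L : ℕ → ℝ} (hL : IsGauge L) {θ β C : ℝ} (hθ : θ ≤ 1) (hβ : -1 < β)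
    {F : PowerSeries ℝ} (h : Asy L θ β C F) : ∃ K, 0 ≤ K ∧ ∀ N : ℕ,
      |coeff N F - C / Real.Gamma β * ((N : ℝ) + 1) ^ (β - 1)| ≤
        K * ((N : ℝ) + 1) ^ (β - 1 - θ) * L N := by
  obtain ⟨K, hK, h1⟩ := Err.coeff h
  obtain ⟨D, hD, h2⟩ := powCoeff_asymp hβ
  refine ⟨K + |C| * D, by positivity, fun N => ?_⟩
  have h1 := h1 N
  have hLN := hL.one_le N
  have hle : ((N : ℝ) + 1) ^ (β - 2) ≤ ((N : ℝ) + 1) ^ (β - 1 - θ) * L N := by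
    have h3 : ((N : ℝ) + 1) ^ (β - 2) ≤ ((N : ℝ) + 1) ^ (β - 1 - θ) :=
      Real.rpow_le_rpow_of_exponent_le (by simp) (by linarith)
    exact h3.trans (le_mul_of_one_le_right (by positivity) hLN)
  rw [map_sub, map_smul, coeff_powSeries, smul_eq_mul, show β - θ - 1 = β - 1 - θ by ring] at h1
  calc |coeff N F - C / Real.Gamma β * ((N : ℝ) + 1) ^ (β - 1)|
      = |(coeff N F - C * powCoeff β N) +
          C * (powCoeff β N - ((N : ℝ) + 1) ^ (β - 1) / Real.Gamma β)| := by congr 1; ring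
    _ ≤ _ := abs_add_le _ _
    _ ≤ K * ((N : ℝ) + 1) ^ (β - 1 - θ) * L N + |C| * (D * ((N : ℝ) + 1) ^ (β - 2)) := by
        rw [abs_mul C]
        gcongr
        exact h2 N
    _ ≤ K * ((N : ℝ) + 1) ^ (β - 1 - θ) * L N + |C| * (D * (((N : ℝ) + 1) ^ (β - 1 - θ) * L N)) := by
        gcongr
    _ = _ := by ring

theorem limitMoment_excursion_zero (p : ℝ) : limitMoment .excursion p 0 = 1 := by
  have h := Real.Gamma_add_one (s := -1 / 2) (by norm_num)
  rw [show (-1 / 2 : ℝ) + 1 = 1 / 2 by norm_num, Real.Gamma_one_half_eq] at h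
  have h1 : Real.Gamma (-(1 / 2)) = -2 * √Real.pi := by rw [h]; ring_nf
  have : √Real.pi ≠ 0 := by positivity
  simp only [limitMoment, muE, Nat.factorial_zero, Nat.cast_zero, Nat.cast_one, zero_mul, zero_sub, h1]
  field_simp
  norm_num

/-- The moments of the rescaled cost converge to those of the limit law, at the speed at which
the Hadamard product with the Catalan series approaches its leading singular term. -/
theorem isBigO_moment_sub (e : Ensemble) {L : ℕ → ℝ} (hL : IsGauge L) {p θ α : ℝ} (hθ : 0 < θ)
    (hθ2 : θ ≤ 1 / 2) (hθp : θ ≤ p) {ω : ℕ → ℝ}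
    (hω : ∃ C, 0 ≤ C ∧ ∀ k : ℕ, |ω k - α - ((k : ℝ) + 1) ^ p| ≤ C * ((k : ℝ) + 1) ^ (p - θ))
    (h1 : Asy L θ (p - 1 / 2) (Real.Gamma (p - 1 / 2) / √Real.pi)
      (hadamard (fun k => ω k - α) (momentSeries .excursion (fun k => ω k - α) 0))) (s : ℕ) :
    (fun N : ℕ => (∫ x, x ^ s ∂(rescaledLaw e ω p α N : Measure ℝ)) - limitMoment e p s)
      =O[atTop] fun N : ℕ => (N : ℝ) ^ (-θ) * L N := by
  have hp : 0 < p := by linarith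
  have hE := ExcursionRec.asy hL hθ hθ2 hθp hω (excursionRec fun k => ω k - α) h1
  have hpi : √Real.pi ≠ 0 := by positivity
  have hpi' : 1 / √Real.pi ≠ 0 := by positivity
  simp_rw [integral_pow_rescaledLaw]
  cases e with
  | excursion =>
    rcases s with _ | s
    · refine IsBigO.congr_left (isBigO_zero _ _) fun N => ?_
      have h2 : coeff N (momentSeries .excursion (fun k => ω k - α) 0) ≠ 0 := by
        rw [coeff_momentSeries_excursion_zero, normCatalan_eq_div]
        have := powCoeff_pos (β := 1 / 2) (by norm_num) N
        positivity
      rw [limitMoment_excursion_zero, div_self h2]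
      simp
    · have h2 := (hE s).1.coeff_asymp hL (by linarith) (by nlinarith [(Nat.cast_nonneg s : (0 : ℝ) ≤ s)])
      have h3 := isBigO_ratio_sub hL hθ.le (by linarith) (x := -3 / 2)
        (y := ((s + 1 : ℕ) : ℝ) * (p + 1 / 2)) (B := 1 / √Real.pi) (a := fun N =>
          coeff N (momentSeries .excursion (fun k => ω k - α) (s + 1)))
        (d := fun N => coeff N (momentSeries .excursion (fun k => ω k - α) 0))
        (A := 4 * muE p (s + 1) / Real.Gamma ((s + 1) * (p + 1 / 2) - 1 / 2)) hpi' (by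
          convert h2 using 7 <;> push_cast <;> ring_nf) (by
          obtain ⟨C, hC, h⟩ := normCatalan_asymp
          refine ⟨2 * C, by positivity, fun N => ?_⟩
          have e1 : 2 * normCatalan N - 1 / √Real.pi * ((N : ℝ) + 1) ^ (-3 / 2 : ℝ) =
            2 * (normCatalan N - ((N : ℝ) + 1) ^ (-3 / 2 : ℝ) / (2 * √Real.pi)) := by
            field_simp
          rw [coeff_momentSeries_excursion_zero, e1, abs_mul, abs_two, mul_assoc,
            show (-3 / 2 - 1 : ℝ) = -5 / 2 by norm_num]
          gcongr
          exact h N)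
      refine (h3.const_mul_left ((s + 1).factorial : ℝ)).congr_left fun N => ?_
      rw [mul_sub]
      congr 1
      simp only [limitMoment]
      push_cast
      field_simp
  | bridge =>
    have h2 := (BridgeRec.asy hL hθ hθ2 hθp (excursionRec fun k => ω k - α)
      (bridgeRec fun k => ω k - α) (fun s => (hE s).2) s).coeff_asymp hL (by linarith)
        (by nlinarith [(Nat.cast_nonneg s : (0 : ℝ) ≤ s)])
    have h3 := isBigO_ratio_sub hL hθ.le (by linarith) (x := -1 / 2)
      (y := (s : ℝ) * (p + 1 / 2)) (B := 1 / √Real.pi) (a := fun N =>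
        coeff N (momentSeries .bridge (fun k => ω k - α) s))
      (d := fun N => coeff N (momentSeries .bridge (fun k => ω k - α) 0))
      (A := muB p s / Real.Gamma (s * (p + 1 / 2) + 1 / 2)) hpi' (by
        convert h2 using 7 <;> ring_nf) (by
        obtain ⟨C, hC, h⟩ := powCoeff_asymp (β := 1 / 2) (by norm_num)
        refine ⟨C, hC, fun N => ?_⟩
        rw [BridgeRec.zero (excursionRec fun k => ω k - α) (bridgeRec _), coeff_powSeries]
        convert h N using 2
        · rw [Real.Gamma_one_half_eq, show (1 / 2 - 1 : ℝ) = -1 / 2 by norm_num]; ring_nf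
        · norm_num)
    refine (h3.const_mul_left (s.factorial : ℝ)).congr_left fun N => ?_
    rw [mul_sub]
    congr 1
    simp only [limitMoment]
    field_simp

theorem IsGauge.tendsto_rpow_mul {L : ℕ → ℝ} (hL : IsGauge L) {θ : ℝ} (hθ : 0 < θ) :
    Tendsto (fun N : ℕ => (N : ℝ) ^ (-θ) * L N) atTop (𝓝 0) := by
  obtain ⟨C, hC, h⟩ := hL.le_rpow (θ / 2) (by positivity)
  have h1 : Tendsto (fun N : ℕ => C * 2 ^ (θ / 2) * (N : ℝ) ^ (-(θ / 2))) atTop (𝓝 0) := by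
    have := ((tendsto_rpow_neg_atTop (y := θ / 2) (by positivity)).comp
      (tendsto_natCast_atTop_atTop (R := ℝ))).const_mul (C * 2 ^ (θ / 2))
    rwa [mul_zero] at this
  refine squeeze_zero' (Eventually.of_forall fun N => mul_nonneg (by positivity) (hL.pos N).le)
    ?_ h1
  filter_upwards [eventually_ge_atTop 1] with N hN
  have hN1 : (1 : ℝ) ≤ N := by exact_mod_cast hN
  have e1 : (N : ℝ) ^ (-θ) = (N : ℝ) ^ (-(θ / 2)) * (N : ℝ) ^ (-(θ / 2)) := by
    rw [← Real.rpow_add (by positivity)]; ring_nf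
  have e2 : (N : ℝ) ^ (-(θ / 2)) * (N : ℝ) ^ (θ / 2) = 1 := by
    rw [← Real.rpow_add (by positivity)]; simp
  calc (N : ℝ) ^ (-θ) * L N ≤ (N : ℝ) ^ (-θ) * (C * (2 * N) ^ (θ / 2)) := by
        gcongr
        refine (h N).trans ?_
        gcongr
        linarith
    _ = C * 2 ^ (θ / 2) * (N : ℝ) ^ (-(θ / 2)) * ((N : ℝ) ^ (-(θ / 2)) * (N : ℝ) ^ (θ / 2)) := by
        rw [Real.mul_rpow (by norm_num) (by positivity), e1]; ring
    _ = _ := by rw [e2, mul_one]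

theorem tendsto_moment {e : Ensemble} {L : ℕ → ℝ} (hL : IsGauge L) {p θ α : ℝ} (hθ : 0 < θ)
    {ω : ℕ → ℝ} (h : ∀ s : ℕ,
      (fun N : ℕ => (∫ x, x ^ s ∂(rescaledLaw e ω p α N : Measure ℝ)) - limitMoment e p s)
        =O[atTop] fun N : ℕ => (N : ℝ) ^ (-θ) * L N) (s : ℕ) :
    Tendsto (fun N : ℕ => ∫ x, x ^ s ∂(rescaledLaw e ω p α N : Measure ℝ)) atTop
      (𝓝 (limitMoment e p s)) := by
  have := ((h s).trans_tendsto (hL.tendsto_rpow_mul hθ)).add_const (limitMoment e p s)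
  simpa using this

theorem IsAlpha.isBigO_moment_sub (e : Ensemble) {ω : ℕ → ℝ} {p η α : ℝ} (hp : 0 < p)
    (hp2 : p ≠ 1 / 2) (hη : 0 < η) (hω : HasGrowth ω p η) (h : IsAlpha ω p η α) (s : ℕ) :
    (fun N : ℕ => (∫ x, x ^ s ∂(rescaledLaw e ω p α N : Measure ℝ)) - limitMoment e p s)
      =O[atTop] fun N : ℕ => (N : ℝ) ^ (-(min p (min η (1 / 2)))) * 1 :=
  PAiry.isBigO_moment_sub e isGauge_one (lt_min hp (lt_min hη (by norm_num)))
    ((min_le_right _ _).trans (min_le_right _ _)) (min_le_left _ _) (hω.sub_const_bound α)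
    (h.asy hp hp2 hω) s

theorem HasGrowth.isBigO_moment_sub_log (e : Ensemble) {ω : ℕ → ℝ} {p η : ℝ} (hp : 0 < p)
    (hp2 : p ≠ 1 / 2) (hη0 : 0 < η) (hω : HasGrowth ω p η) (hη : η = p - 1 / 2) (hη2 : η ≤ 1 / 2)
    (α : ℝ) (s : ℕ) :
    (fun N : ℕ => (∫ x, x ^ s ∂(rescaledLaw e ω p α N : Measure ℝ)) - limitMoment e p s)
      =O[atTop] fun N : ℕ => (N : ℝ) ^ (-(min p (min η (1 / 2)))) * (1 + Real.log ((N : ℝ) + 1)) :=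
  PAiry.isBigO_moment_sub e isGauge_log (lt_min hp (lt_min hη0 (by norm_num)))
    ((min_le_right _ _).trans (min_le_right _ _)) (min_le_left _ _) (hω.sub_const_bound α)
    (hω.asy_log hp hp2 hη hη2 α) s

theorem isBigO_one_add_log :
    (fun N : ℕ => 1 + Real.log ((N : ℝ) + 1)) =O[atTop] fun N : ℕ => Real.log N := by
  refine IsBigO.of_bound 4 ?_
  filter_upwards [eventually_ge_atTop 3] with N hN
  have hN3 : (3 : ℝ) ≤ N := by exact_mod_cast hN
  have h1 : 1 ≤ Real.log N := by
    rw [Real.le_log_iff_exp_le (by positivity)]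
    exact Real.exp_one_lt_d9.le.trans (by linarith)
  have h2 : Real.log ((N : ℝ) + 1) ≤ Real.log ((N : ℝ) ^ 2) :=
    Real.log_le_log (by positivity) (by nlinarith)
  rw [Real.log_pow] at h2
  have h3 : 0 ≤ Real.log ((N : ℝ) + 1) := Real.log_nonneg (by linarith)
  rw [Real.norm_of_nonneg (by positivity), Real.norm_of_nonneg (by positivity)]
  push_cast at h2
  linarith

/-! ### The limit law -/

theorem hasGrowth_rpow (p η : ℝ) : HasGrowth (fun k => (k : ℝ) ^ p) p η := by
  simp only [HasGrowth, sub_self]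
  exact isBigO_zero _ _

theorem tendsto_rescaledLaw {e : Ensemble} {p : ℝ} (hp : 0 < p) {ρ : ProbabilityMeasure ℝ}
    (hρ : HasMoments ρ (limitMoment e p)) {ω : ℕ → ℝ} {α : ℝ} (h : ∀ s : ℕ,
      Tendsto (fun N : ℕ => ∫ x, x ^ s ∂(rescaledLaw e ω p α N : Measure ℝ)) atTop
        (𝓝 (limitMoment e p s))) :
    Tendsto (rescaledLaw e ω p α) atTop (𝓝 ρ) :=
  HasMoments.tendsto (tendsto_even_limitMoment e hp) hρ (integrable_pow_rescaledLaw e ω p α) h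

theorem exists_hasMoments_limitMoment (e : Ensemble) {p : ℝ} (hp : 0 < p) (hp2 : p ≠ 1 / 2) :
    ∃ ρ : ProbabilityMeasure ℝ, HasMoments ρ (limitMoment e p) := by
  obtain ⟨α, hα⟩ := exists_isAlpha (η := 1) hp hp2 (hasGrowth_rpow p 1) (by norm_num)
  exact exists_hasMoments (integrable_pow_rescaledLaw e _ p α) (tendsto_moment isGauge_one
    (lt_min hp (lt_min one_pos (by norm_num)))
    (hα.isBigO_moment_sub e hp hp2 one_pos (hasGrowth_rpow p 1)))

/-- For `p > 1 / 2` the centring may be dropped, and the cost function `k ^ p` is nonnegative. -/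
theorem measure_Iio_zero (e : Ensemble) {p : ℝ} (hp : 1 / 2 < p) {ρ : ProbabilityMeasure ℝ}
    (hρ : HasMoments ρ (limitMoment e p)) : (ρ : Measure ℝ) (Set.Iio 0) = 0 := by
  have hp0 : 0 < p := by linarith
  -- The rate `η` is so small that a constant is absorbed by the error term.
  set η : ℝ := min (p - 1 / 2) (1 / 2) / 2 with hη
  have hη0 : 0 < η := by
    have : 0 < min (p - 1 / 2) (1 / 2) := lt_min (by linarith) (by norm_num)
    positivity
  have hη1 : η < p - 1 / 2 := by linarith [min_le_left (p - 1 / 2) (1 / 2)]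
  have hη2 : η < 1 / 2 := by linarith [min_le_right (p - 1 / 2) (1 / 2 : ℝ)]
  have hg := hasGrowth_rpow p η
  obtain ⟨α, hα⟩ := exists_isAlpha hp0 hp.ne' hg fun h => hη1.ne h.1
  have h0 : IsAlpha (fun k => (k : ℝ) ^ p) p η 0 := by
    rw [isAlpha_iff hp0 hp.ne' hg] at hα ⊢
    have h1 : (fun _ : ℝ => α) =O[𝓝[<] 1] fun z : ℝ => (1 - z) ^ (-(p - 1 / 2 - min η (1 / 2))) := by
      have h2 := isBigO_one_sub_rpow (a := 0) (b := -(p - 1 / 2 - min η (1 / 2)))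
        (by rw [min_eq_left hη2.le]; linarith)
      simp only [Real.rpow_zero] at h2
      exact (isBigO_const_const α one_ne_zero _).trans h2
    refine (hα.add h1).congr_left fun z => ?_
    ring
  refine measure_Iio_zero_of_tendsto (tendsto_rescaledLaw hp0 hρ (tendsto_moment isGauge_one
    (lt_min hp0 (lt_min hη0 (by norm_num))) (h0.isBigO_moment_sub e hp0 hp.ne' hη0 hg))) fun N => ?_
  rw [coe_rescaledLaw, Measure.smul_apply, Measure.finsetSum_apply,
    Finset.sum_eq_zero, smul_zero]
  intro l _
  have h1 : 0 ≤ (cost (fun k => (k : ℝ) ^ p) l - 0 * N) / (N : ℝ) ^ (p + 1 / 2) := by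
    have : 0 ≤ cost (fun k => (k : ℝ) ^ p) l := Finset.sum_nonneg fun _ _ => by positivity
    rw [zero_mul, sub_zero]
    positivity
  rw [Measure.dirac_apply' _ measurableSet_Iio, Set.indicator_of_notMem (by simpa using h1)]

end PAiry

end

theorem mainTheorem1 (p : ℝ) (hp : 0 < p) (hp2 : p ≠ 1 / 2) (e : PAiry.Ensemble) :
    ∃ ρ : ProbabilityMeasure ℝ,
      PAiry.HasMoments ρ (PAiry.limitMoment e p) ∧
      (∀ ρ' : ProbabilityMeasure ℝ, PAiry.HasMoments ρ' (PAiry.limitMoment e p) → ρ' = ρ) ∧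
      (1 / 2 < p → (ρ : Measure ℝ) (Set.Iio 0) = 0) ∧
      ∀ (η : ℝ), 0 < η → ∀ ω : ℕ → ℝ, PAiry.HasGrowth ω p η →
        (¬(η = p - 1 / 2 ∧ η ≤ 1 / 2) → ∃ α : ℝ, PAiry.IsAlpha ω p η α) ∧
        (p - 1 / 2 < min η (1 / 2) → ∃! α : ℝ, PAiry.IsAlpha ω p η α) ∧
        (∀ α : ℝ, PAiry.IsAlpha ω p η α →
          Tendsto (PAiry.rescaledLaw e ω p α) atTop (𝓝 ρ) ∧
          ∀ s : ℕ,
            (fun N : ℕ => (∫ x, x ^ s ∂(PAiry.rescaledLaw e ω p α N : Measure ℝ))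
                - PAiry.limitMoment e p s)
              =O[atTop] fun N : ℕ => (N : ℝ) ^ (-(min p (min η (1 / 2))))) ∧
        (η = p - 1 / 2 → η ≤ 1 / 2 → ∀ α : ℝ,
          Tendsto (PAiry.rescaledLaw e ω p α) atTop (𝓝 ρ) ∧
          ∀ s : ℕ,
            (fun N : ℕ => (∫ x, x ^ s ∂(PAiry.rescaledLaw e ω p α N : Measure ℝ))
                - PAiry.limitMoment e p s)
              =O[atTop] fun N : ℕ => (N : ℝ) ^ (-(min p (min η (1 / 2)))) * Real.log N) := by
  obtain ⟨ρ, hρ⟩ := PAiry.exists_hasMoments_limitMoment e hp hp2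
  refine ⟨ρ, hρ, fun ρ' h => h.unique (PAiry.tendsto_even_limitMoment e hp) hρ,
    fun h => PAiry.measure_Iio_zero e h hρ, fun η hη ω hω => ⟨PAiry.exists_isAlpha hp hp2 hω,
    fun hlt => ?_, fun α hα => ?_, fun h1 h2 α => ?_⟩⟩
  · obtain ⟨α, hα⟩ := PAiry.exists_isAlpha hp hp2 hω fun h => by
      rw [min_eq_left h.2] at hlt; exact hlt.ne' h.1
    exact ⟨α, hα, fun α' h => h.unique hlt hα⟩
  · have h := hα.isBigO_moment_sub e hp hp2 hη hω
    refine ⟨PAiry.tendsto_rescaledLaw hp hρ (PAiry.tendsto_moment PAiry.isGauge_one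
      (lt_min hp (lt_min hη (by norm_num))) h), fun s => ?_⟩
    simpa only [mul_one] using h s
  · have h := hω.isBigO_moment_sub_log e hp hp2 hη h1 h2 α
    exact ⟨PAiry.tendsto_rescaledLaw hp hρ (PAiry.tendsto_moment PAiry.isGauge_log
      (lt_min hp (lt_min hη (by norm_num))) h), fun s =>
        (h s).trans ((isBigO_refl _ _).mul PAiry.isBigO_one_add_log)⟩
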